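/- **Theorem.** Let $d\ge 3$ and let $\mathbf k$ be a field of arbitrary characteristic. 1. The $d$-dimensional Swiss-cheese operad $\mathcal{SC}_d$ is not formal over $\mathbf k$. 2. If moreover $\mathbf k$ has characteristic $2$, then already the complex of $S_2$-modules $C_*(\mathcal{SC}_d(\mathfrak c,\mathfrak c;\mathfrak c);\mathbf k)$ is not formal. Here the following conventions are used. *The Swiss-cheese operad.* $\mathcal{SC}_d$ is the following symmetric topological operad with two colours, the closed colour $\mathfrak c$ and the open colour $\mathfrak o$. Let $B(x;r)$ be the open ball of centre $x\in\mathbb R^d$ and radius $r>0$ and, for $x_d=0$, let $B^+(x;r)=\{y\in B(x;r)\mid y_d>0\}$ be the semiball. The space $\mathcal{SC}_d(x_1,\dots,x_n;\mathfrak c)$ is empty if $n=0$ or if some $x_i=\mathfrak o$, and otherwise it is the space of $n$-tuples of pairwise disjoint balls contained in $B(0;1)$. The space $\mathcal{SC}_d(x_1,\dots,x_n;\mathfrak o)$ is empty if $n=0$, and otherwise it is the space of $n$-tuples $(b_1,\dots,b_n)$ of pairwise disjoint subsets of $B^+(0;1)$, where $b_i$ is a ball if $x_i=\mathfrak c$ and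 a semiball (centred on the hyperplane $x_d=0$) if $x_i=\mathfrak o$; operations with only closed inputs and open output are allowed. These spaces are topologized by centres and radii, the symmetric groups permute the labels, the units are $B(0;1)$ and $B^+(0;1)$, and $p\circ_i q$ replaces the $i$-th ball or semiball of $p$, of centre $c$ and radius $r$, by the image of the configuration $q$ under $v\mapsto c+rv$. *Formality of operads.* The singular chains over $\mathbf k$ of a (coloured, symmetric, unital) topological operad $\mathcal C$ form, through the Eilenberg–Zilber cross product, an operad $C(\mathcal C)$ in differential graded $\mathbf k$-vector spaces (dg operad), and its homology $H(\mathcal C)$ is a dg operad with zero differential. The operad $\mathcal C$ is *formal* over $\mathbf k$ if there are a dg operad $\mathcal P$ with the same colours and morphisms of dg operads $$C(\mathcal C)\xleftarrow{\ \gamma\ }\mathcal P\xrightarrow{\ \psi\ }H(\mathcal C)$$ that are quasi-isomorphisms in each arity and for all colours. *Formality of complexes of $S_2$-modules.* A complex $A$ of $\mathbf k[S_2]$-modules is *formal* if there are a complex $M$ of $\mathbf k[S_2]$-modules and $S_2$-equivariant quasi-isomorphisms $A\leftarrow M\to H_*(A)$, where $H_*(A)$ has zero differential. -/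

import Mathlib

open CategoryTheory
universe u

noncomputable section
namespace SwissCheese

/-- The inclusion of the chain degrees `ℕ` into `ℤ`. -/
def embNat : (ComplexShape.down ℕ).Embedding (ComplexShape.down ℤ) :=
  ComplexShape.Embedding.mk' _ _ (fun n : ℕ => (n : ℤ)) (fun _ _ h => by simpa using h)
    (fun i j => by simp only [ComplexShape.down_Rel]; omega)

section Chains
variable (k : Type u) [Field k]

/-- Singular chains with coefficients in `k`, as a chain complex graded by `ℤ` that is zero in
negative degrees. -/
def chainsFunctor : TopCat.{0} ⥤ ChainComplex (ModuleCat.{u} k) ℤ :=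
  (AlgebraicTopology.singularChainComplexFunctor.{0} (ModuleCat.{u} k)).obj (ModuleCat.of k k) ⋙
    embNat.extendFunctor (ModuleCat.{u} k)

/-- Singular simplices of dimension `m`. -/
abbrev Simp (m : ℕ) (X : Type) [TopologicalSpace X] := C(stdSimplex ℝ (Fin (m + 1)), X)

/-- Singular chains graded by `ℕ`. -/
abbrev natChains (X : TopCat.{0}) : ChainComplex (ModuleCat.{u} k) ℕ :=
  (TopCat.toSSet.obj X).chainComplex (ModuleCat.of k k)

/-- Singular chains of a space, graded by `ℤ`. -/
abbrev chains (X : TopCat.{0}) : ChainComplex (ModuleCat.{u} k) ℤ := (chainsFunctor k).obj X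

/-- The complex `chains k X` has the usual singular chains in nonnegative degrees. -/
def chainsXIso (X : TopCat.{0}) {n : ℤ} (m : ℕ) (h : (m : ℤ) = n) :
    (chains k X).X n ≅ (natChains k X).X m :=
  HomologicalComplex.extendXIso (natChains k X) embNat (i := m) h

variable {k}

/-- A singular simplex, as an element of the basis of the module of singular chains. -/
def gen {X : TopCat.{0}} {n : ℤ} (m : ℕ) (h : (m : ℤ) = n) (σ : Simp m X) : (chains k X).X n :=
  (chainsXIso k X m h).inv.hom
    (((TopCat.toSSet.obj X).ιChainComplex (R := ModuleCat.of k k)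
      ((TopCat.toSSetObjEquiv X (.op (.mk m))).symm σ)).hom (1 : k))

variable {X Y : TopCat.{0}} {M : Type u} [AddCommGroup M] [Module k M]

theorem chains_ext {n : ℤ} {f g : (chains k X).X n →ₗ[k] M}
    (h : ∀ m hm σ, f (gen m hm σ) = g (gen m hm σ)) : f = g := by
  by_cases hn : ∃ m : ℕ, (m : ℤ) = n
  · obtain ⟨m, hm⟩ := hn
    have : (chainsXIso k X m hm).inv ≫ ModuleCat.ofHom f =
        (chainsXIso k X m hm).inv ≫ ModuleCat.ofHom g := by
      apply SSet.chainComplex_hom_ext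
      intro x
      apply ModuleCat.hom_ext
      apply LinearMap.ext_ring
      have := h m hm (TopCat.toSSetObjEquiv X (.op (.mk m)) x)
      rw [gen, Equiv.symm_apply_apply] at this
      exact this
    have := (cancel_epi _).1 this
    exact congrArg ModuleCat.Hom.hom this
  · have h0 : Limits.IsZero ((chains k X).X n) :=
      HomologicalComplex.isZero_extend_X _ embNat n (fun i hi => hn ⟨i, hi⟩)
    have := h0.eq_of_src (ModuleCat.ofHom f) (ModuleCat.ofHom g)
    exact congrArg ModuleCat.Hom.hom this

/-- The linear map on singular chains of degree `m` with given values on singular simplices. -/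
def natLift (m : ℕ) (φ : Simp m X → M) : (natChains k X).X m ⟶ ModuleCat.of k M :=
  Limits.Cofan.IsColimit.desc ((TopCat.toSSet.obj X).isColimitChainComplexXCofan _ _)
    (fun x => ModuleCat.ofHom (LinearMap.toSpanSingleton k M
      (φ (TopCat.toSSetObjEquiv X (.op (.mk m)) x))))

theorem natLift_gen (m : ℕ) (φ : Simp m X → M) (σ : Simp m X) :
    (natLift (k := k) m φ).hom (((TopCat.toSSet.obj X).ιChainComplex (R := ModuleCat.of k k)
      ((TopCat.toSSetObjEquiv X (.op (.mk m))).symm σ)).hom (1 : k)) = φ σ := by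
  have := congr(($(Limits.Cofan.IsColimit.fac
    ((TopCat.toSSet.obj X).isColimitChainComplexXCofan (ModuleCat.of k k) m)
    (fun x => ModuleCat.ofHom (LinearMap.toSpanSingleton k M
      (φ (TopCat.toSSetObjEquiv X (.op (.mk m)) x))))
        ((TopCat.toSSetObjEquiv X (.op (.mk m))).symm σ))).hom (1 : k))
  rw [Equiv.apply_symm_apply] at this
  exact this.trans (one_smul k _)

open Classical in
/-- The linear map on singular chains of degree `n` with given values on singular simplices. -/
def chainsLift {n : ℤ} (φ : ∀ m : ℕ, (m : ℤ) = n → Simp m X → M) : (chains k X).X n →ₗ[k] M :=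
  if h : ∃ m : ℕ, (m : ℤ) = n then
    ((chainsXIso k X h.choose h.choose_spec).hom ≫ natLift _ (φ h.choose h.choose_spec)).hom
  else 0

@[simp]
theorem chainsLift_gen {n : ℤ} (φ : ∀ m : ℕ, (m : ℤ) = n → Simp m X → M) (m : ℕ) (h : (m : ℤ) = n)
    (σ : Simp m X) : chainsLift φ (gen (k := k) m h σ) = φ m h σ := by
  have hn : ∃ m : ℕ, (m : ℤ) = n := ⟨m, h⟩
  obtain rfl : m = hn.choose := by have := hn.choose_spec; omega
  rw [chainsLift, dif_pos hn, gen, ModuleCat.hom_comp, LinearMap.comp_apply,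
    ← LinearMap.comp_apply (chainsXIso k X _ _).hom.hom, ← ModuleCat.hom_comp, Iso.inv_hom_id]
  exact natLift_gen _ _ _

theorem chains_map_gen (f : X ⟶ Y) {n : ℤ} (m : ℕ) (h : (m : ℤ) = n) (σ : Simp m X) :
    (((chainsFunctor k).map f).f n).hom (gen m h σ) = gen m h (f.hom.comp σ) := by
  have h1 : ((chainsFunctor k).map f).f n = (chainsXIso k X m h).hom ≫
    (SSet.chainComplexMap (TopCat.toSSet.map f) (ModuleCat.of k k)).f m ≫ (chainsXIso k Y m h).inv :=
    HomologicalComplex.extendMap_f _ _ _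
  rw [h1]
  have := congr(($(SSet.ι_chainComplexMap_f _ _ (TopCat.toSSet.map f) (R := ModuleCat.of k k)
    ((TopCat.toSSetObjEquiv X (.op (.mk m))).symm σ))).hom (1 : k))
  rw [ModuleCat.hom_comp, ModuleCat.hom_comp, LinearMap.comp_apply, LinearMap.comp_apply, gen,
    ← LinearMap.comp_apply (chainsXIso k X _ _).hom.hom, ← ModuleCat.hom_comp, Iso.inv_hom_id]
  refine Eq.trans (congrArg (chainsXIso k Y m h).inv.hom this) ?_
  rfl

theorem chains_d_gen {n n' : ℤ} (m : ℕ) (h : ((m + 1 : ℕ) : ℤ) = n) (h' : (m : ℤ) = n') (σ : Simp (m + 1) X) :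
    ((chains k X).d n n').hom (gen (m + 1) h σ) =
      ∑ i : Fin (m + 2), (-1 : k) ^ (i : ℕ) • gen m h' (σ.comp ⟨_, stdSimplex.continuous_map i.succAbove⟩) := by
  have h1 : (chains k X).d n n' = (chainsXIso k X (m + 1) h).hom ≫
    (natChains k X).d (m + 1) m ≫ (chainsXIso k X m h').inv :=
    HomologicalComplex.extend_d_eq _ _ _ _
  rw [h1]
  have := congr(($(SSet.ιChainComplex_d (TopCat.toSSet.obj X) (R := ModuleCat.of k k)
    ((TopCat.toSSetObjEquiv X (.op (.mk (m + 1)))).symm σ))).hom (1 : k))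
  rw [ModuleCat.hom_comp, ModuleCat.hom_comp, LinearMap.comp_apply, LinearMap.comp_apply, gen,
    ← LinearMap.comp_apply (chainsXIso k X _ _).hom.hom, ← ModuleCat.hom_comp, Iso.inv_hom_id]
  refine Eq.trans (congrArg (chainsXIso k X m h').inv.hom this) ?_
  rw [ModuleCat.hom_sum, LinearMap.sum_apply, map_sum]
  refine Finset.sum_congr rfl fun i _ => ?_
  rw [ModuleCat.hom_zsmul, LinearMap.smul_apply, map_zsmul, ← Int.cast_smul_eq_zsmul k]
  push_cast
  rfl

theorem chains_d_gen_zero {n n' : ℤ} (h : ((0 : ℕ) : ℤ) = n) (σ : Simp 0 X) :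
    ((chains k X).d n n').hom (gen 0 h σ) = 0 := by
  by_cases hn : n' = -1
  · have h0 : Limits.IsZero ((chains k X).X n') :=
      HomologicalComplex.isZero_extend_X _ embNat n' (fun i hi => by
        change (i : ℤ) = _ at hi; omega)
    have := h0.eq_of_tgt ((chains k X).d n n') 0
    simp [this]
  · rw [HomologicalComplex.shape]
    · simp
    · simp; omega

end Chains
section Shuffle
variable (k : Type u) [Field k] {α β γ α' β' : Type}

/-- Linear combinations of words in the alphabet `α`. -/
abbrev Words (α : Type) := List α →₀ k

variable {k}

/-- Adding a letter in front of a word. -/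
def wcons (a : α) : Words k α →ₗ[k] Words k α := Finsupp.lmapDomain k k (List.cons a)

/-- The signed sum of all the lattice paths in the grid `u × v` that go from its first to its last
point and increase one of the two coordinates by one at each step. These paths correspond to the
shuffles of the steps of `u` with those of `v`; the sign is that of the shuffle, namely `-1` to the
number of pairs formed by a step in the direction `v` and a later step in the direction `u`. In the
last clause the first step goes in the direction `u`, or in the direction `v` and then comes before
the `u.length` steps in the direction `u`. -/
def shuffleWord : List α → List β → Words k (α × β)
  | [], _ => 0
  | _ :: _, [] => 0
  | [a], [b] => Finsupp.single [(a, b)] 1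
  | a :: u, b :: v => wcons (a, b) (shuffleWord u (b :: v) +
      (-1 : k) ^ u.length • shuffleWord (a :: u) v)
  termination_by u v => u.length + v.length

open Classical in
/-- Equal to `1` for the empty word, and to `0` otherwise. -/
def emp (u : List α) : k := if u = [] then 1 else 0

/-- The empty word. -/
def wnil : Words k α := Finsupp.single [] 1

theorem shuffleWord_nil_left (v : List β) : shuffleWord (k := k) ([] : List α) v = 0 := by
  rw [shuffleWord]

theorem shuffleWord_nil_right (u : List α) : shuffleWord (k := k) u ([] : List β) = 0 := by
  cases u <;> rw [shuffleWord]

theorem shuffleWord_cons (a : α) (u : List α) (b : β) (v : List β) :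
    shuffleWord (k := k) (a :: u) (b :: v) = wcons (a, b) (shuffleWord u (b :: v) +
      (-1 : k) ^ u.length • shuffleWord (a :: u) v + (emp (k := k) u * emp v) • wnil) := by
  cases u with
  | nil =>
    cases v with
    | nil => simp [shuffleWord, shuffleWord_nil_left, shuffleWord_nil_right, emp, wcons, wnil]
    | cons b' v =>
      have : shuffleWord (k := k) [a] (b :: b' :: v) = wcons (a, b)
          (shuffleWord [] (b :: b' :: v) + (-1 : k) ^ 0 • shuffleWord [a] (b' :: v)) := by
        rw [shuffleWord.eq_4] <;> simp
      rw [this]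
      simp [emp]
  | cons a' u => rw [shuffleWord] <;> simp [emp]

/-- Bilinear extension of `shuffleWord`. -/
def shuffle : Words k α →ₗ[k] Words k β →ₗ[k] Words k (α × β) :=
  Finsupp.linearCombination k fun u => Finsupp.linearCombination k fun v => shuffleWord u v

@[simp] theorem shuffle_single (u : List α) (v : List β) :
    shuffle (Finsupp.single u (1 : k)) (Finsupp.single v 1) = shuffleWord u v := by
  simp [shuffle]

/-- Linear extension of `emp`. -/
def wemp : Words k α →ₗ[k] k := Finsupp.linearCombination k emp
/-- Linear extension of the function equal to `1` for words with one letter, and to `0` otherwise. -/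
def wlen1 : Words k α →ₗ[k] k := Finsupp.linearCombination k fun u => match u with
  | [_] => 1
  | _ => 0
/-- The linear map multiplying a word with `l` letters by `(-1)^l`. -/
def wsign : Words k α →ₗ[k] Words k α :=
  Finsupp.linearCombination k fun u => Finsupp.single u ((-1 : k) ^ u.length)

/-- The alternating sum of the words obtained by erasing one letter. -/
def bdryWord : List α → Words k α
  | [] => 0
  | a :: u => Finsupp.single u 1 - wcons a (bdryWord u)
/-- Linear extension of `bdryWord`. -/
def bdry : Words k α →ₗ[k] Words k α := Finsupp.linearCombination k bdryWord

@[simp] theorem wcons_single (a : α) (u : List α) (c : k) :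
    wcons a (Finsupp.single u c) = Finsupp.single (a :: u) c := by simp [wcons]

theorem words_ext {M : Type*} [AddCommGroup M] [Module k M] {f g : Words k α →ₗ[k] M}
    (h : ∀ u, f (Finsupp.single u 1) = g (Finsupp.single u 1)) (x : Words k α) : f x = g x := by
  have : f = g := by
    apply Finsupp.lhom_ext'
    intro u
    apply LinearMap.ext_ring
    exact h u
  rw [this]

theorem bdry_wcons (a : α) (x : Words k α) : bdry (wcons a x) = x - wcons a (bdry x) := by
  refine words_ext (f := bdry ∘ₗ wcons a) (g := LinearMap.id - wcons a ∘ₗ bdry) (fun u => ?_) x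
  simp [bdry, bdryWord]

theorem wsign_wcons (a : α) (x : Words k α) : wsign (wcons a x) = - wcons a (wsign x) := by
  refine words_ext (f := wsign ∘ₗ wcons a) (g := -(wcons (k := k) a ∘ₗ wsign)) (fun u => ?_) x
  simp [wsign, pow_succ]

theorem wsign_wsign (x : Words k α) : wsign (wsign x) = x := by
  refine words_ext (f := wsign ∘ₗ wsign) (g := LinearMap.id) (fun u => ?_) x
  simp [wsign, ← pow_add, ← two_mul]

theorem wsign_bdry (x : Words k α) : wsign (bdry x) = - bdry (wsign x) := by
  refine words_ext (f := wsign ∘ₗ bdry) (g := -(bdry (k := k) ∘ₗ wsign)) (fun u => ?_) x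
  induction u with
  | nil => simp [bdry, bdryWord, wsign]
  | cons a u ih =>
    simp only [LinearMap.comp_apply, LinearMap.neg_apply] at ih ⊢
    rw [← wcons_single, wsign_wcons, bdry_wcons, map_sub, wsign_wcons, ih, map_neg, map_neg,
      bdry_wcons]
    abel

theorem wemp_wcons (a : α) (x : Words k α) : wemp (wcons a x) = 0 := by
  refine words_ext (f := wemp ∘ₗ wcons a) (g := 0) (fun u => ?_) x
  simp [wemp, emp]

theorem wemp_wsign (x : Words k α) : wemp (wsign x) = wemp x := by
  refine words_ext (f := wemp ∘ₗ wsign) (g := wemp) (fun u => ?_) x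
  cases u <;> simp [wemp, emp, wsign]

theorem wlen1_wcons (a : α) (x : Words k α) : wlen1 (wcons a x) = wemp x := by
  refine words_ext (f := wlen1 ∘ₗ wcons a) (g := wemp) (fun u => ?_) x
  cases u <;> simp [wemp, emp, wlen1]

theorem wemp_bdry (x : Words k α) : wemp (bdry x) = wlen1 x := by
  refine words_ext (f := wemp ∘ₗ bdry) (g := wlen1) (fun u => ?_) x
  cases u with
  | nil => simp [bdry, bdryWord, wemp, wlen1]
  | cons a u =>
    simp only [LinearMap.comp_apply]
    rw [← wcons_single, bdry_wcons, map_sub, wemp_wcons, wlen1_wcons, sub_zero]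

theorem shuffle_wcons (a : α) (x : Words k α) (b : β) (y : Words k β) :
    shuffle (wcons a x) (wcons b y) = wcons (a, b) (shuffle x (wcons b y) +
      shuffle (wcons a (wsign x)) y + (wemp x * wemp y) • wnil) := by
  refine words_ext (f := (shuffle (k := k)).flip (wcons b y) ∘ₗ wcons a)
    (g := wcons (a, b) ∘ₗ ((shuffle (k := k)).flip (wcons b y) +
      (shuffle (k := k)).flip y ∘ₗ wcons a ∘ₗ wsign +
        (LinearMap.toSpanSingleton k _ (wemp y • wnil)) ∘ₗ wemp)) (fun u => ?_) x |>.trans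
        (by simp [mul_smul])
  refine words_ext (f := shuffle (k := k) (wcons a (Finsupp.single u 1)) ∘ₗ wcons b)
    (g := wcons (a, b) ∘ₗ (shuffle (k := k) (Finsupp.single u 1) ∘ₗ wcons b +
      shuffle (k := k) (wcons a (wsign (Finsupp.single u 1))) +
        (LinearMap.toSpanSingleton k _ (wemp (Finsupp.single u (1 : k)) • wnil)) ∘ₗ wemp)) (fun v => ?_) y |>.trans
        (by simp [smul_smul, mul_comm])
  have : wsign (Finsupp.single u (1 : k)) = (-1 : k) ^ u.length • Finsupp.single u 1 := by
    simp [wsign]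
  simp only [LinearMap.comp_apply, LinearMap.add_apply, this, map_smul, LinearMap.smul_apply,
    wcons_single, shuffle_single, shuffleWord_cons]
  simp [wemp, smul_smul, mul_comm]

theorem shuffle_nil_left (y : Words k β) : shuffle (wnil : Words k α) y = 0 := by
  refine words_ext (f := shuffle (wnil : Words k α)) (g := 0) (fun u => ?_) y
  simp [wnil, shuffleWord_nil_left]
theorem shuffle_nil_right (x : Words k α) : shuffle x (wnil : Words k β) = 0 := by
  refine words_ext (f := shuffle.flip (wnil : Words k β)) (g := 0) (fun u => ?_) x
  simp [wnil, shuffleWord_nil_right]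

theorem wsign_single (u : List α) :
    wsign (Finsupp.single u (1 : k)) = (-1 : k) ^ u.length • Finsupp.single u 1 := by
  simp [wsign]

theorem bdry_step (a : α) (b : β) (x : Words k α) (y : Words k β)
    (ih1 : bdry (shuffle x (wcons b y)) = shuffle (bdry x) (wcons b y) -
      shuffle (wsign x) (bdry (wcons b y)) + (wlen1 x * wlen1 (wcons b y)) • wnil)
    (ih2 : bdry (shuffle (wcons a (wsign x)) y) = shuffle (bdry (wcons a (wsign x))) y -
      shuffle (wsign (wcons a (wsign x))) (bdry y) +
      (wlen1 (wcons a (wsign x)) * wlen1 y) • wnil) :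
    bdry (shuffle (wcons a x) (wcons b y)) = shuffle (bdry (wcons a x)) (wcons b y) -
      shuffle (wsign (wcons a x)) (bdry (wcons b y)) +
      (wlen1 (wcons a x) * wlen1 (wcons b y)) • wnil := by
  have h0 : bdry (wnil : Words k (α × β)) = 0 := by simp [bdry, wnil, bdryWord]
  rw [bdry_wcons, wlen1_wcons, map_sub] at ih1
  rw [bdry_wcons, wsign_wcons, wsign_wsign, map_neg, LinearMap.neg_apply, map_sub,
    LinearMap.sub_apply, wlen1_wcons, wemp_wsign] at ih2
  rw [shuffle_wcons, bdry_wcons, map_add bdry, map_add bdry, map_smul bdry, h0, ih1, ih2,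
    bdry_wcons, bdry_wcons, wsign_wcons, wlen1_wcons, wlen1_wcons,
    map_sub (shuffle (k := k) (α := α) (β := β)), LinearMap.sub_apply,
    map_neg (shuffle (k := k) (α := α) (β := β)), LinearMap.neg_apply, map_sub (shuffle (wcons a (wsign x))),
    shuffle_wcons a (bdry x), shuffle_wcons a (wsign x) b (bdry y), wsign_bdry, wsign_wsign,
    wemp_bdry, wemp_bdry, wemp_wsign, map_neg (wcons (k := k) a),
    map_neg (shuffle (k := k) (α := α) (β := β)), LinearMap.neg_apply]
  simp only [map_add, map_sub, map_neg, map_smul, smul_zero, map_zero]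
  generalize wcons (a, b) (shuffle (bdry x) (wcons b y)) = t1
  generalize wcons (a, b) (shuffle (wsign x) y) = t2
  generalize wcons (a, b) (shuffle (wsign x) (wcons b (bdry y))) = t3
  generalize wcons (a, b) (shuffle (wcons a (bdry (wsign x))) y) = t4
  generalize wcons (a, b) (shuffle (wcons a x) (bdry y)) = t5
  generalize shuffle x (wcons b y) = t6
  generalize shuffle (wcons a (wsign x)) y = t7
  generalize (wcons (a, b) wnil : Words k (α × β)) = t8
  generalize (wnil : Words k (α × β)) = t9
  module

theorem bdry_shuffleWord : ∀ (u : List α) (v : List β),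
    bdry (shuffle (Finsupp.single u (1 : k)) (Finsupp.single v 1)) =
      shuffle (bdry (Finsupp.single u 1)) (Finsupp.single v 1) -
        shuffle (wsign (Finsupp.single u 1)) (bdry (Finsupp.single v 1)) +
        (wlen1 (Finsupp.single u (1 : k)) * wlen1 (Finsupp.single v (1 : k))) • wnil
  | [], v => by
    have h1 := shuffle_nil_left (k := k) (α := α) (β := β)
    rw [wnil] at h1
    have h2 : bdry (Finsupp.single ([] : List α) (1 : k)) = 0 := by simp [bdry, bdryWord]
    rw [wsign_single, h2]
    simp [h1, wlen1]
  | u, [] => by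
    have h1 := shuffle_nil_right (k := k) (α := α) (β := β)
    rw [wnil] at h1
    have h2 : bdry (Finsupp.single ([] : List β) (1 : k)) = 0 := by simp [bdry, bdryWord]
    rw [wsign_single, h2]
    simp [h1, wlen1]
  | a :: u, b :: v => by
    have ih1 := bdry_shuffleWord u (b :: v)
    have ih2 := bdry_shuffleWord (a :: u) v
    rw [← wcons_single] at ih1 ih2
    rw [← wcons_single, ← wcons_single b]
    have hx := wsign_single (k := k) u
    set x := Finsupp.single u (1 : k)
    set y := Finsupp.single v (1 : k)
    have ih3 : bdry (shuffle (wcons a (wsign x)) y) = shuffle (bdry (wcons a (wsign x))) y -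
        shuffle (wsign (wcons a (wsign x))) (bdry y) +
        (wlen1 (wcons a (wsign x)) * wlen1 y) • wnil := by
      rw [hx]
      simp only [map_smul, LinearMap.smul_apply, ih2, smul_add, smul_sub, smul_eq_mul, smul_smul,
        mul_assoc]
    exact bdry_step a b x y ih1 ih3
  termination_by u v => u.length + v.length

theorem wsign_shuffleWord : ∀ (u : List α) (v : List β),
    wsign (shuffle (Finsupp.single u (1 : k)) (Finsupp.single v 1)) =
      - shuffle (wsign (Finsupp.single u 1)) (wsign (Finsupp.single v 1))
  | [], v => by
    have h1 := shuffle_nil_left (k := k) (α := α) (β := β)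
    rw [wnil] at h1
    rw [wsign_single, map_smul, h1]
    simp [h1]
  | u, [] => by
    have h1 := shuffle_nil_right (k := k) (α := α) (β := β)
    rw [wnil] at h1
    rw [wsign_single, wsign_single, h1, map_smul, map_smul, LinearMap.smul_apply, h1]
    simp
  | a :: u, b :: v => by
    have ih1 := wsign_shuffleWord u (b :: v)
    have ih2 := wsign_shuffleWord (a :: u) v
    rw [← wcons_single] at ih1 ih2
    rw [← wcons_single, ← wcons_single b]
    have hx := wsign_single (k := k) u
    set x := Finsupp.single u (1 : k)
    set y := Finsupp.single v (1 : k)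
    have ih3 : wsign (shuffle (wcons a (wsign x)) y) =
        - shuffle (wsign (wcons a (wsign x))) (wsign y) := by
      rw [hx]
      simp only [map_smul, LinearMap.smul_apply, ih2, smul_neg]
    have h0 : wsign (wnil : Words k (α × β)) = wnil := by simp [wsign, wnil]
    rw [shuffle_wcons, wsign_wcons, map_add wsign, map_add wsign, ih1, ih3, wsign_wcons, wsign_wcons,
      wsign_wcons, map_neg, map_neg, map_neg, map_neg, LinearMap.neg_apply, LinearMap.neg_apply,
      shuffle_wcons, map_smul, h0, wsign_wsign, wemp_wsign, wemp_wsign]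
    simp only [map_neg, map_add]
    abel
  termination_by u v => u.length + v.length

theorem wsign_shuffle (x : Words k α) (y : Words k β) :
    wsign (shuffle x y) = - shuffle (wsign x) (wsign y) := by
  refine words_ext (f := wsign ∘ₗ (shuffle (k := k)).flip y)
    (g := -((shuffle (k := k)).flip (wsign y) ∘ₗ wsign)) (fun u => ?_) x
  exact words_ext (f := wsign ∘ₗ shuffle (Finsupp.single u (1 : k)))
    (g := -(shuffle (wsign (Finsupp.single u (1 : k))) ∘ₗ wsign))
    (fun v => wsign_shuffleWord u v) y

theorem bdry_shuffle (x : Words k α) (y : Words k β) :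
    bdry (shuffle x y) = shuffle (bdry x) y - shuffle (wsign x) (bdry y) +
      (wlen1 x * wlen1 y) • wnil := by
  refine (words_ext (f := bdry ∘ₗ (shuffle (k := k)).flip y)
    (g := (shuffle (k := k)).flip y ∘ₗ bdry - (shuffle (k := k)).flip (bdry y) ∘ₗ wsign +
      (LinearMap.toSpanSingleton k _ (wlen1 y • wnil)) ∘ₗ wlen1) (fun u => ?_) x).trans
      (by simp [smul_smul])
  refine (words_ext (f := bdry ∘ₗ shuffle (Finsupp.single u (1 : k)))
    (g := shuffle (bdry (Finsupp.single u (1 : k))) -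
      shuffle (wsign (Finsupp.single u (1 : k))) ∘ₗ bdry +
      (LinearMap.toSpanSingleton k _ (wlen1 (Finsupp.single u (1 : k)) • wnil)) ∘ₗ wlen1)
    (fun v => ?_) y).trans
      (by simp [smul_smul, mul_comm])
  simpa [smul_smul, mul_comm] using bdry_shuffleWord (k := k) u v

theorem wemp_shuffle (x : Words k α) (y : Words k β) : wemp (shuffle x y) = 0 := by
  refine words_ext (f := wemp ∘ₗ (shuffle (k := k)).flip y) (g := 0) (fun u => ?_) x
  refine words_ext (f := wemp ∘ₗ (shuffle (k := k)) (Finsupp.single u (1 : k))) (g := 0)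
    (fun v => ?_) y
  cases u with
  | nil => simp [shuffleWord_nil_left]
  | cons a u =>
    cases v with
    | nil => simp [shuffleWord_nil_right]
    | cons b v => simp [shuffleWord_cons, wemp_wcons]

/-- The effect of a map of letters on words. -/
def wmap (f : α → α') : Words k α →ₗ[k] Words k α' := Finsupp.lmapDomain k k (List.map f)

@[simp] theorem wmap_single (f : α → α') (u : List α) (c : k) :
    wmap f (Finsupp.single u c) = Finsupp.single (u.map f) c := by simp [wmap]

theorem wmap_wcons (f : α → α') (a : α) (x : Words k α) :
    wmap f (wcons a x) = wcons (f a) (wmap f x) := by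
  refine words_ext (f := wmap f ∘ₗ wcons a) (g := wcons (f a) ∘ₗ wmap f) (fun u => ?_) x
  simp

theorem wmap_shuffleWord (f : α → α') (g : β → β') : ∀ (u : List α) (v : List β),
    wmap (Prod.map f g) (shuffleWord (k := k) u v) = shuffleWord (u.map f) (v.map g)
  | [], v => by simp [shuffleWord_nil_left]
  | u, [] => by simp [shuffleWord_nil_right]
  | a :: u, b :: v => by
    have ih1 := wmap_shuffleWord f g u (b :: v)
    have ih2 := wmap_shuffleWord f g (a :: u) v
    simp only [List.map_cons] at ih1 ih2 ⊢
    simp only [shuffleWord_cons, wmap_wcons, map_add, map_smul, ih1, ih2, Prod.map_apply,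
      List.length_map]
    simp [emp, wnil]
  termination_by u v => u.length + v.length

theorem shuffle_assocWord : ∀ (u : List α) (v : List β) (w : List γ),
    wmap (Equiv.prodAssoc α β γ) (shuffle (shuffle (Finsupp.single u (1 : k))
      (Finsupp.single v 1)) (Finsupp.single w 1)) =
    shuffle (Finsupp.single u (1 : k)) (shuffle (Finsupp.single v 1) (Finsupp.single w 1))
  | [], v, w => by
    have h1 := shuffle_nil_left (k := k) (α := α) (β := β × γ)
    rw [wnil] at h1
    rw [h1]
    simp [shuffleWord_nil_left]
  | u, [], w => by simp [shuffleWord_nil_left, shuffleWord_nil_right]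
  | u, v, [] => by
    have h1 := shuffle_nil_right (k := k) (α := α × β) (β := γ)
    rw [wnil] at h1
    rw [h1]
    simp [shuffleWord_nil_right]
  | a :: u, b :: v, c :: w => by
    have ih1 := shuffle_assocWord u (b :: v) (c :: w)
    have ih2 := shuffle_assocWord (a :: u) v (c :: w)
    have ih3 := shuffle_assocWord (a :: u) (b :: v) w
    simp only [← wcons_single] at ih1 ih2 ih3 ⊢
    have hx := wsign_single (k := k) u
    have hy := wsign_single (k := k) v
    set x := Finsupp.single u (1 : k)
    set y := Finsupp.single v (1 : k)
    set z := Finsupp.single w (1 : k)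
    have ih2' : wmap (Equiv.prodAssoc α β γ) (shuffle (shuffle (wcons a (wsign x)) y)
        (wcons c z)) = shuffle (wcons a (wsign x)) (shuffle y (wcons c z)) := by
      simp only [hx, map_smul, LinearMap.smul_apply, ih2]
    have ih3' : wmap (Equiv.prodAssoc α β γ) (shuffle (shuffle (wcons a (wsign x))
        (wcons b (wsign y))) z) = shuffle (wcons a (wsign x)) (shuffle (wcons b (wsign y)) z) := by
      simp only [hx, hy, map_smul, LinearMap.smul_apply, ih3]
    set V := shuffle y (wcons c z) + shuffle (wcons b (wsign y)) z + (wemp y * wemp z) • wnil with hV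
    have hYZ : shuffle (wcons b y) (wcons c z) = wcons (b, c) V := shuffle_wcons b y c z
    set W := shuffle x (wcons b y) + shuffle (wcons a (wsign x)) y + (wemp x * wemp y) • wnil with hW
    have hXY : shuffle (wcons a x) (wcons b y) = wcons (a, b) W := shuffle_wcons a x b y
    have hW1 : wcons (a, b) (wsign W) = shuffle (wcons a (wsign x)) (wcons b (wsign y)) := by
      have := wsign_wcons (a, b) W
      rw [← hXY, wsign_shuffle, wsign_wcons, wsign_wcons] at this
      simpa using this.symm
    have hnil : wemp (wnil : Words k (α × β)) = 1 := by simp [wemp, wnil, emp]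
    have hnil' : wemp (wnil : Words k (β × γ)) = 1 := by simp [wemp, wnil, emp]
    have hW2 : wemp W = wemp x * wemp y := by
      simp [hW, wemp_shuffle, hnil]
    have hV2 : wemp V = wemp y * wemp z := by
      simp [hV, wemp_shuffle, hnil']
    rw [hXY, hYZ, shuffle_wcons, shuffle_wcons, hW1, hW2, hV2, wmap_wcons, map_add (wmap _),
      map_add (wmap _), ih3',
      ← hYZ, ← ih1]
    have hL : shuffle W (wcons c z) = shuffle (shuffle x (wcons b y)) (wcons c z) +
        shuffle (shuffle (wcons a (wsign x)) y) (wcons c z) := by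
      simp [hW, shuffle_nil_left]
    have hR : shuffle (wcons a (wsign x)) V = shuffle (wcons a (wsign x)) (shuffle y (wcons c z)) +
        shuffle (wcons a (wsign x)) (shuffle (wcons b (wsign y)) z) := by
      simp [hV, shuffle_nil_right]
    rw [hL, hR, map_add (wmap _), ih2', map_smul (wmap _), mul_assoc]
    have : wmap (Equiv.prodAssoc α β γ) (wnil : Words k _) = wnil := by simp [wnil]
    rw [this]
    change wcons (a, b, c) _ = _
    congr 1
    abel
  termination_by u v w => u.length + v.length + w.length

theorem shuffle_assoc (x : Words k α) (y : Words k β) (z : Words k γ) :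
    wmap (Equiv.prodAssoc α β γ) (shuffle (shuffle x y) z) = shuffle x (shuffle y z) := by
  refine words_ext (f := wmap (Equiv.prodAssoc α β γ) ∘ₗ (shuffle (k := k)).flip z ∘ₗ
    (shuffle (k := k)).flip y) (g := (shuffle (k := k)).flip (shuffle y z)) (fun u => ?_) x
  refine words_ext (f := wmap (Equiv.prodAssoc α β γ) ∘ₗ (shuffle (k := k)).flip z ∘ₗ
    shuffle (Finsupp.single u (1 : k)))
    (g := shuffle (Finsupp.single u (1 : k)) ∘ₗ (shuffle (k := k)).flip z) (fun v => ?_) y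
  exact words_ext (f := wmap (Equiv.prodAssoc α β γ) ∘ₗ
    shuffle (shuffle (Finsupp.single u (1 : k)) (Finsupp.single v (1 : k))))
    (g := shuffle (Finsupp.single u (1 : k)) ∘ₗ shuffle (Finsupp.single v (1 : k)))
    (fun w => shuffle_assocWord u v w) z

theorem shuffle_comm : ∀ (u : List α) (v : List β),
    wmap Prod.swap (shuffleWord (k := k) u v) =
      (-1 : k) ^ ((u.length + 1) * (v.length + 1)) • shuffleWord v u
  | [], v => by simp [shuffleWord_nil_left, shuffleWord_nil_right]
  | u, [] => by simp [shuffleWord_nil_left, shuffleWord_nil_right]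
  | a :: u, b :: v => by
    have ih1 := shuffle_comm u (b :: v)
    have ih2 := shuffle_comm (a :: u) v
    have hn : wmap Prod.swap (wnil : Words k (α × β)) = wnil := by simp [wnil]
    rw [shuffleWord_cons, shuffleWord_cons, wmap_wcons, map_add (wmap _), map_add (wmap _),
      map_smul (wmap _), map_smul (wmap _), hn,
      ih1, ih2, Prod.swap_prod_mk, ← map_smul]
    congr 1
    have e : (emp (k := k) u * emp v) • (wnil : Words k (β × α)) =
        ((-1 : k) ^ (((a :: u).length + 1) * ((b :: v).length + 1)) * (emp v * emp u)) • wnil := by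
      cases u with
      | nil => cases v <;> simp [emp, (by norm_num : (-1 : k) ^ 4 = 1)]
      | cons => simp [emp]
    rw [e]
    simp only [smul_add, smul_smul, List.length_cons, ← pow_add]
    rw [add_comm (_ • _) ((_ : k) • shuffleWord v (a :: u))]
    have p1 : (-1 : k) ^ (u.length + (u.length + 1 + 1) * (v.length + 1)) =
      (-1 : k) ^ ((u.length + 1 + 1) * (v.length + 1 + 1)) := by
      rw [show (u.length + 1 + 1) * (v.length + 1 + 1) =
        (u.length + (u.length + 1 + 1) * (v.length + 1)) + 2 by ring, pow_add _ _ 2]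
      simp
    have p2 : (-1 : k) ^ ((u.length + 1) * (v.length + 1 + 1)) =
      (-1 : k) ^ ((u.length + 1 + 1) * (v.length + 1 + 1) + v.length) := by
      rw [show (u.length + 1 + 1) * (v.length + 1 + 1) + v.length =
        (u.length + 1) * (v.length + 1 + 1) + 2 * (v.length + 1) by ring, pow_add _ _ (2 * _), pow_mul]
      simp
    rw [p1, p2]
  termination_by u v => u.length + v.length

theorem shuffleWord_singleton_left (a : α) : ∀ v : List β, v ≠ [] →
    shuffleWord (k := k) [a] v = Finsupp.single (v.map (Prod.mk a)) 1
  | [], h => absurd rfl h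
  | [b], _ => by simp [shuffleWord]
  | b :: c :: v, _ => by
    rw [shuffleWord_cons, shuffleWord_singleton_left a (c :: v) (by simp)]
    simp [shuffleWord_nil_left, emp]

theorem shuffleWord_singleton_right (b : β) : ∀ u : List α, u ≠ [] →
    shuffleWord (k := k) u [b] = Finsupp.single (u.map (fun a => (a, b))) 1
  | [], h => absurd rfl h
  | [a], _ => by simp [shuffleWord]
  | a :: c :: v, _ => by
    rw [shuffleWord_cons, shuffleWord_singleton_right b (c :: v) (by simp)]
    simp [shuffleWord_nil_right, emp]

/-- The span of the words that have `n + 1` letters. -/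
def wdeg (k : Type u) [Field k] (α : Type) (n : ℤ) : Submodule k (Words k α) :=
  Submodule.span k {x | ∃ w : List α, (w.length : ℤ) = n + 1 ∧ x = Finsupp.single w 1}

theorem exists_ofFn (w : List α) (h : w ≠ []) : ∃ (m : ℕ) (f : Fin (m + 1) → α), w = List.ofFn f := by
  cases w with
  | nil => exact absurd rfl h
  | cons a w => exact ⟨w.length, (a :: w).get, (List.ofFn_get _).symm⟩

theorem bdryWord_ofFn (m : ℕ) : ∀ (f : Fin (m + 2) → α), bdryWord (k := k) (List.ofFn f) =
    ∑ i : Fin (m + 2), (-1 : k) ^ (i : ℕ) • Finsupp.single (List.ofFn (f ∘ i.succAbove)) 1 := by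
  induction m with
  | zero =>
    intro f
    simp [bdryWord, List.ofFn_succ, Fin.sum_univ_succ, sub_eq_add_neg]
  | succ m ih =>
    intro f
    conv_rhs => rw [Fin.sum_univ_succ]
    rw [List.ofFn_succ, bdryWord, ih, sub_eq_add_neg]
    congr 1
    · simp [Function.comp_def]
    · rw [map_sum, ← Finset.sum_neg_distrib]
      refine Finset.sum_congr rfl fun i _ => ?_
      rw [map_smul, wcons_single, List.ofFn_succ (f := f ∘ _)]
      simp [pow_succ, Function.comp_def]

theorem mem_wdeg {n : ℤ} (w : List α) (h : (w.length : ℤ) = n + 1) :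
    Finsupp.single w (1 : k) ∈ wdeg k α n := Submodule.subset_span ⟨w, h, rfl⟩

theorem wcons_mem_wdeg {n : ℤ} (a : α) {x : Words k α} (h : x ∈ wdeg k α n) (n' : ℤ)
    (hn : n' = n + 1) : wcons a x ∈ wdeg k α n' := by
  have : wdeg k α n ≤ (wdeg k α n').comap (wcons a) := by
    rw [wdeg, Submodule.span_le]
    rintro _ ⟨w, hw, rfl⟩
    simp only [SetLike.mem_coe, Submodule.mem_comap, wcons_single]
    exact mem_wdeg _ (by simp; omega)
  exact this h

theorem bdryWord_mem_wdeg : ∀ (w : List α) (n : ℤ) (_ : (w.length : ℤ) = n + 2),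
    bdryWord (k := k) w ∈ wdeg k α n
  | [], _, _ => by simp [bdryWord]
  | a :: u, n, h => by
    rw [bdryWord]
    simp only [List.length_cons] at h
    exact Submodule.sub_mem _ (mem_wdeg _ (by push_cast at h; omega))
      (wcons_mem_wdeg a (bdryWord_mem_wdeg u (n - 1) (by push_cast at h; omega)) _ (by omega))

theorem shuffleWord_mem_wdeg : ∀ (u : List α) (v : List β) (n : ℤ)
    (_ : (u.length : ℤ) + v.length = n + 2), shuffleWord (k := k) u v ∈ wdeg k (α × β) n
  | [], v, _, _ => by simp [shuffleWord_nil_left]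
  | u, [], _, _ => by simp [shuffleWord_nil_right]
  | a :: u, b :: v, n, h => by
    simp only [List.length_cons] at h
    push_cast at h
    rw [shuffleWord_cons]
    refine wcons_mem_wdeg (n := n - 1) _ ?_ _ (by omega)
    refine Submodule.add_mem _ (Submodule.add_mem _ ?_ (Submodule.smul_mem _ _ ?_)) ?_
    · exact shuffleWord_mem_wdeg _ _ _ (by simp; omega)
    · exact shuffleWord_mem_wdeg _ _ _ (by simp; omega)
    · by_cases hu : u = []
      · by_cases hv : v = []
        · subst hu hv
          exact Submodule.smul_mem _ _ (mem_wdeg _ (by simp at h ⊢; omega))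
        · simp [emp, hv]
      · simp [emp, hu]
  termination_by u v => u.length + v.length

theorem wsign_of_mem_wdeg {n : ℤ} {x : Words k α} (h : x ∈ wdeg k α n) :
    wsign x = -((n.negOnePow : ℤ) • x) := by
  induction h using Submodule.span_induction with
  | zero => simp
  | add x x' _ _ h1 h2 => rw [map_add, h1, h2, smul_add, neg_add]
  | smul c x _ h1 => rw [map_smul, h1, smul_neg, smul_comm]
  | mem x hx =>
    obtain ⟨w, hw, rfl⟩ := hx
    rw [wsign_single, ← Int.cast_smul_eq_zsmul k, ← neg_smul]
    congr 1
    have : (n.negOnePow : ℤˣ) = - (-1) ^ w.length := by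
      obtain rfl : n = w.length - 1 := by omega
      rw [Int.negOnePow_sub, Int.negOnePow_one, Int.negOnePow_def, zpow_natCast]
      simp
    rw [this]
    push_cast
    ring

end Shuffle

section Realize
variable {k : Type u} [Field k] {X Y Z W : TopCat.{0}}
variable {α β γ : Type} [Fintype α] [Fintype β] [Fintype γ]

/-- The map of simplices induced by a map of vertices. -/
def simplexMap (f : α → β) : C(stdSimplex ℝ α, stdSimplex ℝ β) :=
  ⟨stdSimplex.map f, stdSimplex.continuous_map f⟩

theorem simplexMap_comp (f : α → β) (g : β → γ) :
    (simplexMap g).comp (simplexMap f) = simplexMap (g ∘ f) := by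
  ext1 z
  exact stdSimplex.map_comp_apply f g z

theorem simplexMap_id : simplexMap (id : α → α) = ContinuousMap.id _ := by
  ext1 z
  exact stdSimplex.map_id_apply z

open Classical in
/-- The singular simplex of dimension `n` of `X` obtained by composing `σ` with the affine map
sending the successive vertices of the standard simplex to the letters of the word `w`; it is zero
if `w` does not have `n + 1` letters. -/
def realizeWord (n : ℤ) (σ : C(stdSimplex ℝ α, X)) (w : List α) : (chains k X).X n :=
  if h : ((w.length - 1 : ℕ) : ℤ) = n ∧ w ≠ [] then
    gen (w.length - 1) h.1 (σ.comp (simplexMap fun i => w.get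
      (i.cast (Nat.sub_add_cancel (List.length_pos_iff.2 h.2)))))
  else 0

/-- Linear extension of `realizeWord`. -/
def realize (n : ℤ) (σ : C(stdSimplex ℝ α, X)) : Words k α →ₗ[k] (chains k X).X n :=
  Finsupp.linearCombination k (realizeWord n σ)

theorem realizeWord_ofFn {n : ℤ} (σ : C(stdSimplex ℝ α, X)) (m : ℕ) (h : (m : ℤ) = n)
    (f : Fin (m + 1) → α) :
    realizeWord (k := k) n σ (List.ofFn f) = gen m h (σ.comp (simplexMap f)) := by
  have key : ∀ (m' : ℕ) (h' : (m' : ℤ) = n) (hl : m' + 1 = (List.ofFn f).length),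
      gen (k := k) m' h' (σ.comp (simplexMap fun i => (List.ofFn f).get (i.cast hl))) =
        gen m h (σ.comp (simplexMap f)) := by
    intro m' h' hl
    obtain rfl : m' = m := by omega
    congr 3
    funext i
    rw [List.get_ofFn]
    rfl
  rw [realizeWord, dif_pos ⟨by simpa using h, by simp⟩]
  exact key _ _ _

theorem realizeWord_eq_zero {n : ℤ} (σ : C(stdSimplex ℝ α, X)) (w : List α)
    (h : (w.length : ℤ) ≠ n + 1) : realizeWord (k := k) n σ w = 0 := by
  rw [realizeWord, dif_neg]
  rintro ⟨h1, h2⟩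
  have := List.length_pos_iff.2 h2
  omega

theorem realizeWord_nil {n : ℤ} (σ : C(stdSimplex ℝ α, X)) :
    realizeWord (k := k) n σ [] = 0 := by
  rw [realizeWord, dif_neg]
  exact fun h => h.2 rfl

@[simp] theorem realize_single (n : ℤ) (σ : C(stdSimplex ℝ α, X)) (w : List α) :
    realize (k := k) n σ (Finsupp.single w 1) = realizeWord n σ w := by
  simp [realize]

theorem realize_wmap (n : ℤ) (σ : C(stdSimplex ℝ β, X)) (f : α → β) (x : Words k α) :
    realize n σ (wmap f x) = realize n (σ.comp (simplexMap f)) x := by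
  refine words_ext (f := realize n σ ∘ₗ wmap f) (g := realize n (σ.comp (simplexMap f)))
    (fun w => ?_) x
  simp only [LinearMap.comp_apply, wmap_single, realize_single]
  by_cases hw : w = []
  · subst hw; simp [realizeWord_nil]
  obtain ⟨m, g, rfl⟩ := exists_ofFn w hw
  by_cases h : (m : ℤ) = n
  · rw [List.map_ofFn, realizeWord_ofFn _ m h, realizeWord_ofFn _ m h, ContinuousMap.comp_assoc,
      simplexMap_comp]
  · rw [realizeWord_eq_zero, realizeWord_eq_zero] <;> simpa using h

theorem map_realize (f : X ⟶ Y) (n : ℤ) (σ : C(stdSimplex ℝ α, X)) (x : Words k α) :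
    (((chainsFunctor k).map f).f n).hom (realize n σ x) = realize n (f.hom.comp σ) x := by
  refine words_ext (f := (((chainsFunctor k).map f).f n).hom ∘ₗ realize n σ)
    (g := realize n (f.hom.comp σ)) (fun w => ?_) x
  simp only [LinearMap.comp_apply, realize_single]
  by_cases hw : w = []
  · subst hw; simp [realizeWord_nil]
  obtain ⟨m, g, rfl⟩ := exists_ofFn w hw
  by_cases h : (m : ℤ) = n
  · rw [realizeWord_ofFn _ m h, realizeWord_ofFn _ m h, chains_map_gen]
    rfl
  · rw [realizeWord_eq_zero, realizeWord_eq_zero, map_zero] <;> simpa using h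

theorem d_realize {n n' : ℤ} (hn : n' + 1 = n) (σ : C(stdSimplex ℝ α, X)) (x : Words k α) :
    ((chains k X).d n n').hom (realize n σ x) = realize n' σ (bdry x) := by
  refine words_ext (f := ((chains k X).d n n').hom ∘ₗ realize n σ) (g := realize n' σ ∘ₗ bdry)
    (fun w => ?_) x
  have hb : bdry (Finsupp.single w (1 : k)) = bdryWord w := by simp [bdry]
  simp only [LinearMap.comp_apply, realize_single, hb]
  by_cases hw : w = []
  · subst hw; simp [realizeWord_nil, bdryWord]
  obtain ⟨m, g, rfl⟩ := exists_ofFn w hw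
  cases m with
  | zero =>
    have : bdryWord (k := k) (List.ofFn g) = Finsupp.single [] 1 := by simp [bdryWord]
    rw [this, realize_single, realizeWord_nil]
    by_cases h : ((0 : ℕ) : ℤ) = n
    · rw [realizeWord_ofFn _ 0 h, chains_d_gen_zero]
    · rw [realizeWord_eq_zero, map_zero]
      simp at h ⊢; omega
  | succ m =>
    rw [bdryWord_ofFn, map_sum]
    simp only [map_smul, realize_single]
    by_cases h : ((m + 1 : ℕ) : ℤ) = n
    · have h' : (m : ℤ) = n' := by push_cast at h; omega
      rw [realizeWord_ofFn _ _ h, chains_d_gen m h h']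
      refine Finset.sum_congr rfl fun i _ => ?_
      rw [realizeWord_ofFn _ _ h', ← simplexMap_comp]
      rfl
    · rw [realizeWord_eq_zero, map_zero]
      · symm
        apply Finset.sum_eq_zero
        intro i _
        rw [realizeWord_eq_zero, smul_zero]
        simp at h ⊢; omega
      · simp at h ⊢; omega

/-- For `σ` and `τ` defined on simplices with vertex sets `α` and `β`, the map
`z ↦ μ (σ (pr₁ z), τ (pr₂ z))` on the simplex with vertex set `α × β`. -/
def pairSimplex (μ : C(X × Y, Z)) (σ : C(stdSimplex ℝ α, X)) (τ : C(stdSimplex ℝ β, Y)) :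
    C(stdSimplex ℝ (α × β), Z) :=
  μ.comp ((σ.comp (simplexMap Prod.fst)).prodMk (τ.comp (simplexMap Prod.snd)))

theorem simplexMap_simplexMap (f : α → β) (g : β → γ) (z : stdSimplex ℝ α) :
    simplexMap g (simplexMap f z) = simplexMap (g ∘ f) z :=
  stdSimplex.map_comp_apply f g z

theorem pairSimplex_comp (μ : C(X × Y, Z)) (σ : C(stdSimplex ℝ α, X)) (τ : C(stdSimplex ℝ β, Y))
    (e : γ → α × β) : (pairSimplex μ σ τ).comp (simplexMap e) =
      μ.comp ((σ.comp (simplexMap (Prod.fst ∘ e))).prodMk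
        (τ.comp (simplexMap (Prod.snd ∘ e)))) := by
  ext1 z
  change μ (σ (simplexMap Prod.fst (simplexMap e z)), τ (simplexMap Prod.snd (simplexMap e z))) =
    μ (σ (simplexMap (Prod.fst ∘ e) z), τ (simplexMap (Prod.snd ∘ e) z))
  rw [simplexMap_simplexMap, simplexMap_simplexMap]

/-- The Eilenberg–Zilber (shuffle) cross product of singular chains of `X` and of `Y`, followed
by the map induced by `μ : X × Y → Z`. -/
def cross (μ : C(X × Y, Z)) {p q n : ℤ} (_h : p + q = n) :
    (chains k X).X p →ₗ[k] (chains k Y).X q →ₗ[k] (chains k Z).X n :=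
  chainsLift fun m _ σ => chainsLift fun m' _ τ => realize n (pairSimplex μ σ τ)
    (shuffleWord (List.finRange (m + 1)) (List.finRange (m' + 1)))

theorem cross_gen (μ : C(X × Y, Z)) {p q n : ℤ} (h : p + q = n) (m : ℕ) (hm : (m : ℤ) = p)
    (m' : ℕ) (hm' : (m' : ℤ) = q) (σ : Simp m X) (τ : Simp m' Y) :
    cross (k := k) μ h (gen m hm σ) (gen m' hm' τ) = realize n (pairSimplex μ σ τ)
      (shuffleWord (List.finRange (m + 1)) (List.finRange (m' + 1))) := by
  simp [cross]

theorem gen_eq_realize {n : ℤ} (m : ℕ) (hm : (m : ℤ) = n) (σ : Simp m X) :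
    gen (k := k) m hm σ = realize n σ (Finsupp.single (List.finRange (m + 1)) 1) := by
  rw [realize_single, ← List.ofFn_id, realizeWord_ofFn σ m hm, simplexMap_id,
    ContinuousMap.comp_id]

theorem cross_realizeWord (μ : C(X × Y, Z)) {p q n : ℤ} (h : p + q = n)
    (σ : C(stdSimplex ℝ α, X)) (τ : C(stdSimplex ℝ β, Y)) (u : List α) (v : List β)
    (hu : (u.length : ℤ) = p + 1) (hv : (v.length : ℤ) = q + 1) :
    cross (k := k) μ h (realizeWord p σ u) (realizeWord q τ v) =
      realize n (pairSimplex μ σ τ) (shuffleWord u v) := by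
  by_cases hu0 : u = []
  · subst hu0; simp [realizeWord_nil, shuffleWord_nil_left]
  by_cases hv0 : v = []
  · subst hv0; simp [realizeWord_nil, shuffleWord_nil_right]
  obtain ⟨m, f, rfl⟩ := exists_ofFn u hu0
  obtain ⟨m', g, rfl⟩ := exists_ofFn v hv0
  rw [realizeWord_ofFn σ m (by simpa using hu), realizeWord_ofFn τ m' (by simpa using hv),
    cross_gen, ← List.map_id (List.ofFn f), ← List.map_id (List.ofFn g)]
  rw [List.map_id, List.map_id, List.ofFn_eq_map, List.ofFn_eq_map, ← wmap_shuffleWord,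
    realize_wmap]
  refine congrArg (fun s => realize n s _) ?_
  rw [pairSimplex_comp]
  ext1 z
  change μ (σ (simplexMap f (simplexMap Prod.fst z)), τ (simplexMap g (simplexMap Prod.snd z))) = _
  rw [simplexMap_simplexMap, simplexMap_simplexMap]
  rfl

theorem cross_realize (μ : C(X × Y, Z)) {p q n : ℤ} (h : p + q = n)
    (σ : C(stdSimplex ℝ α, X)) (τ : C(stdSimplex ℝ β, Y)) {x : Words k α} {y : Words k β}
    (hx : x ∈ wdeg k α p) (hy : y ∈ wdeg k β q) :
    cross (k := k) μ h (realize p σ x) (realize q τ y) =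
      realize n (pairSimplex μ σ τ) (shuffle x y) := by
  induction hx using Submodule.span_induction with
  | zero => simp
  | add x x' _ _ h1 h2 => simp [h1, h2]
  | smul c x _ h1 => simp [h1]
  | mem x hx =>
    obtain ⟨u, hu, rfl⟩ := hx
    induction hy using Submodule.span_induction with
    | zero => simp
    | add x x' _ _ h1 h2 => simp only [map_add, h1, h2]
    | smul c x _ h1 => simp only [map_smul, h1]
    | mem y hy =>
      obtain ⟨v, hv, rfl⟩ := hy
      simpa using cross_realizeWord μ h σ τ u v hu hv

variable {M : Type u} [AddCommGroup M] [Module k M]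

theorem chains_ext₂ {p q : ℤ} {f g : (chains k X).X p →ₗ[k] (chains k Y).X q →ₗ[k] M}
    (h : ∀ m hm σ m' hm' τ, f (gen m hm σ) (gen m' hm' τ) = g (gen m hm σ) (gen m' hm' τ))
    (a : (chains k X).X p) (b : (chains k Y).X q) : f a b = g a b := by
  have : f = g := chains_ext fun m hm σ => chains_ext fun m' hm' τ => h m hm σ m' hm' τ
  rw [this]

theorem map_cross (f : Z ⟶ W) (μ : C(X × Y, Z)) {p q n : ℤ} (h : p + q = n)
    (a : (chains k X).X p) (b : (chains k Y).X q) :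
    (((chainsFunctor k).map f).f n).hom (cross μ h a b) = cross (f.hom.comp μ) h a b := by
  refine chains_ext₂ (f := (cross (k := k) μ h).compr₂ (((chainsFunctor k).map f).f n).hom)
    (g := cross (f.hom.comp μ) h) (fun m hm σ m' hm' τ => ?_) a b
  simp only [LinearMap.compr₂_apply, cross_gen, map_realize]
  rfl

theorem cross_map (f : X ⟶ Z) (g : Y ⟶ W) {V : TopCat.{0}} (μ : C(Z × W, V)) {p q n : ℤ}
    (h : p + q = n) (a : (chains k X).X p) (b : (chains k Y).X q) :
    cross μ h ((((chainsFunctor k).map f).f p).hom a) ((((chainsFunctor k).map g).f q).hom b) =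
      cross (μ.comp (f.hom.prodMap g.hom)) h a b := by
  refine chains_ext₂ (f := (cross (k := k) μ h).compl₁₂ (((chainsFunctor k).map f).f p).hom
    (((chainsFunctor k).map g).f q).hom)
    (g := cross (μ.comp (f.hom.prodMap g.hom)) h) (fun m hm σ m' hm' τ => ?_) a b
  simp only [LinearMap.compl₁₂_apply, cross_gen, chains_map_gen]
  rfl

theorem cross_comm (μ : C(X × Y, Z)) {p q n : ℤ} (h : p + q = n) (h' : q + p = n)
    (a : (chains k X).X p) (b : (chains k Y).X q) :
    cross μ h a b = ((p * q).negOnePow : ℤ) •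
      cross (μ.comp ContinuousMap.prodSwap) h' b a := by
  refine chains_ext₂ (f := cross (k := k) μ h) (g := ((p * q).negOnePow : ℤ) •
    (cross (k := k) (μ.comp ContinuousMap.prodSwap) h').flip) (fun m hm σ m' hm' τ => ?_) a b
  simp only [LinearMap.smul_apply, LinearMap.flip_apply, cross_gen]
  have := shuffle_comm (k := k) (List.finRange (m' + 1)) (List.finRange (m + 1))
  have h2 := congrArg (realize n (pairSimplex μ σ τ)) this
  rw [realize_wmap] at h2
  have h3 : (pairSimplex μ σ τ).comp (simplexMap Prod.swap) =
      pairSimplex (μ.comp ContinuousMap.prodSwap) τ σ := by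
    rw [pairSimplex_comp]
    rfl
  rw [h3] at h2
  rw [h2, map_smul, ← Int.cast_smul_eq_zsmul k, smul_smul]
  subst hm hm'
  have : (((((m : ℤ) * m').negOnePow : ℤˣ) : ℤ) : k) = (-1) ^ (m * m') := by
    rw [← Nat.cast_mul, Int.negOnePow_def, zpow_natCast]
    push_cast
    rfl
  rw [this]
  simp only [List.length_finRange]
  rw [← pow_add, show m * m' + (m' + 1 + 1) * (m + 1 + 1) = 2 * (m * m' + m + m' + 2) by ring,
    pow_mul]
  simp

theorem cross_assoc {V U : TopCat.{0}} (ν : C(X × Y, V)) (μ : C(V × Z, U)) (ν' : C(Y × Z, W))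
    (μ' : C(X × W, U)) (hμ : ∀ x y z, μ (ν (x, y), z) = μ' (x, ν' (y, z)))
    {p q r s t n : ℤ} (h1 : p + q = s) (h2 : s + r = n) (h3 : q + r = t) (h4 : p + t = n)
    (a : (chains k X).X p) (b : (chains k Y).X q) (c : (chains k Z).X r) :
    cross μ h2 (cross ν h1 a b) c = cross μ' h4 a (cross ν' h3 b c) := by
  refine congrArg (fun f => f a) (chains_ext (k := k) (f := (cross μ h2).flip c ∘ₗ (cross ν h1).flip b)
    (g := (cross μ' h4).flip (cross ν' h3 b c)) fun m hm σ => ?_)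
  refine chains_ext₂ (k := k) (f := cross μ h2 ∘ₗ cross ν h1 (gen m hm σ))
    (g := (cross ν' h3).compr₂ (cross μ' h4 (gen m hm σ))) (fun m' hm' τ m'' hm'' ρ => ?_) b c
  simp only [LinearMap.comp_apply, LinearMap.compr₂_apply]
  rw [cross_gen, cross_gen, gen_eq_realize m'', gen_eq_realize m,
    cross_realize _ _ _ _ (shuffleWord_mem_wdeg _ _ _ (by simp; omega))
      (mem_wdeg _ (by simp; omega)),
    cross_realize _ _ _ _ (mem_wdeg _ (by simp; omega))
      (shuffleWord_mem_wdeg _ _ _ (by simp; omega)),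
    ← shuffle_single, ← shuffle_single, ← shuffle_assoc, realize_wmap]
  refine congrArg (fun s => realize n s _) ?_
  rw [pairSimplex_comp]
  ext1 z
  change μ (ν (σ (simplexMap Prod.fst (simplexMap Prod.fst z)),
      τ (simplexMap Prod.snd (simplexMap Prod.fst z))), ρ (simplexMap Prod.snd z)) =
    μ' (σ (simplexMap _ z), ν' (τ (simplexMap Prod.fst (simplexMap _ z)),
      ρ (simplexMap Prod.snd (simplexMap _ z))))
  simp only [simplexMap_simplexMap]
  exact hμ _ _ _

theorem realize_wnil (n : ℤ) (σ : C(stdSimplex ℝ α, X)) :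
    realize (k := k) n σ wnil = 0 := by
  rw [wnil, realize_single, realizeWord_nil]

theorem d_cross (μ : C(X × Y, Z)) {p q n p' q' n' : ℤ} (h : p + q = n) (hp : p' + 1 = p)
    (hq : q' + 1 = q) (hn : n' + 1 = n) (h1 : p' + q = n') (h2 : p + q' = n')
    (a : (chains k X).X p) (b : (chains k Y).X q) :
    ((chains k Z).d n n').hom (cross μ h a b) =
      cross μ h1 (((chains k X).d p p').hom a) b +
      (p.negOnePow : ℤ) • cross μ h2 a (((chains k Y).d q q').hom b) := by
  refine chains_ext₂ (k := k) (f := (cross μ h).compr₂ ((chains k Z).d n n').hom)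
    (g := (cross μ h1) ∘ₗ ((chains k X).d p p').hom +
      (p.negOnePow : ℤ) • (cross μ h2).compl₂ ((chains k Y).d q q').hom)
    (fun m hm σ m' hm' τ => ?_) a b
  simp only [LinearMap.comp_apply, LinearMap.compr₂_apply, LinearMap.compl₂_apply,
    LinearMap.add_apply, LinearMap.smul_apply]
  have hx : Finsupp.single (List.finRange (m + 1)) (1 : k) ∈ wdeg k _ p :=
    mem_wdeg _ (by simp; omega)
  have hy : Finsupp.single (List.finRange (m' + 1)) (1 : k) ∈ wdeg k _ q :=
    mem_wdeg _ (by simp; omega)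
  have hb : ∀ (m : ℕ), bdry (Finsupp.single (List.finRange (m + 1)) (1 : k)) =
      bdryWord (List.finRange (m + 1)) := fun m => by simp [bdry]
  have hdx : bdry (Finsupp.single (List.finRange (m + 1)) (1 : k)) ∈ wdeg k _ p' := by
    rw [hb]; exact bdryWord_mem_wdeg _ _ (by simp; omega)
  have hdy : bdry (Finsupp.single (List.finRange (m' + 1)) (1 : k)) ∈ wdeg k _ q' := by
    rw [hb]; exact bdryWord_mem_wdeg _ _ (by simp; omega)
  rw [gen_eq_realize m, gen_eq_realize m', cross_realize _ _ _ _ hx hy, d_realize hn,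
    d_realize hp, d_realize hq, cross_realize _ _ _ _ hdx hy, cross_realize _ _ _ _ hx hdy,
    bdry_shuffle, wsign_of_mem_wdeg hx, map_add, map_smul, realize_wnil, smul_zero, add_zero,
    map_neg, LinearMap.neg_apply, sub_neg_eq_add, map_add, map_zsmul, LinearMap.smul_apply,
    map_zsmul]

theorem cross_gen_zero_left (μ : C(X × Y, Z)) {p q : ℤ} (h : p + q = q) (hp : ((0 : ℕ) : ℤ) = p)
    (x : X) (f : Y ⟶ Z) (hf : ∀ y, μ (x, y) = f y) (b : (chains k Y).X q) :
    cross μ h (gen 0 hp (ContinuousMap.const _ x)) b =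
      (((chainsFunctor k).map f).f q).hom b := by
  refine congrArg (fun f => f b) (chains_ext (k := k)
    (f := cross μ h (gen 0 hp (ContinuousMap.const _ x)))
    (g := (((chainsFunctor k).map f).f q).hom) fun m hm σ => ?_)
  rw [cross_gen, chains_map_gen, List.finRange_succ (n := 0), List.finRange_zero, List.map_nil,
    shuffleWord_singleton_left, ← wmap_single, realize_wmap, gen_eq_realize]
  · refine congrArg (fun s => realize _ s _) ?_
    rw [pairSimplex_comp]
    ext1 z
    change μ (x, σ (simplexMap id z)) = f (σ z)
    rw [simplexMap_id, hf]
    rfl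
  · simp [List.finRange_succ]

theorem cross_gen_zero_right (μ : C(X × Y, Z)) {p q : ℤ} (h : p + q = p)
    (hq : ((0 : ℕ) : ℤ) = q) (y : Y) (f : X ⟶ Z) (hf : ∀ x, μ (x, y) = f x)
    (a : (chains k X).X p) :
    cross μ h a (gen 0 hq (ContinuousMap.const _ y)) =
      (((chainsFunctor k).map f).f p).hom a := by
  refine congrArg (fun f => f a) (chains_ext (k := k)
    (f := (cross μ h).flip (gen 0 hq (ContinuousMap.const _ y)))
    (g := (((chainsFunctor k).map f).f p).hom) fun m hm σ => ?_)
  rw [LinearMap.flip_apply, cross_gen, chains_map_gen, List.finRange_succ (n := 0),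
    List.finRange_zero, List.map_nil,
    shuffleWord_singleton_right, ← wmap_single, realize_wmap, gen_eq_realize]
  · refine congrArg (fun s => realize _ s _) ?_
    rw [pairSimplex_comp]
    ext1 z
    change μ (σ (simplexMap id z), y) = f (σ z)
    rw [simplexMap_id, hf]
    rfl
  · simp [List.finRange_succ]

theorem cross_map_map {V U : TopCat.{0}} (f : X ⟶ Z) (g : Y ⟶ W) (μ : C(Z × W, V))
    (μ' : C(X × Y, U)) (e : U ⟶ V) (H : ∀ x y, μ (f x, g y) = e (μ' (x, y))) {p q n : ℤ}
    (h : p + q = n) (a : (chains k X).X p) (b : (chains k Y).X q) :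
    cross μ h ((((chainsFunctor k).map f).f p).hom a) ((((chainsFunctor k).map g).f q).hom b) =
      (((chainsFunctor k).map e).f n).hom (cross μ' h a b) := by
  rw [cross_map, map_cross]
  have : μ.comp (f.hom.prodMap g.hom) = e.hom.comp μ' := by
    ext1 z
    exact H z.1 z.2
  rw [this]

theorem cross_assoc_map {V U U' : TopCat.{0}} (ν : C(X × Y, V)) (μ : C(V × Z, U))
    (ν' : C(Y × Z, W)) (μ' : C(X × W, U')) (e : U' ⟶ U)
    (H : ∀ x y z, μ (ν (x, y), z) = e (μ' (x, ν' (y, z))))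
    {p q r s t n : ℤ} (h1 : p + q = s) (h2 : s + r = n) (h3 : q + r = t) (h4 : p + t = n)
    (a : (chains k X).X p) (b : (chains k Y).X q) (c : (chains k Z).X r) :
    cross μ h2 (cross ν h1 a b) c =
      (((chainsFunctor k).map e).f n).hom (cross μ' h4 a (cross ν' h3 b c)) := by
  rw [map_cross]
  exact cross_assoc _ _ _ _ H h1 h2 h3 h4 a b c

theorem cross_swap_map {V U U' : TopCat.{0}} (ν : C(X × Y, V)) (μ : C(V × Z, U))
    (ν' : C(X × Z, W)) (μ' : C(W × Y, U')) (e : U' ⟶ U)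
    (H : ∀ x y z, μ (ν (x, y), z) = e (μ' (ν' (x, z), y)))
    {p q r s t n : ℤ} (h1 : p + q = s) (h2 : s + r = n) (h3 : p + r = t) (h4 : t + q = n)
    (a : (chains k X).X p) (b : (chains k Y).X q) (c : (chains k Z).X r) :
    cross μ h2 (cross ν h1 a b) c = ((q * r).negOnePow : ℤ) •
      (((chainsFunctor k).map e).f n).hom (cross μ' h4 (cross ν' h3 a c) b) := by
  let T : TopCat.{0} := TopCat.of (Y × Z)
  let i : C(Y × Z, T) := ContinuousMap.id _
  let μ₁ : C(X × T, U) := μ.comp ((ν.comp ((ContinuousMap.id _).prodMap ContinuousMap.fst)).prodMk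
    (ContinuousMap.snd.comp ContinuousMap.snd))
  rw [cross_assoc ν μ i μ₁ (fun _ _ _ => rfl) h1 h2 (t := q + r) rfl (by omega),
    cross_comm i rfl (by omega),
    map_zsmul, map_cross]
  rw [cross_assoc ν' (e.hom.comp μ') (i.comp ContinuousMap.prodSwap) μ₁
    (fun x z y => (H x y z).symm) h3 h4 (t := q + r) (by omega) (by omega)]

end Realize

section Index
variable {I I' J J' K S : Type}

/-- The set of inputs of a partial composite `p ∘ᵢ q`, where `p` has inputs `I` and `q` has
inputs `J`: the input `i` is replaced by the inputs of `q`. -/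
abbrev Graft (i : I) (J : Type) : Type := {a : I // a ≠ i} ⊕ J

/-- The colours of the inputs of a partial composite. -/
abbrev graftColor (x : I → S) (i : I) (z : J → S) : Graft i J → S := Sum.elim (fun a => x a) z

/-- Bijections of the inputs of `p` and of `q` induce one of the inputs of `p ∘ᵢ q`. -/
def graftCongr (σ : I' ≃ I) (i : I') (τ : J' ≃ J) : Graft i J' ≃ Graft (σ i) J :=
  Equiv.sumCongr (σ.subtypeEquiv fun _ => not_congr σ.injective.eq_iff.symm) τ

/-- The inputs of `(p ∘ᵢ q) ∘ⱼ r` and of `p ∘ᵢ (q ∘ⱼ r)`, where `j` is an input of `q`. -/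
def graftAssoc (i : I) (j : J) (K : Type) :
    Graft (Sum.inr j : Graft i J) K ≃ Graft i (Graft j K) where
  toFun
    | .inl ⟨.inl a, _⟩ => .inl a
    | .inl ⟨.inr b, h⟩ => .inr (.inl ⟨b, fun e => h (congrArg Sum.inr e)⟩)
    | .inr c => .inr (.inr c)
  invFun
    | .inl a => .inl ⟨.inl a, Sum.inl_ne_inr⟩
    | .inr (.inl b) => .inl ⟨.inr b.1, fun e => b.2 (Sum.inr_injective e)⟩
    | .inr (.inr c) => .inr c
  left_inv := by rintro (⟨a | b, h⟩ | c) <;> rfl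
  right_inv := by rintro (a | b | c) <;> rfl

/-- The inputs of `(p ∘ᵢ q) ∘ᵢ' r` and of `(p ∘ᵢ' r) ∘ᵢ q`, where `i` and `i'` are different
inputs of `p`. -/
def graftSwap {i i' : I} (h : i ≠ i') (J K : Type) :
    Graft (Sum.inl ⟨i', h.symm⟩ : Graft i J) K ≃ Graft (Sum.inl ⟨i, h⟩ : Graft i' K) J where
  toFun
    | .inl ⟨.inl a, ha⟩ => .inl ⟨.inl ⟨a.1, fun e => ha (congrArg Sum.inl (Subtype.ext e))⟩,
        fun e => a.2 (congrArg Subtype.val (Sum.inl_injective e))⟩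
    | .inl ⟨.inr b, _⟩ => .inr b
    | .inr c => .inl ⟨.inr c, Sum.inr_ne_inl⟩
  invFun
    | .inl ⟨.inl a, ha⟩ => .inl ⟨.inl ⟨a.1, fun e => ha (congrArg Sum.inl (Subtype.ext e))⟩,
        fun e => a.2 (congrArg Subtype.val (Sum.inl_injective e))⟩
    | .inl ⟨.inr c, _⟩ => .inr c
    | .inr b => .inl ⟨.inr b, Sum.inr_ne_inl⟩
  left_inv := by rintro (⟨a | b, h⟩ | c) <;> rfl
  right_inv := by rintro (⟨a | b, h⟩ | c) <;> rfl

/-- The inputs of `id ∘ q` are those of `q`. -/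
def graftUnitLeft (J : Type) : Graft () J ≃ J where
  toFun
    | .inl a => (a.2 rfl).elim
    | .inr b => b
  invFun b := .inr b
  left_inv := by
    rintro (a | b)
    · exact (a.2 rfl).elim
    · rfl
  right_inv _ := rfl

open Classical in
/-- The inputs of `p ∘ᵢ id` are those of `p`. -/
def graftUnitRight (i : I) : Graft i Unit ≃ I where
  toFun
    | .inl a => a.1
    | .inr _ => i
  invFun a := if h : a = i then .inr () else .inl ⟨a, h⟩
  left_inv := by
    rintro (a | b)
    · exact dif_neg a.2
    · exact dif_pos rfl
  right_inv a := by
    by_cases h : a = i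
    · subst h; simp
    · simp [h]

variable (x : I → S) (z : J → S) (w : K → S)

theorem graftCongr_color (σ : I' ≃ I) (i : I') (τ : J' ≃ J) (a) :
    graftColor (fun a => x (σ a)) i (fun b => z (τ b)) a =
      graftColor x (σ i) z (graftCongr σ i τ a) := by
  rcases a with a | b <;> rfl

theorem graftAssoc_color (i : I) (j : J) (a) :
    graftColor (graftColor x i z) (Sum.inr j) w a =
      graftColor x i (graftColor z j w) (graftAssoc i j K a) := by
  rcases a with ⟨a | b, h⟩ | c <;> rfl

theorem graftSwap_color {i i' : I} (h : i ≠ i') (a) :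
    graftColor (graftColor x i z) (Sum.inl ⟨i', h.symm⟩) w a =
      graftColor (graftColor x i' w) (Sum.inl ⟨i, h⟩) z (graftSwap h J K a) := by
  rcases a with ⟨a | b, h⟩ | c <;> rfl

theorem graftUnitLeft_color (c : S) (a) :
    graftColor (fun _ : Unit => c) () z a = z (graftUnitLeft J a) := by
  rcases a with a | b
  · exact (a.2 rfl).elim
  · rfl

theorem graftUnitRight_color (i : I) (a) :
    graftColor x i (fun _ : Unit => x i) a = x (graftUnitRight i a) := by
  rcases a with a | b <;> rfl

end Index

/-- A (symmetric, unital) operad in topological spaces with set of colours `S`, indexed by finite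
sets of inputs: `obj I x y` is the space of operations whose inputs are labelled by the finite
set `I`, with input colours `x` and output colour `y`; for `I = Fin n` it is
`P(x₁, …, xₙ; y)`. A bijection `e : I ≃ J` acts on the right by `p ↦ p · e`, and `comp` is the
partial composition `(p, q) ↦ p ∘ᵢ q`. -/
structure TopOperad (S : Type) where
  obj (I : Type) [Finite I] (x : I → S) (y : S) : TopCat.{0}
  act {I J : Type} [Finite I] [Finite J] (e : I ≃ J) {x' : I → S} {x : J → S}
    (h : ∀ i, x' i = x (e i)) (y : S) : obj J x y ⟶ obj I x' y
  comp {I J : Type} [Finite I] [Finite J] (x : I → S) (y : S) (i : I) (z : J → S) :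
    C(obj I x y × obj J z (x i), obj (Graft i J) (graftColor x i z) y)
  one (c : S) : obj Unit (fun _ => c) c
  act_refl {I : Type} [Finite I] (x : I → S) (y : S) :
    act (Equiv.refl I) (fun _ => rfl : ∀ i, x i = x i) y = 𝟙 _
  act_trans {I J K : Type} [Finite I] [Finite J] [Finite K] (e : I ≃ J) (f : J ≃ K)
    {x'' : I → S} {x' : J → S} {x : K → S} (h : ∀ i, x'' i = x' (e i)) (h' : ∀ i, x' i = x (f i))
    (y : S) : act f h' y ≫ act e h y = act (e.trans f) (fun i => (h i).trans (h' (e i))) y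
  act_comp {I I' J J' : Type} [Finite I] [Finite I'] [Finite J] [Finite J'] (σ : I' ≃ I)
    (τ : J' ≃ J) (x : I → S) (y : S) (i : I') (z : J → S) (p : obj I x y)
    (q : obj J z (x (σ i))) :
    comp (fun a => x (σ a)) y i (fun b => z (τ b))
        (act σ (fun _ => rfl) y p, act τ (fun _ => rfl) (x (σ i)) q) =
      act (graftCongr σ i τ) (graftCongr_color x z σ i τ) y (comp x y (σ i) z (p, q))
  comp_assoc {I J K : Type} [Finite I] [Finite J] [Finite K] (x : I → S) (y : S) (i : I)
    (z : J → S) (j : J) (w : K → S) (p : obj I x y) (q : obj J z (x i)) (r : obj K w (z j)) :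
    comp (graftColor x i z) y (Sum.inr j) w (comp x y i z (p, q), r) =
      act (graftAssoc i j K) (graftAssoc_color x z w i j) y
        (comp x y i (graftColor z j w) (p, comp z (x i) j w (q, r)))
  comp_swap {I J K : Type} [Finite I] [Finite J] [Finite K] (x : I → S) (y : S) {i i' : I}
    (h : i ≠ i') (z : J → S) (w : K → S) (p : obj I x y) (q : obj J z (x i))
    (r : obj K w (x i')) :
    comp (graftColor x i z) y (Sum.inl ⟨i', h.symm⟩) w (comp x y i z (p, q), r) =
      act (graftSwap h J K) (graftSwap_color x z w h) y
        (comp (graftColor x i' w) y (Sum.inl ⟨i, h⟩) z (comp x y i' w (p, r), q))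
  one_comp {J : Type} [Finite J] (c : S) (z : J → S) (q : obj J z c) :
    comp (fun _ : Unit => c) c () z (one c, q) =
      act (graftUnitLeft J) (graftUnitLeft_color z c) c q
  comp_one {I : Type} [Finite I] (x : I → S) (y : S) (i : I) (p : obj I x y) :
    comp x y i (fun _ => x i) (p, one (x i)) =
      act (graftUnitRight i) (graftUnitRight_color x i) y p

/-- A (symmetric, unital) operad in differential graded `k`-vector spaces (`ℤ`-graded, with
differential of degree `-1`) with set of colours `S`, with the same conventions as for
`TopOperad`. Partial compositions are morphisms of complexes from the tensor product (`d_comp`),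
and the parallel associativity `comp_swap` holds up to the Koszul sign. -/
structure DGOperad (k : Type u) [Field k] (S : Type) where
  obj (I : Type) [Finite I] (x : I → S) (y : S) : ChainComplex (ModuleCat.{u} k) ℤ
  act {I J : Type} [Finite I] [Finite J] (e : I ≃ J) {x' : I → S} {x : J → S}
    (h : ∀ i, x' i = x (e i)) (y : S) : obj J x y ⟶ obj I x' y
  comp {I J : Type} [Finite I] [Finite J] (x : I → S) (y : S) (i : I) (z : J → S) {p q n : ℤ}
    (h : p + q = n) : (obj I x y).X p →ₗ[k] (obj J z (x i)).X q →ₗ[k]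
      (obj (Graft i J) (graftColor x i z) y).X n
  one (c : S) : (obj Unit (fun _ => c) c).X 0
  d_one (c : S) (n : ℤ) : ((obj Unit (fun _ => c) c).d 0 n).hom (one c) = 0
  d_comp {I J : Type} [Finite I] [Finite J] (x : I → S) (y : S) (i : I) (z : J → S)
    {p q n p' q' n' : ℤ} (h : p + q = n) (hp : p' + 1 = p) (hq : q' + 1 = q) (hn : n' + 1 = n)
    (h1 : p' + q = n') (h2 : p + q' = n') (a : (obj I x y).X p) (b : (obj J z (x i)).X q) :
    ((obj (Graft i J) (graftColor x i z) y).d n n').hom (comp x y i z h a b) =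
      comp x y i z h1 (((obj I x y).d p p').hom a) b +
        (p.negOnePow : ℤ) • comp x y i z h2 a (((obj J z (x i)).d q q').hom b)
  act_refl {I : Type} [Finite I] (x : I → S) (y : S) :
    act (Equiv.refl I) (fun _ => rfl : ∀ i, x i = x i) y = 𝟙 _
  act_trans {I J K : Type} [Finite I] [Finite J] [Finite K] (e : I ≃ J) (f : J ≃ K)
    {x'' : I → S} {x' : J → S} {x : K → S} (h : ∀ i, x'' i = x' (e i)) (h' : ∀ i, x' i = x (f i))
    (y : S) : act f h' y ≫ act e h y = act (e.trans f) (fun i => (h i).trans (h' (e i))) y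
  act_comp {I I' J J' : Type} [Finite I] [Finite I'] [Finite J] [Finite J'] (σ : I' ≃ I)
    (τ : J' ≃ J) (x : I → S) (y : S) (i : I') (z : J → S) {p q n : ℤ} (h : p + q = n)
    (a : (obj I x y).X p) (b : (obj J z (x (σ i))).X q) :
    comp (fun a => x (σ a)) y i (fun b => z (τ b)) h
        (((act σ (fun _ => rfl) y).f p).hom a) (((act τ (fun _ => rfl) (x (σ i))).f q).hom b) =
      ((act (graftCongr σ i τ) (graftCongr_color x z σ i τ) y).f n).hom (comp x y (σ i) z h a b)
  comp_assoc {I J K : Type} [Finite I] [Finite J] [Finite K] (x : I → S) (y : S) (i : I)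
    (z : J → S) (j : J) (w : K → S) {p q r s t n : ℤ} (h1 : p + q = s) (h2 : s + r = n)
    (h3 : q + r = t) (h4 : p + t = n) (a : (obj I x y).X p) (b : (obj J z (x i)).X q)
    (c : (obj K w (z j)).X r) :
    comp (graftColor x i z) y (Sum.inr j) w h2 (comp x y i z h1 a b) c =
      ((act (graftAssoc i j K) (graftAssoc_color x z w i j) y).f n).hom
        (comp x y i (graftColor z j w) h4 a (comp z (x i) j w h3 b c))
  comp_swap {I J K : Type} [Finite I] [Finite J] [Finite K] (x : I → S) (y : S) {i i' : I}
    (h : i ≠ i') (z : J → S) (w : K → S) {p q r s t n : ℤ} (h1 : p + q = s) (h2 : s + r = n)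
    (h3 : p + r = t) (h4 : t + q = n) (a : (obj I x y).X p) (b : (obj J z (x i)).X q)
    (c : (obj K w (x i')).X r) :
    comp (graftColor x i z) y (Sum.inl ⟨i', h.symm⟩) w h2 (comp x y i z h1 a b) c =
      ((q * r).negOnePow : ℤ) • ((act (graftSwap h J K) (graftSwap_color x z w h) y).f n).hom
        (comp (graftColor x i' w) y (Sum.inl ⟨i, h⟩) z h4 (comp x y i' w h3 a c) b)
  one_comp {J : Type} [Finite J] (c : S) (z : J → S) {q : ℤ} (h : 0 + q = q)
    (b : (obj J z c).X q) :
    comp (fun _ : Unit => c) c () z h (one c) b =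
      ((act (graftUnitLeft J) (graftUnitLeft_color z c) c).f q).hom b
  comp_one {I : Type} [Finite I] (x : I → S) (y : S) (i : I) {p : ℤ} (h : p + 0 = p)
    (a : (obj I x y).X p) :
    comp x y i (fun _ => x i) h a (one (x i)) =
      ((act (graftUnitRight i) (graftUnitRight_color x i) y).f p).hom a

section Operads
variable {k : Type u} [Field k] {S : Type}

/-- A morphism of dg operads (with the same set of colours). -/
structure DGOperad.Hom (P Q : DGOperad k S) where
  app (I : Type) [Finite I] (x : I → S) (y : S) : P.obj I x y ⟶ Q.obj I x y
  map_act {I J : Type} [Finite I] [Finite J] (e : I ≃ J) {x' : I → S} {x : J → S}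
    (h : ∀ i, x' i = x (e i)) (y : S) : P.act e h y ≫ app I x' y = app J x y ≫ Q.act e h y
  map_comp {I J : Type} [Finite I] [Finite J] (x : I → S) (y : S) (i : I) (z : J → S) {p q n : ℤ}
    (h : p + q = n) (a : (P.obj I x y).X p) (b : (P.obj J z (x i)).X q) :
    ((app (Graft i J) (graftColor x i z) y).f n).hom (P.comp x y i z h a b) =
      Q.comp x y i z h (((app I x y).f p).hom a) (((app J z (x i)).f q).hom b)
  map_one (c : S) : ((app Unit (fun _ => c) c).f 0).hom (P.one c) = Q.one c

/-- A morphism of dg operads is a quasi-isomorphism if all its components are. -/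
def DGOperad.Hom.IsQuasiIso {P Q : DGOperad k S} (φ : P.Hom Q) : Prop :=
  ∀ (I : Type) [Finite I] (x : I → S) (y : S), QuasiIso (φ.app I x y)

variable (k) in
/-- The dg operad of singular chains of a topological operad: its compositions are induced by
those of the topological operad through the Eilenberg–Zilber cross product. -/
def TopOperad.chains (O : TopOperad S) : DGOperad k S where
  obj I _ x y := (chainsFunctor k).obj (O.obj I x y)
  act e _ _ h y := (chainsFunctor k).map (O.act e h y)
  comp x y i z _ _ _ h := cross (O.comp x y i z) h
  one c := gen 0 rfl (ContinuousMap.const _ (O.one c))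
  d_one c n := chains_d_gen_zero _ _
  d_comp x y i z _ _ _ _ _ _ h hp hq hn h1 h2 a b := d_cross _ h hp hq hn h1 h2 a b
  act_refl x y := by rw [O.act_refl, (chainsFunctor k).map_id]
  act_trans e f _ _ _ h h' y := by rw [← O.act_trans e f h h', (chainsFunctor k).map_comp]
  act_comp σ τ x y i z _ _ _ h a b :=
    cross_map_map _ _ _ _ _ (fun u v => O.act_comp σ τ x y i z u v) h a b
  comp_assoc x y i z j w _ _ _ _ _ _ h1 h2 h3 h4 a b c :=
    cross_assoc_map _ _ _ _ _ (fun u v t => O.comp_assoc x y i z j w u v t) h1 h2 h3 h4 a b c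
  comp_swap x y _ _ h z w _ _ _ _ _ _ h1 h2 h3 h4 a b c :=
    cross_swap_map _ _ _ _ _ (fun u v t => O.comp_swap x y h z w u v t) h1 h2 h3 h4 a b c
  one_comp c z q h b := cross_gen_zero_left _ h rfl _ _ (fun v => O.one_comp c z v) b
  comp_one x y i p h a := cross_gen_zero_right _ h rfl _ _ (fun u => O.comp_one x y i u) a

end Operads

section Homology
variable {k : Type u} [Field k]

variable (k) in
/-- The functor sending a complex to its homology, seen as a complex with zero differential. -/
def gradedHomology : ChainComplex (ModuleCat.{u} k) ℤ ⥤ ChainComplex (ModuleCat.{u} k) ℤ where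
  obj A := { X := fun n => A.homology n, d := fun _ _ => 0 }
  map f := { f := fun n => HomologicalComplex.homologyMap f n }
  map_id A := by
    ext1 n
    exact HomologicalComplex.homologyMap_id A n
  map_comp f g := by
    ext1 n
    exact HomologicalComplex.homologyMap_comp f g n

variable (A B : ChainComplex (ModuleCat.{u} k) ℤ)

/-- The space of cycles of degree `n`. -/
abbrev Cycle (n : ℤ) : Submodule k (A.X n) := LinearMap.ker (A.d n (n - 1)).hom

/-- The homology class of a cycle. -/
def homClass (n : ℤ) : Cycle A n →ₗ[k] ((gradedHomology k).obj A).X n :=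
  (A.liftCycles (ModuleCat.ofHom (Cycle A n).subtype) (n - 1) (by simp)
    (ModuleCat.hom_ext (LinearMap.ext fun z => z.2)) ≫ A.homologyπ n).hom

theorem homClass_surjective (n : ℤ) : Function.Surjective (homClass A n) := by
  intro a
  have := (ModuleCat.epi_iff_surjective (A.homologyπ n)).1 inferInstance
  obtain ⟨c, rfl⟩ := this a
  have h0 : (A.d n (n - 1)).hom ((A.iCycles n).hom c) = 0 := by
    have := A.iCycles_d n (n - 1)
    exact congr(($this).hom c)
  refine ⟨⟨(A.iCycles n).hom c, h0⟩, ?_⟩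
  change (A.homologyπ n).hom ((A.liftCycles _ _ _ _).hom _) = (A.homologyπ n).hom c
  congr 1
  have hm := (ModuleCat.mono_iff_injective (A.iCycles n)).1 inferInstance
  apply hm
  exact congr(($(A.liftCycles_i (ModuleCat.ofHom (Cycle A n).subtype) (n - 1) (by simp)
    (ModuleCat.hom_ext (LinearMap.ext fun z => z.2)))).hom ⟨(A.iCycles n).hom c, h0⟩)

theorem homClass_eq_zero_iff (n : ℤ) (z : Cycle A n) :
    homClass A n z = 0 ↔ ∃ w : A.X (n + 1), (A.d (n + 1) n).hom w = z := by
  have hlift := A.liftCycles_i (ModuleCat.ofHom (Cycle A n).subtype) (n - 1) (by simp)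
    (ModuleCat.hom_ext (LinearMap.ext fun z => z.2))
  set l := A.liftCycles (ModuleCat.ofHom (Cycle A n).subtype) (n - 1) (by simp)
    (ModuleCat.hom_ext (LinearMap.ext fun z => z.2)) with hl
  have hz : (A.iCycles n).hom (l.hom z) = z := congr(($hlift).hom z)
  have hc (w : A.X (n + 1)) : (A.iCycles n).hom ((A.toCycles (n + 1) n).hom w) =
      (A.d (n + 1) n).hom w := congr(($(A.toCycles_i (n + 1) n)).hom w)
  have hm := (ModuleCat.mono_iff_injective (A.iCycles n)).1 inferInstance
  have hex := ShortComplex.exact_of_g_is_cokernel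
    (ShortComplex.mk _ _ (A.toCycles_comp_homologyπ (n + 1) n))
    (A.homologyIsCokernel (n + 1) n (by simp))
  rw [ShortComplex.moduleCat_exact_iff] at hex
  constructor
  · intro h
    obtain ⟨w, hw⟩ := hex (l.hom z) h
    exact ⟨w, ((hc w).symm.trans (congrArg _ hw)).trans hz⟩
  · rintro ⟨w, hw⟩
    have : l.hom z = (A.toCycles (n + 1) n).hom w := by
      apply hm
      exact hz.trans (hw.symm.trans (hc w).symm)
    change (A.homologyπ n).hom (l.hom z) = 0
    rw [this]
    exact congr(($(A.toCycles_comp_homologyπ (n + 1) n)).hom w)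

variable {A B}

theorem map_mem_cycle (f : A ⟶ B) {n : ℤ} {z : A.X n} (hz : z ∈ Cycle A n) :
    (f.f n).hom z ∈ Cycle B n := by
  have h1 : (B.d n (n - 1)).hom ((f.f n).hom z) = (f.f (n - 1)).hom ((A.d n (n - 1)).hom z) :=
    congr(($(f.comm n (n - 1))).hom z)
  rw [LinearMap.mem_ker, h1, LinearMap.mem_ker.1 hz, map_zero]

theorem homClass_map (f : A ⟶ B) (n : ℤ) (z : Cycle A n) :
    (((gradedHomology k).map f).f n).hom (homClass A n z) =
      homClass B n ⟨(f.f n).hom z, map_mem_cycle f z.2⟩ := by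
  have h1 := A.liftCycles_comp_cyclesMap (ModuleCat.ofHom (Cycle A n).subtype) (n - 1) (by simp)
    (ModuleCat.hom_ext (LinearMap.ext fun z => z.2)) f
  have h2 := HomologicalComplex.homologyπ_naturality f n
  set l := A.liftCycles (ModuleCat.ofHom (Cycle A n).subtype) (n - 1) (by simp)
    (ModuleCat.hom_ext (LinearMap.ext fun z => z.2)) with hl
  have e1 : (((gradedHomology k).map f).f n).hom (homClass A n z) =
    (B.homologyπ n).hom ((HomologicalComplex.cyclesMap f n).hom (l.hom z)) :=
    congr(($h2).hom (l.hom z))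
  rw [e1]
  change _ = (B.homologyπ n).hom _
  congr 1
  have hm := (ModuleCat.mono_iff_injective (B.iCycles n)).1 inferInstance
  apply hm
  have e2 : (HomologicalComplex.cyclesMap f n).hom (l.hom z) = _ := congr(($h1).hom z)
  have e3 := congr(($(B.liftCycles_i (ModuleCat.ofHom (Cycle B n).subtype) (n - 1) (by simp)
    (ModuleCat.hom_ext (LinearMap.ext fun z => z.2)))).hom ⟨(f.f n).hom z, map_mem_cycle f z.2⟩)
  refine Eq.trans ?_ e3.symm
  rw [e2]
  exact congr(($(B.liftCycles_i (ModuleCat.ofHom (Cycle A n).subtype ≫ f.f n) (n - 1) (by simp)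
    (ModuleCat.hom_ext (LinearMap.ext fun z => map_mem_cycle f z.2)))).hom z)

variable {D : ChainComplex (ModuleCat.{u} k) ℤ}

/-- Bilinear maps of all bidegrees that form a morphism of complexes from the tensor product. -/
structure IsLeibniz (μ : ∀ p q n : ℤ, p + q = n → (A.X p →ₗ[k] B.X q →ₗ[k] D.X n)) :
    Prop where
  d_eq {p q n p' q' n' : ℤ} (h : p + q = n) (hp : p' + 1 = p) (hq : q' + 1 = q) (hn : n' + 1 = n)
    (h1 : p' + q = n') (h2 : p + q' = n') (a : A.X p) (b : B.X q) :
    (D.d n n').hom (μ p q n h a b) = μ p' q n' h1 ((A.d p p').hom a) b +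
      (p.negOnePow : ℤ) • μ p q' n' h2 a ((B.d q q').hom b)

section Bilin
variable {μ : ∀ p q n : ℤ, p + q = n → (A.X p →ₗ[k] B.X q →ₗ[k] D.X n)}

theorem IsLeibniz.mem_cycle (hμ : IsLeibniz μ) {p q n : ℤ} (h : p + q = n) {a : A.X p}
    {b : B.X q} (ha : a ∈ Cycle A p) (hb : b ∈ Cycle B q) : μ p q n h a b ∈ Cycle D n := by
  rw [LinearMap.mem_ker] at ha hb ⊢
  rw [hμ.d_eq h (p' := p - 1) (q' := q - 1) (by omega) (by omega) (by omega) (by omega) (by omega),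
    ha, hb]
  simp

theorem IsLeibniz.class_left (hμ : IsLeibniz μ) {p q n : ℤ} (h : p + q = n) {z z' : Cycle A p}
    (b : Cycle B q) (hz : homClass A p z = homClass A p z') :
    homClass D n ⟨μ p q n h z b, hμ.mem_cycle h z.2 b.2⟩ =
      homClass D n ⟨μ p q n h z' b, hμ.mem_cycle h z'.2 b.2⟩ := by
  rw [← sub_eq_zero, ← map_sub, homClass_eq_zero_iff] at hz ⊢
  obtain ⟨w, hw⟩ := hz
  refine ⟨μ (p + 1) q (n + 1) (by omega) w b, ?_⟩
  have hb := LinearMap.mem_ker.1 b.2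
  rw [hμ.d_eq _ (p' := p) (q' := q - 1) (by omega) (by omega) (by omega) h (by omega), hw, hb]
  simp

theorem IsLeibniz.class_right (hμ : IsLeibniz μ) {p q n : ℤ} (h : p + q = n) (a : Cycle A p)
    {z z' : Cycle B q} (hz : homClass B q z = homClass B q z') :
    homClass D n ⟨μ p q n h a z, hμ.mem_cycle h a.2 z.2⟩ =
      homClass D n ⟨μ p q n h a z', hμ.mem_cycle h a.2 z'.2⟩ := by
  rw [← sub_eq_zero, ← map_sub, homClass_eq_zero_iff] at hz ⊢
  obtain ⟨w, hw⟩ := hz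
  refine ⟨(p.negOnePow : ℤ) • μ p (q + 1) (n + 1) (by omega) a w, ?_⟩
  have ha := LinearMap.mem_ker.1 a.2
  rw [map_zsmul, hμ.d_eq _ (p' := p - 1) (q' := q) (by omega) (by omega) (by omega) (by omega) h, hw, ha,
    map_zero, LinearMap.zero_apply, zero_add, smul_smul, ← Units.val_mul,
    ← Int.negOnePow_add, Int.negOnePow_even _ ⟨p, rfl⟩, Units.val_one, one_smul, Submodule.coe_sub,
    map_sub]
  rfl

end Bilin

/-- A linear choice of representing cycles. -/
def homRep (A : ChainComplex (ModuleCat.{u} k) ℤ) (n : ℤ) :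
    ((gradedHomology k).obj A).X n →ₗ[k] Cycle A n :=
  ((homClass A n).exists_rightInverse_of_surjective
    (LinearMap.range_eq_top.2 (homClass_surjective A n))).choose

theorem homClass_homRep (A : ChainComplex (ModuleCat.{u} k) ℤ) (n : ℤ)
    (a : ((gradedHomology k).obj A).X n) : homClass A n (homRep A n a) = a :=
  congr($(((homClass A n).exists_rightInverse_of_surjective
    (LinearMap.range_eq_top.2 (homClass_surjective A n))).choose_spec) a)

/-- The bilinear map `([a], [b]) ↦ [μ a b]` in homology. By `homBilin_class` it does not depend
on the choice of representatives. -/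
def homBilin (μ : ∀ p q n : ℤ, p + q = n → (A.X p →ₗ[k] B.X q →ₗ[k] D.X n)) (hμ : IsLeibniz μ)
    {p q n : ℤ} (h : p + q = n) :
    ((gradedHomology k).obj A).X p →ₗ[k] ((gradedHomology k).obj B).X q →ₗ[k]
      ((gradedHomology k).obj D).X n :=
  LinearMap.mk₂ k (fun a b => homClass D n ⟨μ p q n h (homRep A p a) (homRep B q b),
      hμ.mem_cycle h (homRep A p a).2 (homRep B q b).2⟩)
    (fun a a' b => by
      rw [← map_add]
      exact congrArg _ (Subtype.ext (by simp)))
    (fun c a b => by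
      rw [← map_smul]
      exact congrArg _ (Subtype.ext (by simp)))
    (fun a b b' => by
      rw [← map_add]
      exact congrArg _ (Subtype.ext (by simp)))
    (fun c a b => by
      rw [← map_smul]
      exact congrArg _ (Subtype.ext (by simp)))

theorem homBilin_class (μ : ∀ p q n : ℤ, p + q = n → (A.X p →ₗ[k] B.X q →ₗ[k] D.X n))
    (hμ : IsLeibniz μ) {p q n : ℤ} (h : p + q = n) (a : Cycle A p) (b : Cycle B q) :
    homBilin μ hμ h (homClass A p a) (homClass B q b) =
      homClass D n ⟨μ p q n h a b, hμ.mem_cycle h a.2 b.2⟩ :=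
  (hμ.class_left h _ (homClass_homRep A p _)).trans
    (hμ.class_right h _ (homClass_homRep B q _))

end Homology

section HomologyOperad
variable {k : Type u} [Field k] {S : Type}

theorem DGOperad.one_mem_cycle (P : DGOperad k S) (c : S) : P.one c ∈ Cycle _ 0 :=
  P.d_one c _

theorem DGOperad.isLeibniz (P : DGOperad k S) {I J : Type} [Finite I] [Finite J] (x : I → S)
    (y : S) (i : I) (z : J → S) : IsLeibniz (k := k) (fun _ _ _ h => P.comp x y i z h) :=
  ⟨fun h hp hq hn h1 h2 a b => P.d_comp x y i z h hp hq hn h1 h2 a b⟩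

/-- The homology operad of a dg operad, seen as a dg operad with zero differential. -/
def DGOperad.homology (P : DGOperad k S) : DGOperad k S where
  obj I _ x y := (gradedHomology k).obj (P.obj I x y)
  act e _ _ h y := (gradedHomology k).map (P.act e h y)
  comp x y i z _ _ _ h := homBilin _ (P.isLeibniz x y i z) h
  one c := homClass _ 0 ⟨P.one c, P.one_mem_cycle c⟩
  d_one c n := rfl
  d_comp x y i z _ _ _ _ _ _ h _ _ _ h1 h2 a b := by
    change 0 = homBilin _ (P.isLeibniz x y i z) h1 0 b +
      _ • homBilin _ (P.isLeibniz x y i z) h2 a 0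
    simp
  act_refl x y := by rw [P.act_refl, (gradedHomology k).map_id]
  act_trans e f _ _ _ h h' y := by rw [← P.act_trans e f h h', (gradedHomology k).map_comp]
  act_comp σ τ x y i z p q n h a b := by
    obtain ⟨a, rfl⟩ := homClass_surjective _ _ a
    obtain ⟨b, rfl⟩ := homClass_surjective _ _ b
    rw [homBilin_class, homClass_map, homClass_map, homBilin_class, homClass_map]
    exact congrArg _ (Subtype.ext (P.act_comp σ τ x y i z h a b))
  comp_assoc x y i z j w p q r s t n h1 h2 h3 h4 a b c := by
    obtain ⟨a, rfl⟩ := homClass_surjective _ _ a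
    obtain ⟨b, rfl⟩ := homClass_surjective _ _ b
    obtain ⟨c, rfl⟩ := homClass_surjective _ _ c
    rw [homBilin_class, homBilin_class, homBilin_class]
    refine (homBilin_class _ (P.isLeibniz (graftColor x i z) y (Sum.inr j) w) h2 _ c).trans
      (Eq.trans ?_ (homClass_map _ n _).symm)
    exact congrArg _ (Subtype.ext (P.comp_assoc x y i z j w h1 h2 h3 h4 a b c))
  comp_swap x y i i' h z w p q r s t n h1 h2 h3 h4 a b c := by
    obtain ⟨a, rfl⟩ := homClass_surjective _ _ a
    obtain ⟨b, rfl⟩ := homClass_surjective _ _ b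
    obtain ⟨c, rfl⟩ := homClass_surjective _ _ c
    rw [homBilin_class, homBilin_class]
    refine (homBilin_class _ (P.isLeibniz (graftColor x i z) y (Sum.inl ⟨i', h.symm⟩) w)
      h2 _ c).trans (Eq.trans ?_ (congrArg (fun m => ((q * r).negOnePow : ℤ) • m)
        ((congrArg _ (homBilin_class _
          (P.isLeibniz (graftColor x i' w) y (Sum.inl ⟨i, h⟩) z) h4 _ b)).trans
            (homClass_map _ n _))).symm)
    rw [← map_zsmul]
    exact congrArg _ (Subtype.ext (P.comp_swap x y h z w h1 h2 h3 h4 a b c))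
  one_comp c z q h b := by
    obtain ⟨b, rfl⟩ := homClass_surjective _ _ b
    rw [homBilin_class, homClass_map]
    exact congrArg _ (Subtype.ext (P.one_comp c z h b))
  comp_one x y i p h a := by
    obtain ⟨a, rfl⟩ := homClass_surjective _ _ a
    rw [homBilin_class, homClass_map]
    exact congrArg _ (Subtype.ext (P.comp_one x y i h a))

/-- The complex `P(c, …, c; y)` with `n` inputs of the same colour, seen as a complex of
`S_n`-modules. Since permutations act on the right on operations, the left action of `σ` used here
is the right action of `σ⁻¹`. -/
def DGOperad.symModule (P : DGOperad k S) (n : ℕ) (c y : S) :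
    Action (ChainComplex (ModuleCat.{u} k) ℤ) (Equiv.Perm (Fin n)) where
  V := P.obj (Fin n) (fun _ => c) y
  ρ :=
    { toFun := fun σ => P.act σ⁻¹ (fun _ => rfl) y
      map_one' := P.act_refl _ _
      map_mul' := fun σ τ => by
        rw [End.mul_def, P.act_trans]
        congr 1 }

/-- A complex `A` of modules over a group `G` is formal if there are quasi-isomorphisms of complexes
of `G`-modules `A ← M → H(A)`, for some complex `M` of `G`-modules. -/
def IsFormalModule {G : Type} [Group G] (A : Action (ChainComplex (ModuleCat.{u} k) ℤ) G) : Prop :=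
  ∃ (M : Action (ChainComplex (ModuleCat.{u} k) ℤ) G) (γ : M ⟶ A)
    (ψ : M ⟶ ((gradedHomology k).mapAction G).obj A), QuasiIso γ.hom ∧ QuasiIso ψ.hom

variable (k) in
/-- A topological operad is formal over `k` if there are quasi-isomorphisms of dg operads from some
dg operad to the singular chains of the operad and to the homology of these singular chains. -/
def TopOperad.IsFormal (O : TopOperad S) : Prop :=
  ∃ (P : DGOperad k S) (γ : P.Hom (O.chains k)) (ψ : P.Hom (O.chains k).homology),
    γ.IsQuasiIso ∧ ψ.IsQuasiIso

end HomologyOperad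

section Cheese

/-- The two colours of the Swiss-cheese operad. -/
inductive Colour : Type
  | closed
  | opened

variable (d : ℕ)

/-- The open upper half-space `x_d > 0` in `ℝ^d`. -/
def upperHalf : Set (EuclideanSpace ℝ (Fin d)) := {v | ∀ i : Fin d, (i : ℕ) + 1 = d → 0 < v i}

/-- The hyperplane `x_d = 0` in `ℝ^d`. -/
def boundary : Set (EuclideanSpace ℝ (Fin d)) := {v | ∀ i : Fin d, (i : ℕ) + 1 = d → v i = 0}

variable {d}

/-- The region with centre `b.1` and radius `b.2`: an open ball for the closed colour, its
intersection with the upper half-space for the open colour. -/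
def region (s : Colour) (b : EuclideanSpace ℝ (Fin d) × ℝ) : Set (EuclideanSpace ℝ (Fin d)) :=
  match s with
  | .closed => Metric.ball b.1 b.2
  | .opened => Metric.ball b.1 b.2 ∩ upperHalf d

/-- The family `f` of centres and radii describes an operation of the `d`-dimensional
Swiss-cheese operad with input colours `x` and output colour `y`: a nonempty family of pairwise
disjoint balls (closed inputs) and of half-balls centred at the hyperplane `x_d = 0` (open
inputs), contained in the unit ball if the output is closed and in the unit upper half-ball if
the output is open. An operation with closed output has only closed inputs. -/
structure IsConfig {I : Type} (x : I → Colour) (y : Colour)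
    (f : I → EuclideanSpace ℝ (Fin d) × ℝ) : Prop where
  nonempty : Nonempty I
  closed_of_closed : y = .closed → ∀ i, x i = .closed
  radius_pos : ∀ i, 0 < (f i).2
  centre_mem : ∀ i, x i = .opened → (f i).1 ∈ boundary d
  subset : ∀ i, region (x i) (f i) ⊆ region y (0, 1)
  disjoint : ∀ i j, i ≠ j → Disjoint (region (x i) (f i)) (region (x j) (f j))

/-- The image of the region `b'` under the similarity `v ↦ b.1 + b.2 • v` that maps the unit
ball to the ball `b`. -/
def insertRegion (b b' : EuclideanSpace ℝ (Fin d) × ℝ) : EuclideanSpace ℝ (Fin d) × ℝ :=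
  (b.1 + b.2 • b'.1, b.2 * b'.2)

theorem region_insertRegion {s : Colour} {b : EuclideanSpace ℝ (Fin d) × ℝ} (hb : 0 < b.2)
    (h : s = .opened → b.1 ∈ boundary d) (b' : EuclideanSpace ℝ (Fin d) × ℝ) :
    region s (insertRegion b b') = (fun v => b.1 + b.2 • v) '' region s b' := by
  have key : Metric.ball (b.1 + b.2 • b'.1) (b.2 * b'.2) =
      (fun v => b.1 + b.2 • v) '' Metric.ball b'.1 b'.2 := by
    ext v
    constructor
    · intro hv
      refine ⟨b.2⁻¹ • (v - b.1), ?_, ?_⟩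
      · rw [Metric.mem_ball, dist_eq_norm] at hv ⊢
        have e : b.2⁻¹ • (v - b.1) - b'.1 = b.2⁻¹ • (v - (b.1 + b.2 • b'.1)) := by
          rw [← sub_sub, smul_sub _ (v - b.1), smul_smul, inv_mul_cancel₀ hb.ne', one_smul]
        rw [e, norm_smul, norm_inv, Real.norm_of_nonneg hb.le, inv_mul_lt_iff₀ hb]
        exact hv
      · simp [smul_smul, mul_inv_cancel₀ hb.ne']
    · rintro ⟨w, hw, rfl⟩
      rw [Metric.mem_ball, dist_eq_norm] at hw ⊢
      have e : b.1 + b.2 • w - (b.1 + b.2 • b'.1) = b.2 • (w - b'.1) := by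
        rw [smul_sub]; abel
      change ‖b.1 + b.2 • w - _‖ < _
      rw [e, norm_smul, Real.norm_of_nonneg hb.le]
      exact mul_lt_mul_of_pos_left hw hb
  cases s with
  | closed => exact key
  | opened =>
    change Metric.ball (b.1 + b.2 • b'.1) (b.2 * b'.2) ∩ upperHalf d = _
    rw [key]
    have hup : ∀ v, b.1 + b.2 • v ∈ upperHalf d ↔ v ∈ upperHalf d := by
      intro v
      refine forall_congr' fun i => forall_congr' fun hi => ?_
      have := h rfl i hi
      simp [this, hb]
    ext v
    constructor
    · rintro ⟨⟨w, hw, rfl⟩, hv⟩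
      exact ⟨w, ⟨hw, (hup w).1 hv⟩, rfl⟩
    · rintro ⟨w, ⟨hw, hw'⟩, rfl⟩
      exact ⟨⟨w, hw, rfl⟩, (hup w).2 hw'⟩

variable {I J : Type} {x : I → Colour} {y : Colour} {i : I} {z : J → Colour}
  {f : I → EuclideanSpace ℝ (Fin d) × ℝ} {g : J → EuclideanSpace ℝ (Fin d) × ℝ}

theorem IsConfig.region_eq (hf : IsConfig x y f) (hg : IsConfig z (x i) g) (j : J) :
    region (z j) (insertRegion (f i) (g j)) =
      (fun v => (f i).1 + (f i).2 • v) '' region (z j) (g j) := by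
  refine region_insertRegion (hf.radius_pos i) (fun hj => hf.centre_mem i ?_) _
  cases h : x i with
  | opened => rfl
  | closed => exact absurd ((hg.closed_of_closed h j).symm.trans hj) (by simp)

theorem IsConfig.region_subset (hf : IsConfig x y f) (hg : IsConfig z (x i) g) (j : J) :
    region (z j) (insertRegion (f i) (g j)) ⊆ region (x i) (f i) := by
  have h := region_insertRegion (s := x i) (hf.radius_pos i) (hf.centre_mem i) (0, 1)
  simp only [insertRegion, smul_zero, add_zero, mul_one, Prod.mk.eta] at h
  rw [hf.region_eq hg, h]
  exact Set.image_mono (hg.subset j)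

theorem IsConfig.graft (hf : IsConfig x y f) (hg : IsConfig z (x i) g) :
    IsConfig (graftColor x i z) y
      (Sum.elim (fun a => f a) (fun j => insertRegion (f i) (g j)) : Graft i J → _) where
  nonempty := hg.nonempty.map Sum.inr
  closed_of_closed hy a := by
    rcases a with a | j
    · exact hf.closed_of_closed hy a
    · exact hg.closed_of_closed (hf.closed_of_closed hy i) j
  radius_pos a := by
    rcases a with a | j
    · exact hf.radius_pos a
    · exact mul_pos (hf.radius_pos i) (hg.radius_pos j)
  centre_mem a ha := by
    rcases a with a | j
    · exact hf.centre_mem a ha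
    · have hi : x i = .opened := by
        cases h : x i with
        | opened => rfl
        | closed => exact absurd ((hg.closed_of_closed h j).symm.trans ha) (by simp)
      intro l hl
      have h1 := hf.centre_mem i hi l hl
      have h2 := hg.centre_mem j ha l hl
      simp [insertRegion, h1, h2]
  subset a := by
    rcases a with a | j
    · exact hf.subset a
    · exact (hf.region_subset hg j).trans (hf.subset i)
  disjoint a b hab := by
    rcases a with a | j <;> rcases b with b | l
    · exact hf.disjoint a b fun e => hab (congrArg Sum.inl (Subtype.ext e))
    · exact (hf.disjoint a i a.2).mono_right (hf.region_subset hg l)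
    · exact (hf.disjoint i b b.2.symm).mono_left (hf.region_subset hg j)
    · change Disjoint (region (z j) (insertRegion (f i) (g j)))
        (region (z l) (insertRegion (f i) (g l)))
      rw [hf.region_eq hg, hf.region_eq hg]
      refine Set.disjoint_image_of_injective (fun v w hvw => ?_)
        (hg.disjoint j l fun e => hab (congrArg Sum.inr e))
      exact smul_right_injective _ (hf.radius_pos i).ne' (add_left_cancel hvw)

variable (d) in
/-- The `d`-dimensional Swiss-cheese operad. A bijection of the labels acts by relabelling, and
`p ∘ᵢ q` replaces the ball or half-ball labelled `i` of `p` by the image of `q` under the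
translation and dilation mapping the unit ball to the ball labelled `i`. -/
def swissCheese : TopOperad Colour where
  obj I _ x y := TopCat.of {f : I → EuclideanSpace ℝ (Fin d) × ℝ // IsConfig x y f}
  act e x' x h y := TopCat.ofHom
    { toFun := fun f => ⟨fun a => f.1 (e a),
        { nonempty := f.2.nonempty.map e.symm
          closed_of_closed := fun hy a => (h a).trans (f.2.closed_of_closed hy _)
          radius_pos := fun a => f.2.radius_pos _
          centre_mem := fun a ha => f.2.centre_mem _ ((h a).symm.trans ha)
          subset := fun a => by rw [h a]; exact f.2.subset _
          disjoint := fun a b hab => by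
            rw [h a, h b]
            exact f.2.disjoint _ _ (e.injective.ne hab) }⟩
      continuous_toFun := Continuous.subtype_mk (continuous_pi fun a =>
        (continuous_apply (e a)).comp (continuous_subtype_val (p := IsConfig x y))) _ }
  comp x y i z :=
    { toFun := fun pq => ⟨_, pq.1.2.graft pq.2.2⟩
      continuous_toFun := by
        refine Continuous.subtype_mk (continuous_pi fun a => ?_) _
        rcases a with a | j
        · exact (continuous_apply a.1).comp (continuous_subtype_val.comp continuous_fst)
        · have h1 := (continuous_apply i).comp (continuous_subtype_val.comp
            (continuous_fst (X := {f // IsConfig (d := d) x y f})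
              (Y := {f // IsConfig (d := d) z (x i) f})))
          have h2 := (continuous_apply j).comp (continuous_subtype_val.comp
            (continuous_snd (X := {f // IsConfig (d := d) x y f})
              (Y := {f // IsConfig (d := d) z (x i) f})))
          exact (h1.fst.add (h1.snd.smul h2.fst)).prodMk (h1.snd.mul h2.snd) }
  one c := ⟨fun _ => (0, 1),
    { nonempty := ⟨()⟩
      closed_of_closed := fun h _ => h
      radius_pos := fun _ => one_pos
      centre_mem := fun _ _ _ _ => rfl
      subset := fun _ => subset_rfl
      disjoint := fun a b hab => (hab rfl).elim }⟩
  act_refl x y := rfl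
  act_trans e f _ _ _ h h' y := rfl
  act_comp σ τ x y i z p q := by
    refine Subtype.ext (funext fun a => ?_)
    rcases a with a | b <;> rfl
  comp_assoc x y i z j w p q r := by
    refine Subtype.ext (funext fun a => ?_)
    rcases a with ⟨a | b, h⟩ | c
    · rfl
    · rfl
    · change insertRegion (insertRegion (p.1 i) (q.1 j)) (r.1 c) =
        insertRegion (p.1 i) (insertRegion (q.1 j) (r.1 c))
      simp [insertRegion, smul_smul, mul_assoc, add_assoc]
  comp_swap x y i i' h z w p q r := by
    refine Subtype.ext (funext fun a => ?_)
    rcases a with ⟨a | b, h⟩ | c <;> rfl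
  one_comp c z q := by
    refine Subtype.ext (funext fun a => ?_)
    rcases a with a | b
    · exact (a.2 rfl).elim
    · change insertRegion (0, 1) (q.1 b) = q.1 b
      simp [insertRegion]
  comp_one x y i p := by
    refine Subtype.ext (funext fun a => ?_)
    rcases a with a | b
    · rfl
    · change insertRegion (p.1 i) (0, 1) = p.1 i
      simp [insertRegion]

end Cheese

end SwissCheese
end

/-!
Both statements hold because a formality would make some chains bound, in spaces of configurations
of two balls, that are detected by explicit singular cochains or by the homology of spheres.

*The operad.* Two half-balls centred at opposite points `v / 2` and `-v / 2` of the hyperplane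
`x_d = 0` form a sphere of dimension `d - 2`, hence a cycle `a` of operations with two open inputs
(`openSphere`). Let `b` be the operation formed by one ball in the half-ball (`whistle`). After the
insertion of a ball in one of the half-balls, this ball can pass over the other half-ball: the
sphere becomes the boundary of a hemisphere (`cap`, `cap'`), so `a ∘₀ b` and `a ∘₁ b` are boundaries, of `h₁` and
`h₂` say, and there is a Massey product `h₁ ∘ b - h₂ ∘ b` of degree `d - 1` in the operations with
two closed inputs. In a formal operad these products vanish for suitable choices
(`DGOperad.exists_massey_eq_bdy`): the bounding chains can be taken in the kernel of the morphism to
the homology operad. Here it does not vanish, whatever the choices. Indeed the difference of the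
centres of the two balls sends every composite `h ∘ b` with `h` as `h₁` to the set of the vectors
above the hyperplane or off the vertical axis (`IsConfig.diff_mem_posOrNonzero`), since a ball
disjoint from a half-ball cannot be vertically below a ball contained in it. The composites with `h` as `h₂` are sent to the opposite set. By Mayer–Vietoris
(`mayerVietoris`), if the difference bounded among the nonzero vectors, then the common boundary of
the two parts, a sphere of dimension `d - 2` around the vertical axis, would bound away from this
axis, in contradiction with `sphereChain_ne_bdy`. The latter is proved by the same device, by
induction on the dimension. Mayer–Vietoris is proved by barycentric subdivision
(`eventually_subdiv_mem`).

*The involution.* In characteristic `2`, let `τ` be the exchange of two balls in the space `X` of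
pairs of balls, and let `C ← M → H` be a formality of the chains `C` of `X` with their involution.
A point of `X`, lifted to a cycle `y₀` of `M`, is homologous to its image under `τ`, since two balls
can be exchanged along a path. If `(1 + τ) yₙ` is a boundary in `M`, it is the boundary of some
`yₙ₊₁` in the kernel of `M → H`, and then `(1 + τ) yₙ₊₁` is a cycle in this kernel, hence a
boundary: this gives a sequence of chains `yₙ` of all degrees with `∂ yₙ₊₁ = (1 + τ) yₙ`
(`exists_tower`). Let `sⱼ` be the indicator function of the half of `X` where the coordinate
number `j` of the difference of the centres is positive. As `sⱼ ∘ τ = sⱼ + 1`, the cup product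
`δsₙ ∪ ⋯ ∪ δs₀` takes the same value on `yₙ₊₁` as `δsₙ₋₁ ∪ ⋯ ∪ δs₀` on `yₙ`, namely `1`. But the
product of `d` factors vanishes on small simplices, since the coordinates have no common zero, and
`y_d` can be subdivided (`false_of_formal_of_odd`).
-/

noncomputable section
namespace SwissCheese

/-! ### Words: barycentric subdivision and cochains -/

section WordSubdivision
variable {k : Type u} [Field k] {α β : Type}

/-- The span of the words satisfying `p`. -/
def wspan (k : Type u) [Field k] {α : Type} (p : List α → Prop) : Submodule k (Words k α) :=
  Submodule.span k {x | ∃ w : List α, p w ∧ x = Finsupp.single w 1}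

theorem single_mem_wspan {p : List α → Prop} {w : List α} (h : p w) :
    Finsupp.single w (1 : k) ∈ wspan k p := Submodule.subset_span ⟨w, h, rfl⟩

theorem map_mem_of_mem_wspan {M : Type*} [AddCommGroup M] [Module k M] {p : List α → Prop}
    (f : Words k α →ₗ[k] M) (S : Submodule k M) (h : ∀ w, p w → f (Finsupp.single w 1) ∈ S)
    {x : Words k α} (hx : x ∈ wspan k p) : f x ∈ S := by
  have : wspan k p ≤ S.comap f := by
    rw [wspan, Submodule.span_le]
    rintro _ ⟨w, hw, rfl⟩
    exact h w hw
  exact this hx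

theorem map_eq_of_mem_wspan {M : Type*} [AddCommGroup M] [Module k M] {p : List α → Prop}
    (f g : Words k α →ₗ[k] M) (h : ∀ w, p w → f (Finsupp.single w 1) = g (Finsupp.single w 1))
    {x : Words k α} (hx : x ∈ wspan k p) : f x = g x := by
  refine LinearMap.eqOn_span (s := {x | ∃ w : List α, p w ∧ x = Finsupp.single w 1}) ?_ hx
  rintro _ ⟨w, hw, rfl⟩
  exact h w hw

theorem wcons_mem_wspan {p q : List α → Prop} (a : α) (h : ∀ w, p w → q (a :: w))
    {x : Words k α} (hx : x ∈ wspan k p) : wcons a x ∈ wspan k q := by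
  refine map_mem_of_mem_wspan (wcons a) _ (fun w hw => ?_) hx
  rw [wcons_single]
  exact single_mem_wspan (h w hw)

theorem wspan_mono {p q : List α → Prop} (h : ∀ w, p w → q w) : wspan k p ≤ wspan k q :=
  fun _ hx => map_mem_of_mem_wspan LinearMap.id _ (fun w hw => single_mem_wspan (h w hw)) hx

@[simp] theorem bdry_single (w : List α) : bdry (Finsupp.single w (1 : k)) = bdryWord w := by
  simp [bdry]

theorem bdry_bdry (x : Words k α) : bdry (bdry x) = 0 := by
  refine words_ext (f := bdry ∘ₗ bdry) (g := 0) (fun w => ?_) x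
  simp only [LinearMap.comp_apply, LinearMap.zero_apply]
  induction w with
  | nil => simp [bdryWord]
  | cons a u ih => rw [← wcons_single, bdry_wcons, map_sub, bdry_wcons, ih]; simp

theorem bdryWord_mem_wspan (w : List α) :
    bdryWord (k := k) w ∈ wspan k fun u => u.Sublist w ∧ u.length + 1 = w.length := by
  induction w with
  | nil => simp [bdryWord]
  | cons a w ih =>
    rw [bdryWord]
    refine Submodule.sub_mem _ (single_mem_wspan ⟨List.sublist_cons_self a w, rfl⟩)
      (wcons_mem_wspan a (fun u hu => ⟨hu.1.cons_cons a, ?_⟩) ih)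
    simp only [List.length_cons]
    omega

theorem wmap_bdry (f : α → β) (x : Words k α) : wmap f (bdry x) = bdry (wmap f x) := by
  refine words_ext (f := wmap f ∘ₗ bdry) (g := bdry ∘ₗ wmap f) (fun w => ?_) x
  simp only [LinearMap.comp_apply]
  induction w with
  | nil => simp [bdryWord]
  | cons a u ih => rw [← wcons_single, bdry_wcons, map_sub, wmap_wcons, ih, wmap_wcons, bdry_wcons]

/-- Subdivision of the words with `j` letters. A word `a :: u` is sent to the cone with apex
`b a u` over the subdivision of its boundary; the subdivision is the barycentric one if `b a u` is
the barycentre of the letters of `a :: u`. -/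
def sdWords (b : α → List α → α) : ℕ → Words k α →ₗ[k] Words k α
  | 0 => LinearMap.id
  | j + 1 => Finsupp.linearCombination k fun w => match w with
    | [] => 0
    | a :: u => wcons (b a u) (sdWords b j (bdryWord (a :: u)))

theorem sdWords_cons (b : α → List α → α) (j : ℕ) (a : α) (u : List α) :
    sdWords b (j + 1) (Finsupp.single (a :: u) (1 : k)) =
      wcons (b a u) (sdWords b j (bdryWord (a :: u))) := by
  simp [sdWords]

theorem bdry_sdWords (b : α → List α → α) (j : ℕ) {x : Words k α}
    (hx : x ∈ wspan k fun w => w.length = j + 1) :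
    bdry (sdWords b (j + 1) x) = sdWords b j (bdry x) := by
  induction j generalizing x with
  | zero =>
    refine map_eq_of_mem_wspan (bdry ∘ₗ sdWords b 1) (sdWords b 0 ∘ₗ bdry) (fun w hw => ?_) hx
    obtain ⟨a, rfl⟩ := List.length_eq_one_iff.1 hw
    simp only [LinearMap.comp_apply]
    rw [sdWords_cons, bdry_wcons]
    simp [sdWords, bdryWord]
  | succ j ih =>
    refine map_eq_of_mem_wspan (bdry ∘ₗ sdWords b (j + 2)) (sdWords b (j + 1) ∘ₗ bdry)
      (fun w hw => ?_) hx
    obtain ⟨a, u, rfl⟩ := List.exists_cons_of_length_eq_add_one hw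
    simp only [LinearMap.comp_apply]
    have h1 := bdryWord_mem_wspan (k := k) (a :: u)
    rw [sdWords_cons, bdry_wcons, ih (wspan_mono (fun v hv => ?_) h1), bdry_single,
      ← bdry_single (a :: u), bdry_bdry]
    · simp
    · have := hv.2
      omega

theorem wmap_sdWords (f : α → β) {b : α → List α → α} {b' : β → List β → β}
    (h : ∀ a u, f (b a u) = b' (f a) (u.map f)) (j : ℕ) (x : Words k α) :
    wmap f (sdWords b j x) = sdWords b' j (wmap f x) := by
  induction j generalizing x with
  | zero => rfl
  | succ j ih =>
    refine words_ext (f := wmap f ∘ₗ sdWords b (j + 1)) (g := sdWords b' (j + 1) ∘ₗ wmap f)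
      (fun w => ?_) x
    simp only [LinearMap.comp_apply]
    cases w with
    | nil => simp [sdWords]
    | cons a u =>
      rw [sdWords_cons, wmap_wcons, ih, wmap_single, List.map_cons, sdWords_cons, h,
        ← bdry_single, wmap_bdry, wmap_single, bdry_single, List.map_cons]

/-- For functions `s₀, s₁, …` on the alphabet, the cup product `δsₙ₋₁ ∪ ⋯ ∪ δs₀`, as a function
on words with `n + 1` letters. -/
def cupWord (s : ℕ → α → k) : ℕ → List α → k
  | n + 1, a :: b :: u => (s n b - s n a) * cupWord s n (b :: u)
  | 0, _ :: _ => 1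
  | _, _ => 0

/-- Linear extension of `cupWord`. -/
def cup (s : ℕ → α → k) (n : ℕ) : Words k α →ₗ[k] k := Finsupp.linearCombination k (cupWord s n)

/-- The cup product `sₙ ∪ δsₙ₋₁ ∪ ⋯ ∪ δs₀`, as a linear map on words. -/
def headCup (s : ℕ → α → k) (n : ℕ) : Words k α →ₗ[k] k :=
  Finsupp.linearCombination k fun w => match w with
    | [] => 0
    | a :: u => s n a * cupWord s n (a :: u)

theorem cup_succ_wcons (s : ℕ → α → k) (n : ℕ) (a : α) {x : Words k α}
    (hx : x ∈ wspan k fun w => w ≠ []) :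
    cup s (n + 1) (wcons a x) = headCup s n x - s n a * cup s n x := by
  refine map_eq_of_mem_wspan (cup s (n + 1) ∘ₗ wcons a) (headCup s n - s n a • cup s n)
    (fun w hw => ?_) hx
  cases w with
  | nil => exact absurd rfl hw
  | cons b u => simp [cup, headCup, cupWord, sub_mul]

theorem headCup_wcons (s : ℕ → α → k) (n : ℕ) (a : α) (x : Words k α) :
    headCup s n (wcons a x) = s n a * cup s n (wcons a x) := by
  refine words_ext (f := headCup s n ∘ₗ wcons a) (g := s n a • cup s n ∘ₗ wcons a)
    (fun w => ?_) x
  simp [cup, headCup]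

theorem bdryWord_mem_ne_nil {w : List α} (h : 2 ≤ w.length) :
    bdryWord (k := k) w ∈ wspan k fun u => u ≠ [] := by
  refine wspan_mono (fun u hu => ?_) (bdryWord_mem_wspan w)
  have := hu.2
  exact List.ne_nil_of_length_pos (by omega)

/-- Cup products of coboundaries are cocycles. -/
theorem cup_bdry (s : ℕ → α → k) (n : ℕ) (w : List α) (hw : w.length = n + 2) :
    cup s n (bdryWord w) = 0 ∧ headCup s n (bdryWord w) = cup s (n + 1) (Finsupp.single w 1) := by
  induction n generalizing w with
  | zero =>
    obtain ⟨a, b, rfl⟩ := List.length_eq_two.1 hw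
    constructor <;> simp [bdryWord, cup, headCup, cupWord]
  | succ n ih =>
    obtain ⟨a, v, rfl⟩ := List.exists_cons_of_length_eq_add_one hw
    have hv : v.length = n + 2 := by simpa using hw
    have hne : Finsupp.single v (1 : k) ∈ wspan k fun w => w ≠ [] :=
      single_mem_wspan (List.ne_nil_of_length_pos (by omega))
    have h1 : cup s (n + 1) (bdryWord (a :: v)) = 0 := by
      rw [bdryWord, map_sub, cup_succ_wcons _ _ _ (bdryWord_mem_ne_nil (by omega)), (ih v hv).1,
        (ih v hv).2]
      simp
    refine ⟨h1, ?_⟩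
    rw [bdryWord, map_sub, sub_eq_zero] at h1
    rw [bdryWord, map_sub, headCup_wcons, ← h1, ← wcons_single, cup_succ_wcons _ _ _ hne]

end WordSubdivision

/-! ### Affine maps between simplices -/

section Affine
variable {ι β γ : Type} [Fintype ι] [Fintype β] [Fintype γ]

/-- The affine map of simplices with prescribed images of the vertices. -/
def affMap (p : ι → stdSimplex ℝ β) : C(stdSimplex ℝ ι, stdSimplex ℝ β) where
  toFun t := ⟨fun x => ∑ i, t i * p i x,
    fun x => Finset.sum_nonneg fun i _ => mul_nonneg (t.2.1 i) ((p i).2.1 x), by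
      rw [Finset.sum_comm]
      simp only [← Finset.mul_sum]
      simp⟩
  continuous_toFun := by
    refine Continuous.subtype_mk (continuous_pi fun x => continuous_finsetSum _ fun i _ => ?_) _
    exact ((continuous_apply i).comp continuous_subtype_val).mul continuous_const

theorem affMap_apply (p : ι → stdSimplex ℝ β) (t : stdSimplex ℝ ι) (x : β) :
    affMap p t x = ∑ i, t i * p i x := rfl

theorem affMap_comp (p : ι → stdSimplex ℝ β) (q : β → stdSimplex ℝ γ) :
    (affMap q).comp (affMap p) = affMap fun i => affMap q (p i) := by
  ext t x
  simp only [ContinuousMap.comp_apply, affMap_apply, Finset.sum_mul, Finset.mul_sum]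
  rw [Finset.sum_comm]
  simp only [mul_assoc]

theorem affMap_simplexMap (p : β → stdSimplex ℝ γ) (f : ι → β) :
    (affMap p).comp (simplexMap f) = affMap (p ∘ f) := by
  classical
  ext t x
  simp only [ContinuousMap.comp_apply, affMap_apply]
  change ∑ i, FunOnFinite.linearMap ℝ ℝ f t i * _ = _
  simp only [FunOnFinite.linearMap_apply_apply, Finset.sum_mul]
  rw [← Finset.sum_fiberwise (s := Finset.univ) (g := f)]
  refine Finset.sum_congr rfl fun b _ => Finset.sum_congr rfl fun i hi => ?_
  rw [Function.comp_apply, (Finset.mem_filter.1 hi).2]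

theorem affMap_vertex [DecidableEq β] : affMap (fun i : β => stdSimplex.vertex i) =
    ContinuousMap.id (stdSimplex ℝ β) := by
  ext t x
  rw [affMap_apply]
  simp [Pi.single_apply]

theorem affMap_apply_vertex [DecidableEq ι] (p : ι → stdSimplex ℝ β) (i : ι) :
    affMap p (stdSimplex.vertex i) = p i := by
  ext x
  rw [affMap_apply]
  simp [Pi.single_apply]

/-- The barycentre of the points `a :: u` of a simplex. -/
def baryc (a : stdSimplex ℝ β) (u : List (stdSimplex ℝ β)) : stdSimplex ℝ β :=
  ⟨fun x => ((u.length : ℝ) + 1)⁻¹ * ((a :: u).map fun p => p x).sum, fun x => by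
      refine mul_nonneg (by positivity) (List.sum_nonneg ?_)
      rintro _ hy
      obtain ⟨p, -, rfl⟩ := List.mem_map.1 hy
      exact p.2.1 x, by
    have key : ∀ l : List (stdSimplex ℝ β), ∑ x, (l.map fun p => p x).sum = l.length := by
      intro l
      induction l with
      | nil => simp
      | cons p l ih => simp [Finset.sum_add_distrib, ih, add_comm]
    rw [← Finset.mul_sum, key, List.length_cons]
    push_cast
    exact inv_mul_cancel₀ (by positivity)⟩

theorem affMap_baryc (p : ι → stdSimplex ℝ β) (a : stdSimplex ℝ ι) (u : List (stdSimplex ℝ ι)) :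
    affMap p (baryc a u) = baryc (affMap p a) (u.map (affMap p)) := by
  ext x
  have key : ∀ l : List (stdSimplex ℝ ι), ∑ i, (l.map fun q => q i).sum * p i x =
      (l.map fun q => affMap p q x).sum := by
    intro l
    induction l with
    | nil => simp
    | cons q l ih => simp only [List.map_cons, List.sum_cons, add_mul, Finset.sum_add_distrib, ih,
        affMap_apply]
  have h2 := key (a :: u)
  rw [affMap_apply]
  change ∑ i, ((u.length : ℝ) + 1)⁻¹ * ((a :: u).map fun q => q i).sum * p i x =
    (((u.map (affMap p)).length : ℝ) + 1)⁻¹ * ((affMap p a :: u.map (affMap p)).map fun q => q x).sum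
  simp only [mul_assoc, ← Finset.mul_sum]
  rw [h2, List.length_map, ← List.map_cons, List.map_map]
  rfl

end Affine

/-! ### Supports of singular chains -/

section Support
variable {k : Type u} [Field k] {X Y Z : TopCat.{0}}

/-- The map of singular chains of degree `n` induced by a continuous map. -/
abbrev push (f : X ⟶ Y) (n : ℤ) : (chains k X).X n →ₗ[k] (chains k Y).X n :=
  (((chainsFunctor k).map f).f n).hom

variable (k X) in
/-- The boundary of singular chains, from degree `n` to degree `n'`. -/
abbrev bdy (n n' : ℤ) : (chains k X).X n →ₗ[k] (chains k X).X n' := ((chains k X).d n n').hom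

theorem bdy_push (f : X ⟶ Y) (n n' : ℤ) (x : (chains k X).X n) :
    bdy k Y n n' (push f n x) = push f n' (bdy k X n n' x) :=
  congr(($(((chainsFunctor k).map f).comm n n')).hom x)

theorem bdy_bdy (n n' n'' : ℤ) (x : (chains k X).X n) :
    bdy k X n' n'' (bdy k X n n' x) = 0 :=
  congr(($((chains k X).d_comp_d n n' n'')).hom x)

theorem push_push (f : X ⟶ Y) (g : Y ⟶ Z) (n : ℤ) (x : (chains k X).X n) :
    push g n (push f n x) = push (f ≫ g) n x := by
  have := congr(($((chainsFunctor k).map_comp f g)).f n)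
  exact congr(($this).hom x).symm

theorem bdy_of_ne {n n' : ℤ} (h : n' + 1 ≠ n) : bdy k X n n' = 0 := by
  rw [bdy, HomologicalComplex.shape]
  · rfl
  · exact h

variable (k) in
/-- The span of the singular simplices with image in `V`. -/
def supp (n : ℤ) (V : Set X) : Submodule k ((chains k X).X n) :=
  Submodule.span k {x | ∃ (m : ℕ) (h : (m : ℤ) = n) (σ : Simp m X), (∀ t, σ t ∈ V) ∧ x = gen m h σ}

theorem gen_mem_supp {n : ℤ} {V : Set X} (m : ℕ) (h : (m : ℤ) = n) {σ : Simp m X}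
    (hσ : ∀ t, σ t ∈ V) : gen (k := k) m h σ ∈ supp k n V :=
  Submodule.subset_span ⟨m, h, σ, hσ, rfl⟩

theorem map_mem_of_mem_supp {M : Type*} [AddCommGroup M] [Module k M] {n : ℤ} {V : Set X}
    (f : (chains k X).X n →ₗ[k] M) (S : Submodule k M)
    (h : ∀ m hm (σ : Simp m X), (∀ t, σ t ∈ V) → f (gen m hm σ) ∈ S) {x : (chains k X).X n}
    (hx : x ∈ supp k n V) : f x ∈ S := by
  have : supp k n V ≤ S.comap f := by
    rw [supp, Submodule.span_le]
    rintro _ ⟨m, hm, σ, hσ, rfl⟩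
    exact h m hm σ hσ
  exact this hx

theorem map_eq_of_mem_supp {M : Type*} [AddCommGroup M] [Module k M] {n : ℤ} {V : Set X}
    (f g : (chains k X).X n →ₗ[k] M)
    (h : ∀ m hm (σ : Simp m X), (∀ t, σ t ∈ V) → f (gen m hm σ) = g (gen m hm σ))
    {x : (chains k X).X n} (hx : x ∈ supp k n V) : f x = g x := by
  have := map_mem_of_mem_supp (f - g) ⊥ (fun m hm σ hσ => by simp [h m hm σ hσ]) hx
  simpa [sub_eq_zero] using this

theorem supp_mono {n : ℤ} {V W : Set X} (h : V ⊆ W) : supp k n V ≤ supp k n W := fun _ hx =>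
  map_mem_of_mem_supp LinearMap.id _ (fun m hm _ hσ => gen_mem_supp m hm fun t => h (hσ t)) hx

theorem mem_supp_univ {n : ℤ} (x : (chains k X).X n) : x ∈ supp k n (Set.univ : Set X) := by
  have : (supp k n (Set.univ : Set X)).mkQ = 0 := chains_ext fun m hm σ => by
    simpa using gen_mem_supp m hm fun t => Set.mem_univ (σ t)
  simpa using LinearMap.congr_fun this x

theorem eq_zero_of_mem_supp_empty {n : ℤ} {x : (chains k X).X n}
    (hx : x ∈ supp k n (∅ : Set X)) : x = 0 :=
  map_eq_of_mem_supp LinearMap.id 0 (fun _ _ _ hσ => (hσ (stdSimplex.vertex 0)).elim) hx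

theorem bdy_mem_supp {n : ℤ} (n' : ℤ) {V : Set X} {x : (chains k X).X n} (hx : x ∈ supp k n V) :
    bdy k X n n' x ∈ supp k n' V := by
  by_cases hn : n' + 1 = n
  · refine map_mem_of_mem_supp _ _ (fun m hm σ hσ => ?_) hx
    cases m with
    | zero => rw [bdy, chains_d_gen_zero]; exact Submodule.zero_mem _
    | succ m =>
      rw [bdy, chains_d_gen m hm (by push_cast at hm; omega)]
      exact Submodule.sum_mem _ fun i _ => Submodule.smul_mem _ _ (gen_mem_supp _ _ fun t => hσ _)
  · rw [bdy_of_ne hn]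
    exact Submodule.zero_mem _

theorem push_mem_supp (f : X ⟶ Y) {n : ℤ} {V : Set X} {W : Set Y} (h : ∀ v ∈ V, f v ∈ W)
    {x : (chains k X).X n} (hx : x ∈ supp k n V) : push f n x ∈ supp k n W := by
  refine map_mem_of_mem_supp _ _ (fun m hm σ hσ => ?_) hx
  rw [push, chains_map_gen]
  exact gen_mem_supp m hm fun t => h _ (hσ t)

/-- The inclusion of a subspace. -/
abbrev subIncl (V : Set X) : TopCat.of V ⟶ X := TopCat.ofHom ⟨Subtype.val, continuous_subtype_val⟩

open Classical in
/-- The projection of singular chains of `X` to singular chains of a subspace `V`, killing the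
simplices that are not contained in `V`. It is compatible with the boundary only on chains
supported in `V`. -/
def restr (n : ℤ) (V : Set X) : (chains k X).X n →ₗ[k] (chains k (TopCat.of V)).X n :=
  chainsLift fun m h σ => if hσ : ∀ t, σ t ∈ V then
    gen (X := TopCat.of V) m h ⟨fun t => ⟨σ t, hσ t⟩, by fun_prop⟩ else 0

theorem restr_gen {n : ℤ} {V : Set X} (m : ℕ) (h : (m : ℤ) = n) {σ : Simp m X}
    (hσ : ∀ t, σ t ∈ V) : restr (k := k) n V (gen m h σ) =
      gen (X := TopCat.of V) m h ⟨fun t => ⟨σ t, hσ t⟩, by fun_prop⟩ := by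
  rw [restr, chainsLift_gen, dif_pos hσ]

theorem push_restr {n : ℤ} {V : Set X} {x : (chains k X).X n} (hx : x ∈ supp k n V) :
    push (subIncl V) n (restr n V x) = x := by
  refine map_eq_of_mem_supp (push (subIncl V) n ∘ₗ restr n V) LinearMap.id
    (fun m hm σ hσ => ?_) hx
  rw [LinearMap.comp_apply, restr_gen m hm hσ, push, chains_map_gen]
  rfl

theorem bdy_restr {n n' : ℤ} {V : Set X} {x : (chains k X).X n} (hx : x ∈ supp k n V) :
    bdy k (TopCat.of V) n n' (restr n V x) = restr n' V (bdy k X n n' x) := by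
  by_cases hn : n' + 1 = n
  · refine map_eq_of_mem_supp (bdy k (TopCat.of V) n n' ∘ₗ restr n V) (restr n' V ∘ₗ bdy k X n n')
      (fun m hm σ hσ => ?_) hx
    rw [LinearMap.comp_apply, LinearMap.comp_apply, restr_gen m hm hσ]
    cases m with
    | zero => rw [bdy, bdy, chains_d_gen_zero, chains_d_gen_zero, map_zero]
    | succ m =>
      have hm' : (m : ℤ) = n' := by push_cast at hm; omega
      rw [bdy, bdy, chains_d_gen m hm hm', chains_d_gen m hm hm', map_sum]
      refine Finset.sum_congr rfl fun i _ => ?_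
      rw [map_smul, restr_gen m hm' fun t => hσ _]
      rfl
  · rw [bdy_of_ne hn, bdy_of_ne hn]
    simp

theorem mem_supp_inter {n : ℤ} {V W : Set X} {x : (chains k X).X n} (hV : x ∈ supp k n V)
    (hW : x ∈ supp k n W) : x ∈ supp k n (V ∩ W) := by
  rw [← push_restr hV]
  refine map_mem_of_mem_supp (push (subIncl V) n ∘ₗ restr n V) _ (fun m hm σ hσ => ?_) hW
  by_cases h : ∀ t, σ t ∈ V
  · rw [LinearMap.comp_apply, restr_gen m hm h, push, chains_map_gen]
    exact gen_mem_supp m hm fun t => ⟨h t, hσ t⟩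
  · rw [LinearMap.comp_apply, restr, chainsLift_gen, dif_neg h, map_zero]
    exact Submodule.zero_mem _

theorem push_restr_of_subset {n : ℤ} {V W : Set X} (h : V ⊆ W) {x : (chains k X).X n}
    (hx : x ∈ supp k n V) :
    push (TopCat.ofHom ⟨Set.inclusion h, continuous_inclusion h⟩ : TopCat.of V ⟶ TopCat.of W) n
      (restr n V x) = restr n W x := by
  refine map_eq_of_mem_supp (push (TopCat.ofHom ⟨Set.inclusion h, continuous_inclusion h⟩ :
    TopCat.of V ⟶ TopCat.of W) n ∘ₗ restr n V) (restr n W) (fun m hm σ hσ => ?_) hx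
  rw [LinearMap.comp_apply, restr_gen m hm hσ, push, chains_map_gen,
    restr_gen m hm fun t => h (hσ t)]
  rfl

theorem realize_mem_supp {α : Type} [Fintype α] {n : ℤ} {V : Set X} {σ : C(stdSimplex ℝ α, X)}
    {p : List α → Prop}
    (h : ∀ (m : ℕ) (f : Fin (m + 1) → α), p (List.ofFn f) → ∀ t, σ (simplexMap f t) ∈ V)
    {x : Words k α} (hx : x ∈ wspan k p) : realize n σ x ∈ supp k n V := by
  refine map_mem_of_mem_wspan (realize n σ) _ (fun w hw => ?_) hx
  rw [realize_single]
  by_cases hw0 : w = []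
  · rw [hw0, realizeWord_nil]
    exact Submodule.zero_mem _
  obtain ⟨m, f, rfl⟩ := exists_ofFn w hw0
  by_cases hm : (m : ℤ) = n
  · rw [realizeWord_ofFn σ m hm]
    exact gen_mem_supp m hm fun t => h m f hw t
  · rw [realizeWord_eq_zero]
    · exact Submodule.zero_mem _
    · simpa using hm

theorem mem_wspan_true {α : Type} (x : Words k α) : x ∈ wspan k fun _ => True := by
  have : (wspan k fun _ : List α => True).mkQ x = (0 : Words k α →ₗ[k] _) x :=
    words_ext (fun u => by simpa using single_mem_wspan (k := k) (w := u) trivial) x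
  simpa using this

theorem cross_mem_supp (μ : C(X × Y, Z)) {V : Set Z} (hV : ∀ z, μ z ∈ V) {p q n : ℤ}
    (h : p + q = n) (a : (chains k X).X p) (b : (chains k Y).X q) :
    cross μ h a b ∈ supp k n V := by
  have := chains_ext₂ (k := k) (f := (cross μ h).compr₂ (supp k n V).mkQ) (g := 0)
    (fun m hm σ m' hm' τ => by
      rw [LinearMap.compr₂_apply, cross_gen]
      simpa using realize_mem_supp (p := fun _ => True) (fun _ _ _ _ => hV _) (mem_wspan_true _))
    a b
  simpa using this

end Support

/-! ### Barycentric subdivision of singular chains -/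

theorem map_get_finRange {γ : Type} (w : List γ) : (List.finRange w.length).map w.get = w := by
  simp

section Subdivision
variable {k : Type u} [Field k] {X Y : TopCat.{0}} {ι β : Type} [Fintype ι] [Fintype β]

/-- The singular simplex obtained by composing `σ` with the affine map sending the successive
vertices of the standard simplex to the points of `w`. As in `realizeWord`, it is zero if `w` does
not have `n + 1` letters. -/
def affWord (n : ℤ) (σ : C(stdSimplex ℝ β, X)) (w : List (stdSimplex ℝ β)) : (chains k X).X n :=
  realizeWord n (σ.comp (affMap w.get)) (List.finRange w.length)

/-- Linear extension of `affWord`. -/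
def aff (n : ℤ) (σ : C(stdSimplex ℝ β, X)) : Words k (stdSimplex ℝ β) →ₗ[k] (chains k X).X n :=
  Finsupp.linearCombination k (affWord n σ)

@[simp] theorem aff_single (n : ℤ) (σ : C(stdSimplex ℝ β, X)) (w : List (stdSimplex ℝ β)) :
    aff (k := k) n σ (Finsupp.single w 1) = affWord n σ w := by
  simp [aff]

theorem affWord_eq (n : ℤ) (σ : C(stdSimplex ℝ β, X)) (w : List (stdSimplex ℝ β)) (l : ℕ)
    (g : Fin l → stdSimplex ℝ β) (h : w = List.ofFn g) :
    affWord (k := k) n σ w = realizeWord n (σ.comp (affMap g)) (List.finRange l) := by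
  have key : ∀ (w : List (stdSimplex ℝ β)) (hl : l = w.length),
      (∀ i, w.get (i.cast hl) = g i) →
      affWord (k := k) n σ w = realizeWord n (σ.comp (affMap g)) (List.finRange l) := by
    intro w hl hg
    subst hl
    obtain rfl : w.get = g := funext hg
    rfl
  subst h
  exact key _ (by simp) (by simp)

theorem realize_affMap (n : ℤ) (σ : C(stdSimplex ℝ β, X)) (f : ι → stdSimplex ℝ β)
    (x : Words k ι) : realize n (σ.comp (affMap f)) x = aff n σ (wmap f x) := by
  refine words_ext (f := realize n (σ.comp (affMap f))) (g := aff n σ ∘ₗ wmap f) (fun u => ?_) x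
  have hu : u = (List.finRange u.length).map u.get := by simp
  rw [LinearMap.comp_apply, wmap_single, aff_single, affWord_eq n σ (u.map f) u.length (f ∘ u.get)]
  · conv_lhs => rw [hu, ← wmap_single, realize_wmap, ContinuousMap.comp_assoc, affMap_simplexMap]
    rw [realize_single]
  · rw [← List.map_ofFn, List.ofFn_get]

theorem aff_eq_realize (n : ℤ) (σ : C(stdSimplex ℝ β, X)) (w : List (stdSimplex ℝ β)) :
    aff (k := k) n σ (Finsupp.single w 1) = realize n (σ.comp (affMap w.get))
      (Finsupp.single (List.finRange w.length) 1) := by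
  rw [aff_single, realize_single, affWord]

theorem bdy_aff {n n' : ℤ} (hn : n' + 1 = n) (σ : C(stdSimplex ℝ β, X))
    (x : Words k (stdSimplex ℝ β)) : bdy k X n n' (aff n σ x) = aff n' σ (bdry x) := by
  refine words_ext (f := bdy k X n n' ∘ₗ aff n σ) (g := aff n' σ ∘ₗ bdry) (fun w => ?_) x
  rw [LinearMap.comp_apply, LinearMap.comp_apply, aff_eq_realize, bdy, d_realize hn,
    realize_affMap, wmap_bdry]
  congr 2
  rw [wmap_single, map_get_finRange]

theorem push_aff (f : X ⟶ Y) (n : ℤ) (σ : C(stdSimplex ℝ β, X)) (x : Words k (stdSimplex ℝ β)) :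
    push f n (aff n σ x) = aff n (f.hom.comp σ) x := by
  refine words_ext (f := push f n ∘ₗ aff n σ) (g := aff n (f.hom.comp σ)) (fun w => ?_) x
  rw [LinearMap.comp_apply, aff_eq_realize, push, map_realize, aff_eq_realize]
  rfl

theorem aff_affMap (n : ℤ) (σ : C(stdSimplex ℝ β, X)) (p : ι → stdSimplex ℝ β)
    (x : Words k (stdSimplex ℝ ι)) :
    aff n (σ.comp (affMap p)) x = aff n σ (wmap (affMap p) x) := by
  refine words_ext (f := aff n (σ.comp (affMap p))) (g := aff n σ ∘ₗ wmap (affMap p))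
    (fun w => ?_) x
  rw [LinearMap.comp_apply, aff_eq_realize, ContinuousMap.comp_assoc, affMap_comp, realize_affMap]
  congr 1
  rw [wmap_single, wmap_single]
  congr 1
  conv_rhs => rw [← map_get_finRange w, List.map_map]
  rfl

/-- The vertices of the standard simplex. -/
def vertices (m : ℕ) : List (stdSimplex ℝ (Fin (m + 1))) :=
  (List.finRange (m + 1)).map fun i => stdSimplex.vertex i

theorem map_vertices {m : ℕ} (p : Fin (m + 1) → stdSimplex ℝ β) :
    (vertices m).map (affMap p) = List.ofFn p := by
  rw [vertices, List.map_map, List.ofFn_eq_map]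
  exact List.map_congr_left fun i _ => affMap_apply_vertex p i

theorem gen_eq_aff {n : ℤ} (m : ℕ) (h : (m : ℤ) = n) (σ : Simp m X) :
    gen (k := k) m h σ = aff n σ (Finsupp.single (vertices m) 1) := by
  have := realize_affMap n σ (fun i => stdSimplex.vertex i)
    (Finsupp.single (List.finRange (m + 1)) (1 : k))
  rw [affMap_vertex, ContinuousMap.comp_id, ← gen_eq_realize m h, wmap_single] at this
  exact this

theorem aff_ofFn {n : ℤ} (m : ℕ) (h : (m : ℤ) = n) (σ : C(stdSimplex ℝ β, X))
    (p : Fin (m + 1) → stdSimplex ℝ β) :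
    aff (k := k) n σ (Finsupp.single (List.ofFn p) 1) = gen m h (σ.comp (affMap p)) := by
  rw [gen_eq_aff, aff_affMap, wmap_single, map_vertices]

variable (k X) in
/-- Barycentric subdivision of singular chains. -/
def subdiv (n : ℤ) : (chains k X).X n →ₗ[k] (chains k X).X n :=
  chainsLift fun m _ σ => aff n σ (sdWords baryc (m + 1) (Finsupp.single (vertices m) 1))

theorem subdiv_aff {n : ℤ} {m : ℕ} (h : (m : ℤ) = n) (σ : C(stdSimplex ℝ β, X))
    {x : Words k (stdSimplex ℝ β)} (hx : x ∈ wspan k fun w => w.length = m + 1) :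
    subdiv k X n (aff n σ x) = aff n σ (sdWords baryc (m + 1) x) := by
  refine map_eq_of_mem_wspan (subdiv k X n ∘ₗ aff n σ) (aff n σ ∘ₗ sdWords baryc (m + 1))
    (fun w hw => ?_) hx
  obtain ⟨p, rfl⟩ : ∃ p : Fin (m + 1) → stdSimplex ℝ β, w = List.ofFn p :=
    ⟨fun i => w.get (i.cast hw.symm), by rw [← List.ofFn_congr hw, List.ofFn_get]⟩
  rw [LinearMap.comp_apply, LinearMap.comp_apply, aff_ofFn m h, subdiv, chainsLift_gen,
    aff_affMap, wmap_sdWords _ (affMap_baryc p), wmap_single, map_vertices]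

theorem push_subdiv (f : X ⟶ Y) (n : ℤ) (x : (chains k X).X n) :
    push f n (subdiv k X n x) = subdiv k Y n (push f n x) := by
  refine LinearMap.congr_fun (chains_ext (k := k) (f := push f n ∘ₗ subdiv k X n)
    (g := subdiv k Y n ∘ₗ push f n) fun m hm σ => ?_) x
  rw [LinearMap.comp_apply, LinearMap.comp_apply, push, chains_map_gen, subdiv, chainsLift_gen,
    subdiv, chainsLift_gen]
  exact push_aff f n σ _

theorem length_vertices (m : ℕ) : (vertices m).length = m + 1 := by simp [vertices]

theorem bdy_subdiv (n n' : ℤ) (x : (chains k X).X n) :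
    bdy k X n n' (subdiv k X n x) = subdiv k X n' (bdy k X n n' x) := by
  by_cases hn : n' + 1 = n
  · refine LinearMap.congr_fun (chains_ext (k := k) (f := bdy k X n n' ∘ₗ subdiv k X n)
      (g := subdiv k X n' ∘ₗ bdy k X n n') fun m hm σ => ?_) x
    have hl : Finsupp.single (vertices m) (1 : k) ∈ wspan k fun w => w.length = m + 1 :=
      single_mem_wspan (length_vertices m)
    rw [LinearMap.comp_apply, LinearMap.comp_apply, gen_eq_aff, subdiv_aff hm σ hl,
      bdy_aff hn, bdy_aff hn, bdry_sdWords _ _ hl]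
    cases m with
    | zero =>
      have hb : bdry (Finsupp.single (vertices 0) (1 : k)) = Finsupp.single [] 1 := by
        simp [vertices, bdryWord, List.finRange_succ]
      have h0 : affWord (k := k) n' σ [] = 0 := realizeWord_nil _
      rw [hb, sdWords, LinearMap.id_apply, aff_single, h0, map_zero]
    | succ m =>
      rw [subdiv_aff (m := m) (by push_cast at hm; omega)]
      rw [bdry_single]
      refine wspan_mono (fun u hu => ?_) (bdryWord_mem_wspan _)
      have := hu.2
      rw [length_vertices] at this
      omega
  · rw [bdy_of_ne hn]
    simp

theorem subdiv_zero (x : (chains k X).X 0) : subdiv k X 0 x = x := by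
  refine LinearMap.congr_fun (chains_ext (k := k) (f := subdiv k X 0)
      (g := LinearMap.id) fun m hm σ => ?_) x
  obtain rfl : m = 0 := by exact_mod_cast hm
  rw [subdiv, chainsLift_gen, gen_eq_aff]
  have : vertices 0 = [stdSimplex.vertex 0] := rfl
  rw [this, sdWords_cons, LinearMap.id_apply]
  congr 1
  have h0 : baryc (stdSimplex.vertex (0 : Fin 1)) [] = stdSimplex.vertex 0 :=
    Subsingleton.elim _ _
  rw [h0]
  simp [sdWords, bdryWord]

theorem subdiv_mem_supp {n : ℤ} {V : Set X} {x : (chains k X).X n} (hx : x ∈ supp k n V) :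
    subdiv k X n x ∈ supp k n V := by
  rw [← push_restr hx, ← push_subdiv]
  exact push_mem_supp _ (V := Set.univ) (fun (v : V) _ => v.2) (mem_supp_univ _)

theorem push_subdiv_pow (f : X ⟶ Y) (n : ℤ) (N : ℕ) (x : (chains k X).X n) :
    push f n ((subdiv k X n ^ N) x) = (subdiv k Y n ^ N) (push f n x) := by
  induction N with
  | zero => simp
  | succ N ih => rw [pow_succ', pow_succ', Module.End.mul_apply, Module.End.mul_apply,
      push_subdiv, ih]

theorem bdy_subdiv_pow (n n' : ℤ) (N : ℕ) (x : (chains k X).X n) :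
    bdy k X n n' ((subdiv k X n ^ N) x) = (subdiv k X n' ^ N) (bdy k X n n' x) := by
  induction N with
  | zero => simp
  | succ N ih => rw [pow_succ', pow_succ', Module.End.mul_apply, Module.End.mul_apply,
      bdy_subdiv, ih]

theorem subdiv_pow_zero (N : ℕ) (x : (chains k X).X 0) : (subdiv k X 0 ^ N) x = x := by
  induction N with
  | zero => simp
  | succ N ih => rw [pow_succ', Module.End.mul_apply, ih, subdiv_zero]

theorem subdiv_pow_mem_supp {n : ℤ} {V : Set X} (N : ℕ) {x : (chains k X).X n}
    (hx : x ∈ supp k n V) : (subdiv k X n ^ N) x ∈ supp k n V := by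
  induction N with
  | zero => simpa
  | succ N ih => rw [pow_succ', Module.End.mul_apply]; exact subdiv_mem_supp ih

end Subdivision

/-! ### Small simplices -/

section Small
variable {k : Type u} [Field k] {X : TopCat.{0}} {ι β : Type} [Fintype ι] [Fintype β]

theorem dist_affMap_le {p : ι → stdSimplex ℝ β} {x : stdSimplex ℝ β} {r : ℝ}
    (h : ∀ i, dist (p i) x ≤ r) (t : stdSimplex ℝ ι) : dist (affMap p t) x ≤ r := by
  have hr : 0 ≤ r := by
    obtain ⟨i⟩ : Nonempty ι := by
      by_contra hι
      rw [not_nonempty_iff] at hι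
      simpa using stdSimplex.sum_eq_one t
    exact dist_nonneg.trans (h i)
  rw [Subtype.dist_eq, dist_pi_le_iff hr]
  intro c
  have h1 : (affMap p t).1 c - x.1 c = ∑ i, t i * (p i c - x c) := by
    simp only [mul_sub, Finset.sum_sub_distrib, ← Finset.sum_mul, stdSimplex.sum_eq_one, one_mul]
    rfl
  rw [Real.dist_eq, h1]
  calc |∑ i, t i * (p i c - x c)| ≤ ∑ i, t i * r := by
        refine (Finset.abs_sum_le_sum_abs _ _).trans (Finset.sum_le_sum fun i _ => ?_)
        rw [abs_mul, abs_of_nonneg (stdSimplex.zero_le t i)]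
        exact mul_le_mul_of_nonneg_left ((dist_le_pi_dist (p i).1 x.1 c).trans (h i)) (stdSimplex.zero_le t i)
    _ = r := by rw [← Finset.sum_mul, stdSimplex.sum_eq_one, one_mul]

theorem dist_baryc_le (a : stdSimplex ℝ β) (u : List (stdSimplex ℝ β)) (x : stdSimplex ℝ β) :
    dist (baryc a u) x ≤ ((u.length : ℝ) + 1)⁻¹ * ((a :: u).map fun p => dist p x).sum := by
  have hnn : ∀ l : List (stdSimplex ℝ β), 0 ≤ (l.map fun p => dist p x).sum := fun l => by
    refine List.sum_nonneg ?_
    rintro _ hy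
    obtain ⟨p, -, rfl⟩ := List.mem_map.1 hy
    exact dist_nonneg
  have key : ∀ (l : List (stdSimplex ℝ β)) (c : β),
      |(l.map fun p => p c).sum - l.length * x c| ≤ (l.map fun p => dist p x).sum := by
    intro l c
    induction l with
    | nil => simp
    | cons p l ih =>
      simp only [List.map_cons, List.sum_cons, List.length_cons]
      push_cast
      have h1 : |p c - x c| ≤ dist p x := dist_le_pi_dist p.1 x.1 c
      calc _ = |(p c - x c) + ((l.map fun p => p c).sum - l.length * x c)| := by congr 1; ring
        _ ≤ _ := (abs_add_le _ _).trans (add_le_add h1 ih)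
  rw [Subtype.dist_eq, dist_pi_le_iff (mul_nonneg (by positivity) (hnn _))]
  intro c
  have hpos : 0 < ((u.length : ℝ) + 1)⁻¹ := by positivity
  have e : (baryc a u).1 c - x.1 c = ((u.length : ℝ) + 1)⁻¹ *
      (((a :: u).map fun p => p c).sum - (a :: u).length * x c) := by
    rw [mul_sub, List.length_cons]
    push_cast
    rw [inv_mul_cancel_left₀ (by positivity)]
    rfl
  rw [Real.dist_eq, e, abs_mul, abs_of_pos hpos]
  exact mul_le_mul_of_nonneg_left (key _ c) hpos.le

/-- The barycentre of `j + 1` points at distance at most `D` from each other is at distance at most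
`j / (j + 1) * D` from each of them. -/
theorem dist_baryc_mem_le {a : stdSimplex ℝ β} {u : List (stdSimplex ℝ β)} {D : ℝ}
    (hD : ∀ p ∈ a :: u, ∀ q ∈ a :: u, dist p q ≤ D) {M : ℕ} (hM : u.length ≤ M)
    {x : stdSimplex ℝ β} (hx : x ∈ a :: u) : dist x (baryc a u) ≤ M / (M + 1) * D := by
  classical
  have hD0 : 0 ≤ D := dist_nonneg.trans (hD x hx x hx)
  have h1 := (List.perm_cons_erase hx).map fun p => dist p x
  have h2 : (((a :: u).erase x).map fun p => dist p x).sum ≤ u.length * D := by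
    have h3 : ((a :: u).erase x).length = u.length := by
      rw [List.length_erase_of_mem hx]; simp
    have h4 := List.sum_le_card_nsmul (((a :: u).erase x).map fun p => dist p x) D (by
      rintro _ hy
      obtain ⟨p, hp, rfl⟩ := List.mem_map.1 hy
      exact hD p (List.mem_of_mem_erase hp) x hx)
    simpa [h3] using h4
  rw [dist_comm]
  refine (dist_baryc_le a u x).trans ?_
  rw [h1.sum_eq, List.map_cons, List.sum_cons, dist_self, zero_add]
  have hu : (u.length : ℝ) ≤ M := by exact_mod_cast hM
  calc _ ≤ ((u.length : ℝ) + 1)⁻¹ * (u.length * D) :=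
        mul_le_mul_of_nonneg_left h2 (by positivity)
    _ = u.length / (u.length + 1) * D := by ring
    _ ≤ _ := by
        refine mul_le_mul_of_nonneg_right ?_ hD0
        rw [div_le_div_iff₀ (by positivity) (by positivity)]
        nlinarith

theorem dist_baryc_le_of_le {a : stdSimplex ℝ β} {u : List (stdSimplex ℝ β)} {x : stdSimplex ℝ β}
    {r : ℝ} (h : ∀ p ∈ a :: u, dist p x ≤ r) : dist (baryc a u) x ≤ r := by
  refine (dist_baryc_le a u x).trans ?_
  have h4 := List.sum_le_card_nsmul ((a :: u).map fun p => dist p x) r (by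
    rintro _ hy
    obtain ⟨p, hp, rfl⟩ := List.mem_map.1 hy
    exact h p hp)
  rw [inv_mul_le_iff₀ (by positivity)]
  simpa using h4

/-- The mesh of the barycentric subdivision. The last property of the letters says that they
belong to every closed ball that contains the letters of `w`; it is what the induction over the
faces uses. -/
theorem sdWords_mem_small (M j : ℕ) (hj : j ≤ M + 1) (D : ℝ) (w : List (stdSimplex ℝ β))
    (hw : w.length = j) (hD : ∀ p ∈ w, ∀ q ∈ w, dist p q ≤ D) :
    sdWords baryc j (Finsupp.single w (1 : k)) ∈ wspan k fun v => v.length = j ∧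
      (∀ p ∈ v, ∀ q ∈ v, dist p q ≤ M / (M + 1) * D) ∧
      ∀ x r, (∀ p ∈ w, dist p x ≤ r) → ∀ p ∈ v, dist p x ≤ r := by
  induction j generalizing w with
  | zero =>
    obtain rfl := List.length_eq_zero_iff.1 hw
    exact single_mem_wspan (by simp)
  | succ j ih =>
    obtain ⟨a, u, rfl⟩ := List.exists_cons_of_length_eq_add_one hw
    have hu : u.length = j := by simpa using hw
    have hD0 : 0 ≤ D := dist_nonneg.trans (hD a (by simp) a (by simp))
    rw [sdWords_cons]
    have h1 := map_mem_of_mem_wspan (sdWords baryc j) (wspan k fun v => v.length = j ∧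
        (∀ p ∈ v, ∀ q ∈ v, dist p q ≤ M / (M + 1) * D) ∧
        ∀ x r, (∀ p ∈ a :: u, dist p x ≤ r) → ∀ p ∈ v, dist p x ≤ r)
      (fun v hv => wspan_mono (fun v' hv' => ⟨hv'.1, hv'.2.1, fun x r hx =>
          hv'.2.2 x r fun p hp => hx p (hv.1.subset hp)⟩)
        (ih (by omega) v (by have := hv.2; simp only [List.length_cons] at this; omega)
          fun p hp q hq => hD p (hv.1.subset hp) q (hv.1.subset hq)))
      (bdryWord_mem_wspan (k := k) (a :: u))
    refine wcons_mem_wspan _ (fun v hv => ⟨by simp [hv.1], ?_, ?_⟩) h1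
    · have hb : ∀ q ∈ v, dist q (baryc a u) ≤ M / (M + 1) * D :=
        hv.2.2 _ _ fun p hp => dist_baryc_mem_le hD (by omega) hp
      intro p hp q hq
      rcases List.mem_cons.1 hp with rfl | hp <;> rcases List.mem_cons.1 hq with rfl | hq
      · rw [dist_self]; positivity
      · rw [dist_comm]; exact hb q hq
      · exact hb p hp
      · exact hv.2.1 p hp q hq
    · intro x r hx p hp
      rcases List.mem_cons.1 hp with rfl | hp
      · exact dist_baryc_le_of_le hx
      · exact hv.2.2 x r hx p hp

theorem subdiv_pow_gen {n : ℤ} (m : ℕ) (h : (m : ℤ) = n) (σ : Simp m X) (N : ℕ) :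
    ∃ y ∈ wspan k fun w : List (stdSimplex ℝ (Fin (m + 1))) => w.length = m + 1 ∧
        ∀ p ∈ w, ∀ q ∈ w, dist p q ≤ ((m : ℝ) / (m + 1)) ^ N * Metric.diam (stdSimplex ℝ (Fin (m + 1))),
      (subdiv k X n ^ N) (gen m h σ) = aff n σ y := by
  induction N with
  | zero =>
    refine ⟨Finsupp.single (vertices m) 1, single_mem_wspan ⟨length_vertices m, ?_⟩,
      gen_eq_aff m h σ⟩
    intro p _ q _
    rw [pow_zero, one_mul]
    exact Metric.dist_le_diam_of_mem (bounded_stdSimplex _) p.2 q.2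
  | succ N ih =>
    obtain ⟨y, hy, e⟩ := ih
    refine ⟨sdWords baryc (m + 1) y, ?_, ?_⟩
    · refine map_mem_of_mem_wspan (sdWords baryc (m + 1)) _ (fun w hw => ?_) hy
      refine wspan_mono (fun v hv => ⟨hv.1, ?_⟩) (sdWords_mem_small m (m + 1) le_rfl _ w hw.1 hw.2)
      intro p hp q hq
      rw [pow_succ', mul_assoc]
      exact hv.2.1 p hp q hq
    · rw [pow_succ', Module.End.mul_apply, e]
      exact subdiv_aff h σ (wspan_mono (fun w hw => hw.1) hy)

/-- After sufficiently many subdivisions, a chain in a union of open sets is a sum of chains in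
these open sets. -/
theorem eventually_subdiv_mem {A : Type} {U : A → Set X} (hU : ∀ a, IsOpen (U a)) {V : Set X}
    (hV : V ⊆ ⋃ a, U a) {n : ℤ} {x : (chains k X).X n} (hx : x ∈ supp k n V) :
    ∀ᶠ N in Filter.atTop, (subdiv k X n ^ N) x ∈ ⨆ a, supp k n (U a) := by
  induction hx using Submodule.span_induction with
  | zero => simp
  | add x y _ _ h1 h2 =>
    filter_upwards [h1, h2] with N h1 h2
    rw [map_add]
    exact Submodule.add_mem _ h1 h2
  | smul c x _ h1 =>
    filter_upwards [h1] with N h1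
    rw [map_smul]
    exact Submodule.smul_mem _ _ h1
  | mem x hx =>
    obtain ⟨m, hm, σ, hσ, rfl⟩ := hx
    obtain ⟨δ, hδ, hL⟩ := lebesgue_number_lemma_of_metric (isCompact_univ (X := stdSimplex ℝ (Fin (m + 1))))
      (c := fun a => σ ⁻¹' U a) (fun a => (hU a).preimage σ.continuous) (fun t _ => by
        obtain ⟨a, ha⟩ := Set.mem_iUnion.1 (hV (hσ t))
        exact Set.mem_iUnion.2 ⟨a, ha⟩)
    have hlim : Filter.Tendsto (fun N : ℕ => ((m : ℝ) / (m + 1)) ^ N *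
        Metric.diam (stdSimplex ℝ (Fin (m + 1)))) Filter.atTop (nhds (0 * _)) :=
      (tendsto_pow_atTop_nhds_zero_of_lt_one (by positivity)
        ((div_lt_one (by positivity)).2 (by linarith))).mul_const _
    rw [zero_mul] at hlim
    filter_upwards [hlim.eventually (gt_mem_nhds hδ)] with N hN
    obtain ⟨y, hy, e⟩ := subdiv_pow_gen (k := k) m hm σ N
    rw [e]
    refine map_mem_of_mem_wspan (aff n σ) _ (fun w hw => ?_) hy
    obtain ⟨p, rfl⟩ : ∃ p : Fin (m + 1) → stdSimplex ℝ (Fin (m + 1)), w = List.ofFn p :=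
      ⟨fun i => w.get (i.cast hw.1.symm), by rw [← List.ofFn_congr hw.1, List.ofFn_get]⟩
    obtain ⟨a, ha⟩ := hL (p 0) (Set.mem_univ _)
    rw [aff_ofFn m hm]
    refine Submodule.mem_iSup_of_mem a (gen_mem_supp m hm fun t => ha ?_)
    refine lt_of_le_of_lt (dist_affMap_le (fun i => hw.2 (p i) ?_ (p 0) ?_) t) hN <;>
      exact (List.mem_ofFn' _ _).2 ⟨_, rfl⟩

/-- The connecting map of the Mayer–Vietoris sequence, at the level of chains: the chain `c` shows
that the common boundary of `a` and `b` bounds in `V ∩ W` after subdivision. -/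
theorem mayerVietoris {V W : Set X} (hV : IsOpen V) (hW : IsOpen W) {n n' : ℤ}
    {a b : (chains k X).X n} (ha : a ∈ supp k n V) (hb : b ∈ supp k n W)
    {e : (chains k X).X n'} (he : e ∈ supp k n' (V ∪ W)) (h : a - b = bdy k X n' n e) :
    ∃ (N : ℕ) (c : (chains k X).X n) (e' : (chains k X).X n'), c ∈ supp k n (V ∩ W) ∧
      (subdiv k X n ^ N) a - c = bdy k X n' n e' := by
  have hsm := eventually_subdiv_mem (U := fun a : Bool => cond a V W)
    (fun a => by cases a <;> assumption) (fun x hx => by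
      rcases hx with hx | hx
      · exact Set.mem_iUnion.2 ⟨true, hx⟩
      · exact Set.mem_iUnion.2 ⟨false, hx⟩) he
  obtain ⟨N, hN⟩ := hsm.exists
  rw [iSup_bool_eq] at hN
  obtain ⟨e₁, h1, e₂, h2, he12⟩ := Submodule.mem_sup.1 hN
  refine ⟨N, (subdiv k X n ^ N) a - bdy k X n' n e₁, e₁, mem_supp_inter ?_ ?_, by abel⟩
  · exact Submodule.sub_mem _ (subdiv_pow_mem_supp N ha) (bdy_mem_supp n h1)
  · have : (subdiv k X n ^ N) a - bdy k X n' n e₁ =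
        (subdiv k X n ^ N) b + bdy k X n' n e₂ := by
      have := congrArg (subdiv k X n ^ N) h
      rw [map_sub, ← bdy_subdiv_pow, ← he12, map_add, sub_eq_iff_eq_add] at this
      rw [this]
      abel
    rw [this]
    exact Submodule.add_mem _ (subdiv_pow_mem_supp N hb) (bdy_mem_supp n h2)

end Small

/-! ### Cochains on singular chains -/

section Vertices
variable {k : Type u} [Field k] {X Y : TopCat.{0}}

/-- The word formed by the successive vertices of a singular simplex, extended linearly. -/
def verts (n : ℤ) : (chains k X).X n →ₗ[k] Words k X :=
  chainsLift fun _ _ σ => Finsupp.single (List.ofFn fun i => σ (stdSimplex.vertex i)) 1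

theorem verts_gen {n : ℤ} (m : ℕ) (h : (m : ℤ) = n) (σ : Simp m X) :
    verts (k := k) n (gen m h σ) =
      Finsupp.single (List.ofFn fun i => σ (stdSimplex.vertex i)) 1 := by
  rw [verts, chainsLift_gen]

theorem verts_bdy {n n' : ℤ} (hn : n' + 1 = n) (hn' : 0 ≤ n') (x : (chains k X).X n) :
    verts n' (bdy k X n n' x) = bdry (verts n x) := by
  refine LinearMap.congr_fun (chains_ext (k := k) (f := verts n' ∘ₗ bdy k X n n')
    (g := bdry ∘ₗ verts n) fun m hm σ => ?_) x
  cases m with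
  | zero => push_cast at hm; omega
  | succ m =>
    have hm' : (m : ℤ) = n' := by push_cast at hm; omega
    rw [LinearMap.comp_apply, LinearMap.comp_apply, bdy, chains_d_gen m hm hm', verts_gen,
      bdry_single, bdryWord_ofFn, map_sum]
    refine Finset.sum_congr rfl fun i _ => ?_
    rw [map_smul, verts_gen]
    congr 3
    funext j
    change σ (stdSimplex.map i.succAbove (stdSimplex.vertex j)) = _
    rw [stdSimplex.map_vertex]
    rfl

theorem verts_push (f : X ⟶ Y) (n : ℤ) (x : (chains k X).X n) :
    verts n (push f n x) = wmap f (verts n x) := by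
  refine LinearMap.congr_fun (chains_ext (k := k) (f := verts n ∘ₗ push f n)
    (g := wmap f ∘ₗ verts n) fun m hm σ => ?_) x
  rw [LinearMap.comp_apply, LinearMap.comp_apply, push, chains_map_gen, verts_gen, verts_gen,
    wmap_single, List.map_ofFn]
  rfl

theorem verts_mem {n : ℤ} (x : (chains k X).X n) :
    verts n x ∈ wspan k fun w => (w.length : ℤ) = n + 1 := by
  have := LinearMap.congr_fun (chains_ext (k := k)
    (f := (wspan k fun w : List X => (w.length : ℤ) = n + 1).mkQ ∘ₗ verts n) (g := 0)
    fun m hm σ => by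
      rw [LinearMap.comp_apply, verts_gen]
      simpa using single_mem_wspan (k := k)
        (p := fun w : List X => (w.length : ℤ) = n + 1)
        (w := List.ofFn fun i => σ (stdSimplex.vertex i)) (by simpa using hm)) x
  simpa using this

/-- The augmentation of singular chains vanishes on boundaries. -/
theorem cup_zero_bdy (s : ℕ → X → k) (x : (chains k X).X 1) :
    cup s 0 (verts 0 (bdy k X 1 0 x)) = 0 := by
  rw [verts_bdy (by norm_num) le_rfl]
  refine map_eq_of_mem_wspan (cup s 0 ∘ₗ bdry) 0 (fun w hw => ?_) (verts_mem x)
  rw [LinearMap.comp_apply, bdry_single, (cup_bdry s 0 w (by omega)).1]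
  rfl

end Vertices

/-! ### The fundamental cycles of cross-polytopes -/

section CrossPolytope
variable {k : Type u} [Field k] {α : Type}

/-- The boundary of the cross-polytope with opposite vertices `c i true` and `c i false`, for
`i < m`, as a signed sum of words with `m` letters: the iterated suspension of the empty word. -/
def crossWords (c : ℕ → Bool → α) : ℕ → Words k α
  | 0 => wnil
  | m + 1 => wcons (c m true) (crossWords c m) - wcons (c m false) (crossWords c m)

theorem bdry_crossWords (c : ℕ → Bool → α) (m : ℕ) : bdry (crossWords (k := k) c m) = 0 := by
  induction m with
  | zero => simp [crossWords, wnil, bdryWord]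
  | succ m ih => simp [crossWords, bdry_wcons, ih]

theorem bdry_wcons_crossWords (c : ℕ → Bool → α) (m : ℕ) (a : α) :
    bdry (wcons a (crossWords (k := k) c m)) = crossWords c m := by
  simp [bdry_wcons, bdry_crossWords]

theorem crossWords_mem (c : ℕ → Bool → α) (m : ℕ) : crossWords (k := k) c m ∈ wspan k fun w =>
    ∃ b : ℕ → Bool, ∀ a ∈ w, ∃ i < m, a = c i (b i) := by
  induction m with
  | zero => exact single_mem_wspan ⟨fun _ => true, by simp⟩
  | succ m ih =>
    have key : ∀ s, wcons (c m s) (crossWords (k := k) c m) ∈ wspan k fun w =>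
        ∃ b : ℕ → Bool, ∀ a ∈ w, ∃ i < m + 1, a = c i (b i) := by
      intro s
      refine wcons_mem_wspan _ ?_ ih
      rintro w ⟨b, hb⟩
      refine ⟨Function.update b m s, fun a ha => ?_⟩
      rcases List.mem_cons.1 ha with rfl | ha
      · exact ⟨m, by omega, by simp⟩
      · obtain ⟨i, hi, rfl⟩ := hb a ha
        exact ⟨i, by omega, by rw [Function.update_of_ne hi.ne]⟩
    exact Submodule.sub_mem _ (key _) (key _)

theorem wcons_crossWords_mem (c : ℕ → Bool → α) (m : ℕ) (s : Bool) :
    wcons (c m s) (crossWords (k := k) c m) ∈ wspan k fun w =>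
      ∃ b : ℕ → Bool, b m = s ∧ ∀ a ∈ w, ∃ i < m + 1, a = c i (b i) := by
  refine wcons_mem_wspan _ ?_ (crossWords_mem c m)
  rintro w ⟨b, hb⟩
  refine ⟨Function.update b m s, by simp, fun a ha => ?_⟩
  rcases List.mem_cons.1 ha with rfl | ha
  · exact ⟨m, by omega, by simp⟩
  · obtain ⟨i, hi, rfl⟩ := hb a ha
    exact ⟨i, by omega, by rw [Function.update_of_ne hi.ne]⟩

variable (d : ℕ)

/-- The set of vectors one of whose first `m` coordinates does not vanish. -/
def someNonzero (m : ℕ) : Set (EuclideanSpace ℝ (Fin d)) := {v | ∃ i : Fin d, (i : ℕ) < m ∧ v i ≠ 0}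

/-- The set of vectors whose coordinate number `m` is positive, or one of whose previous
coordinates does not vanish. -/
def posOrNonzero (m : ℕ) : Set (EuclideanSpace ℝ (Fin d)) :=
  {v | (∃ i : Fin d, (i : ℕ) = m ∧ 0 < v i) ∨ v ∈ someNonzero d m}

/-- The image of `posOrNonzero d m` under `v ↦ -v`. -/
def negOrNonzero (m : ℕ) : Set (EuclideanSpace ℝ (Fin d)) := {v | -v ∈ posOrNonzero d m}

variable {d}

theorem isOpen_coord_pos (i : Fin d) : IsOpen {v : EuclideanSpace ℝ (Fin d) | 0 < v i} :=
  isOpen_lt continuous_const (by fun_prop)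

theorem isOpen_someNonzero (m : ℕ) : IsOpen (someNonzero d m) := by
  have : someNonzero d m = ⋃ i : Fin d, ⋃ (_ : (i : ℕ) < m), {v | v i ≠ 0} := by
    ext v; simp [someNonzero]
  rw [this]
  exact isOpen_iUnion fun i => isOpen_iUnion fun _ =>
    isOpen_ne_fun (by fun_prop) continuous_const

theorem isOpen_posOrNonzero (m : ℕ) : IsOpen (posOrNonzero d m) := by
  have : posOrNonzero d m = (⋃ i : Fin d, ⋃ (_ : (i : ℕ) = m), {v | 0 < v i}) ∪ someNonzero d m := by
    ext v; simp [posOrNonzero]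
  rw [this]
  exact (isOpen_iUnion fun i => isOpen_iUnion fun _ => isOpen_coord_pos i).union
    (isOpen_someNonzero m)

theorem isOpen_negOrNonzero (m : ℕ) : IsOpen (negOrNonzero d m) :=
  (isOpen_posOrNonzero m).preimage continuous_neg

theorem neg_mem_someNonzero {m : ℕ} {v : EuclideanSpace ℝ (Fin d)} :
    -v ∈ someNonzero d m ↔ v ∈ someNonzero d m := by
  simp [someNonzero]

theorem pos_inter_neg (m : ℕ) : posOrNonzero d m ∩ negOrNonzero d m = someNonzero d m := by
  ext v
  constructor
  · rintro ⟨⟨i, hi, h⟩ | h, ⟨j, hj, h'⟩ | h'⟩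
    · obtain rfl : i = j := Fin.ext (hi.trans hj.symm)
      simp only [PiLp.neg_apply] at h'
      linarith
    · exact neg_mem_someNonzero.1 h'
    · exact h
    · exact h
  · exact fun h => ⟨Or.inr h, Or.inr (neg_mem_someNonzero.2 h)⟩

theorem pos_union_neg (m : ℕ) : posOrNonzero d m ∪ negOrNonzero d m = someNonzero d (m + 1) := by
  ext v
  constructor
  · rintro ((⟨i, hi, h⟩ | ⟨i, hi, h⟩) | (⟨i, hi, h⟩ | ⟨i, hi, h⟩))
    · exact ⟨i, by omega, h.ne'⟩
    · exact ⟨i, by omega, h⟩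
    · exact ⟨i, by omega, by rintro h0; simp [h0] at h⟩
    · exact ⟨i, by omega, by rintro h0; simp [h0] at h⟩
  · rintro ⟨i, hi, h⟩
    rcases (Nat.lt_succ_iff_lt_or_eq.1 hi) with hi | hi
    · exact Or.inl (Or.inr ⟨i, hi, h⟩)
    · rcases lt_or_gt_of_ne h with h | h
      · exact Or.inr (Or.inl ⟨i, hi, by simpa using h⟩)
      · exact Or.inl (Or.inl ⟨i, hi, h⟩)

variable (d) in
/-- The affine map sending the vertices `(i, true)` and `(i, false)` to the vectors `eᵢ` and
`-eᵢ`. -/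
def crossMap : C(stdSimplex ℝ (Fin d × Bool), TopCat.of (EuclideanSpace ℝ (Fin d))) where
  toFun t := WithLp.toLp 2 fun i => t (i, true) - t (i, false)
  continuous_toFun := by
    refine (PiLp.continuous_toLp 2 _).comp (continuous_pi fun i => ?_)
    exact ((continuous_apply (i, true)).comp continuous_subtype_val).sub
      ((continuous_apply (i, false)).comp continuous_subtype_val)

variable (d) in
/-- The letters `(i, true)` and `(i, false)`, for `i < d`. -/
def crossLetter [NeZero d] (i : ℕ) (s : Bool) : Fin d × Bool := (Fin.ofNat d i, s)

theorem simplexMap_eq_zero {ι β : Type} [Fintype ι] [Fintype β] (f : ι → β) (t : stdSimplex ℝ ι)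
    (x : β) (h : ∀ i, f i ≠ x) : simplexMap f t x = 0 := by
  classical
  change FunOnFinite.linearMap ℝ ℝ f t x = 0
  rw [FunOnFinite.linearMap_apply_apply]
  exact Finset.sum_eq_zero fun i hi => absurd (Finset.mem_filter.1 hi).2 (h i)

theorem crossMap_mem [NeZero d] {m : ℕ} (hm : m ≤ d) (b : ℕ → Bool) {l : ℕ}
    {f : Fin (l + 1) → Fin d × Bool} (hf : ∀ j, ∃ i < m, f j = crossLetter d i (b i))
    (t : stdSimplex ℝ (Fin (l + 1))) :
    crossMap d (simplexMap f t) ∈ someNonzero d m ∧ ‖crossMap d (simplexMap f t)‖ ≤ 1 ∧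
      (∀ i : Fin d, m ≤ i → crossMap d (simplexMap f t) i = 0) ∧
      ∀ i : Fin d, (b i = true → 0 ≤ crossMap d (simplexMap f t) i) ∧
        (b i = false → crossMap d (simplexMap f t) i ≤ 0) := by
  set T := simplexMap f t with hT
  have hv : ∀ i, crossMap d T i = T (i, true) - T (i, false) := fun i => rfl
  have h0 : ∀ i : Fin d, T (i, !b i) = 0 := by
    intro i
    refine simplexMap_eq_zero f t _ fun j hj => ?_
    obtain ⟨n, hn, e⟩ := hf j
    rw [hj, crossLetter, Prod.mk.injEq] at e
    have : (i : ℕ) = n := by rw [e.1]; exact Nat.mod_eq_of_lt (by omega)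
    rw [this] at e
    simpa using e.2
  have h1 : ∀ i : Fin d, m ≤ i → ∀ s, T (i, s) = 0 := by
    intro i hi s
    refine simplexMap_eq_zero f t _ fun j hj => ?_
    obtain ⟨n, hn, e⟩ := hf j
    rw [hj, crossLetter, Prod.mk.injEq] at e
    have : (i : ℕ) = n := by rw [e.1]; exact Nat.mod_eq_of_lt (by omega)
    omega
  have hpos : ∀ a, 0 ≤ T a := stdSimplex.zero_le T
  have hsum : ∑ i : Fin d, (T (i, true) + T (i, false)) = 1 := by
    rw [← stdSimplex.sum_eq_one T, Fintype.sum_prod_type]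
    simp
  have habs : ∀ i, |crossMap d T i| = T (i, true) + T (i, false) := by
    intro i
    have := h0 i
    rw [hv]
    cases h : b i <;> rw [h] at this <;> simp only [Bool.not_true, Bool.not_false] at this <;>
      rw [this] <;> simp [abs_of_nonneg (hpos _)]
  refine ⟨?_, ?_, ?_, ?_⟩
  · by_contra hne
    have hz : ∀ i : Fin d, T (i, true) + T (i, false) = 0 := by
      intro i
      by_cases hi : (i : ℕ) < m
      · rw [← habs, abs_eq_zero]
        by_contra h
        exact hne ⟨i, hi, h⟩
      · rw [h1 i (by omega), h1 i (by omega), add_zero]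
    rw [Finset.sum_eq_zero fun i _ => hz i] at hsum
    exact zero_ne_one hsum
  · rw [EuclideanSpace.norm_eq]
    refine Real.sqrt_le_one.2 ?_
    calc ∑ i, ‖crossMap d T i‖ ^ 2 ≤ ∑ i, (T (i, true) + T (i, false)) := by
          refine Finset.sum_le_sum fun i _ => ?_
          rw [Real.norm_eq_abs, habs]
          have h2 := Finset.single_le_sum (f := fun i => T (i, true) + T (i, false))
            (fun i _ => add_nonneg (hpos _) (hpos _)) (Finset.mem_univ i)
          rw [hsum] at h2
          have h3 := add_nonneg (hpos (i, true)) (hpos (i, false))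
          nlinarith
      _ = 1 := hsum
  · intro i hi
    rw [hv, h1 i hi, h1 i hi, sub_zero]
  · intro i
    have := h0 i
    rw [hv]
    constructor <;> intro h <;> rw [h] at this <;>
      simp only [Bool.not_true, Bool.not_false] at this <;> rw [this]
    · simp
    · simp

variable (k d) [NeZero d]

/-- The fundamental cycle of the sphere formed by the first `m` coordinates; it is meaningful for
`n = m - 1`. -/
def sphereChain (n : ℤ) (m : ℕ) : (chains k (TopCat.of (EuclideanSpace ℝ (Fin d)))).X n :=
  realize n (crossMap d) (crossWords (crossLetter d) m)

/-- The cone over `sphereChain` with apex the vector `eₘ` or `-eₘ`; it is meaningful for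
`n = m`. -/
def hemisphere (n : ℤ) (m : ℕ) (s : Bool) : (chains k (TopCat.of (EuclideanSpace ℝ (Fin d)))).X n :=
  realize n (crossMap d) (wcons (crossLetter d m s) (crossWords (crossLetter d) m))

theorem sphereChain_succ (n : ℤ) (m : ℕ) :
    sphereChain k d n (m + 1) = hemisphere k d n m true - hemisphere k d n m false := by
  rw [sphereChain, crossWords, map_sub, hemisphere, hemisphere]

theorem bdy_sphereChain {n n' : ℤ} (hn : n' + 1 = n) (m : ℕ) :
    bdy k _ n n' (sphereChain k d n m) = 0 := by
  rw [bdy, sphereChain, d_realize hn, bdry_crossWords, map_zero]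

theorem bdy_hemisphere {n n' : ℤ} (hn : n' + 1 = n) (m : ℕ) (s : Bool) :
    bdy k _ n n' (hemisphere k d n m s) = sphereChain k d n' m := by
  rw [bdy, hemisphere, d_realize hn, bdry_wcons_crossWords, sphereChain]

theorem sphereChain_mem (n : ℤ) {m : ℕ} (hm : m ≤ d) : sphereChain k d n m ∈
    supp k n {v : EuclideanSpace ℝ (Fin d) | v ∈ someNonzero d m ∧ ‖v‖ ≤ 1 ∧
      ∀ i : Fin d, m ≤ i → v i = 0} := by
  refine realize_mem_supp (fun l f hf t => ?_) (crossWords_mem (crossLetter d) m)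
  obtain ⟨b, hb⟩ := hf
  have := crossMap_mem hm b (fun j => hb (f j) ((List.mem_ofFn' _ _).2 ⟨j, rfl⟩)) t
  exact ⟨this.1, this.2.1, this.2.2.1⟩

theorem hemisphere_mem (n : ℤ) {m : ℕ} (hm : m < d) (s : Bool) : hemisphere k d n m s ∈
    supp k n {v : EuclideanSpace ℝ (Fin d) | v ∈ someNonzero d (m + 1) ∧ ‖v‖ ≤ 1 ∧
      (∀ i : Fin d, m + 1 ≤ i → v i = 0) ∧ ∀ i : Fin d, (i : ℕ) = m → cond s (0 ≤ v i) (v i ≤ 0)} := by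
  refine realize_mem_supp (fun l f hf t => ?_) (wcons_crossWords_mem (crossLetter d) m s)
  obtain ⟨b, hbs, hb⟩ := hf
  have := crossMap_mem hm b (fun j => hb (f j) ((List.mem_ofFn' _ _).2 ⟨j, rfl⟩)) t
  refine ⟨this.1, this.2.1, this.2.2.1, fun i hi => ?_⟩
  have h4 := this.2.2.2 i
  rw [hi, hbs] at h4
  cases s
  · exact h4.2 rfl
  · exact h4.1 rfl

theorem hemisphere_true_mem (n : ℤ) {m : ℕ} (hm : m < d) :
    hemisphere k d n m true ∈ supp k n (posOrNonzero d m) := by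
  refine supp_mono ?_ (hemisphere_mem k d n hm true)
  rintro v ⟨⟨i, hi, h⟩, -, -, h'⟩
  rcases (Nat.lt_succ_iff_lt_or_eq.1 hi) with hi | hi
  · exact Or.inr ⟨i, hi, h⟩
  · exact Or.inl ⟨i, hi, lt_of_le_of_ne (h' i hi) h.symm⟩

theorem hemisphere_false_mem (n : ℤ) {m : ℕ} (hm : m < d) :
    hemisphere k d n m false ∈ supp k n (negOrNonzero d m) := by
  refine supp_mono ?_ (hemisphere_mem k d n hm false)
  rintro v ⟨⟨i, hi, h⟩, -, -, h'⟩
  rcases (Nat.lt_succ_iff_lt_or_eq.1 hi) with hi | hi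
  · exact Or.inr (neg_mem_someNonzero.2 ⟨i, hi, h⟩)
  · refine Or.inl ⟨i, hi, ?_⟩
    have := lt_of_le_of_ne (h' i hi) h
    simpa using this

theorem cup_zero_hemisphere (s : ℕ → EuclideanSpace ℝ (Fin d) → k) (t : Bool) :
    cup s 0 (verts 0 (hemisphere k d 0 0 t)) = 1 := by
  have h : wcons (crossLetter d 0 t) (crossWords (k := k) (crossLetter d) 0) =
      Finsupp.single (List.ofFn fun _ : Fin 1 => crossLetter d 0 t) 1 := by
    simp [crossWords, wnil]
  rw [hemisphere, h, realize_single, realizeWord_ofFn _ 0 Nat.cast_zero, verts_gen]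
  simp [cup, cupWord]

variable {k d}

/-- The fundamental class of a sphere is not zero, even after subdivision. By induction on the
dimension: the connecting map of the Mayer–Vietoris sequence of the two half-spaces sends the
fundamental cycle of a sphere to that of its equator. -/
theorem sphereChain_ne_bdy (m : ℕ) (hm : m < d) {n n' : ℤ} (hn : (m : ℤ) = n) (hn' : n + 1 = n')
    (N : ℕ) (e : (chains k (TopCat.of (EuclideanSpace ℝ (Fin d)))).X n')
    (he : e ∈ supp k n' (someNonzero d (m + 1))) :
    (subdiv k _ n ^ N) (sphereChain k d n (m + 1)) ≠ bdy k _ n' n e := by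
  induction m generalizing n n' N with
  | zero =>
    intro h
    obtain rfl : n = 0 := by simpa using hn.symm
    obtain rfl : n' = 1 := by omega
    rw [sphereChain_succ, subdiv_pow_zero] at h
    rw [← pos_union_neg] at he
    obtain ⟨M, c, e', hc, h1⟩ := mayerVietoris (isOpen_posOrNonzero 0) (isOpen_negOrNonzero 0)
      (hemisphere_true_mem k d 0 hm) (hemisphere_false_mem k d 0 hm) he h
    rw [pos_inter_neg] at hc
    have hempty : someNonzero d 0 = ∅ := by ext v; simp [someNonzero]
    rw [hempty] at hc
    rw [eq_zero_of_mem_supp_empty hc, sub_zero, subdiv_pow_zero] at h1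
    have h2 := cup_zero_bdy (0 : ℕ → EuclideanSpace ℝ (Fin d) → k) e'
    rw [← h1] at h2
    exact one_ne_zero ((cup_zero_hemisphere k d _ _).symm.trans h2)
  | succ m ih =>
    intro h
    rw [sphereChain_succ, map_sub] at h
    rw [← pos_union_neg] at he
    obtain ⟨M, c, e', hc, h1⟩ := mayerVietoris (isOpen_posOrNonzero _) (isOpen_negOrNonzero _)
      (subdiv_pow_mem_supp N (hemisphere_true_mem k d n hm))
      (subdiv_pow_mem_supp N (hemisphere_false_mem k d n hm)) he h
    rw [pos_inter_neg] at hc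
    push_cast at hn
    refine ih (by omega) (n := n - 1) (n' := n) (by omega) (by omega) (M + N) c hc ?_
    rw [sub_eq_iff_eq_add] at h1
    have h2 := congrArg (bdy k _ n (n - 1)) h1
    rw [map_add, bdy_bdy, zero_add, bdy_subdiv_pow, bdy_subdiv_pow,
      bdy_hemisphere k d (by omega)] at h2
    rw [← h2, pow_add, Module.End.mul_apply]

end CrossPolytope

/-! ### Quasi-isomorphisms and cycles -/

section QuasiIsos
variable {k : Type u} [Field k] {A B : ChainComplex (ModuleCat.{u} k) ℤ}

theorem gradedHomology_map_bijective (f : A ⟶ B) [QuasiIso f] (n : ℤ) :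
    Function.Bijective (((gradedHomology k).map f).f n).hom := by
  have : IsIso (((gradedHomology k).map f).f n) :=
    inferInstanceAs (IsIso (HomologicalComplex.homologyMap f n))
  exact ConcreteCategory.bijective_of_isIso (((gradedHomology k).map f).f n)

theorem exists_cycle_lift (f : A ⟶ B) [QuasiIso f] {n : ℤ} {b : B.X n} (hb : b ∈ Cycle B n) :
    ∃ a ∈ Cycle A n, ∃ w : B.X (n + 1), (f.f n).hom a = b + (B.d (n + 1) n).hom w := by
  obtain ⟨c, hc⟩ := (gradedHomology_map_bijective f n).2 (homClass B n ⟨b, hb⟩)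
  obtain ⟨a, rfl⟩ := homClass_surjective A n c
  rw [homClass_map, ← sub_eq_zero, ← map_sub, homClass_eq_zero_iff] at hc
  obtain ⟨w, hw⟩ := hc
  exact ⟨a, a.2, w, by rw [hw]; simp⟩

theorem exists_bdy_of_map_bdy (f : A ⟶ B) [QuasiIso f] {n : ℤ} {a : A.X n} (ha : a ∈ Cycle A n)
    {w : B.X (n + 1)} (h : (B.d (n + 1) n).hom w = (f.f n).hom a) :
    ∃ v : A.X (n + 1), (A.d (n + 1) n).hom v = a := by
  rw [← homClass_eq_zero_iff A n ⟨a, ha⟩]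
  refine (gradedHomology_map_bijective f n).1 ?_
  rw [homClass_map, map_zero, homClass_eq_zero_iff]
  exact ⟨w, h⟩

/-- For a quasi-isomorphism to a complex with zero differential, a bounding chain can be chosen in
its kernel. -/
theorem exists_bdy_map_eq_zero (f : A ⟶ (gradedHomology k).obj B) (hf : QuasiIso f) {n : ℤ}
    (v : A.X (n + 1)) : ∃ v' : A.X (n + 1), (A.d (n + 1) n).hom v' = (A.d (n + 1) n).hom v ∧
      (f.f (n + 1)).hom v' = 0 := by
  obtain ⟨a, ha, w, hw⟩ := exists_cycle_lift f (b := (f.f (n + 1)).hom v)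
    (show _ ∈ LinearMap.ker _ from rfl)
  have h0 : (f.f (n + 1)).hom a = (f.f (n + 1)).hom v := by
    rw [hw]
    exact add_zero _
  have ha' : (A.d (n + 1) n).hom a = 0 := by
    have := LinearMap.mem_ker.1 ha
    rwa [add_sub_cancel_right] at this
  exact ⟨v - a, by rw [map_sub, ha', sub_zero], by rw [map_sub, h0, sub_self]⟩

theorem exists_bdy_of_map_zero (f : A ⟶ (gradedHomology k).obj B) (hf : QuasiIso f) {n : ℤ}
    {a : A.X n} (ha : a ∈ Cycle A n) (h : (f.f n).hom a = 0) :
    ∃ v : A.X (n + 1), (A.d (n + 1) n).hom v = a :=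
  exists_bdy_of_map_bdy f ha (w := 0) (by rw [h, map_zero])

theorem mem_cycle_iff {n n' : ℤ} (hn : n' + 1 = n) {a : A.X n} :
    a ∈ Cycle A n ↔ (A.d n n').hom a = 0 := by
  obtain rfl : n' = n - 1 := by omega
  exact LinearMap.mem_ker

theorem bdy_mem_cycle {n n' : ℤ} (v : A.X n) : (A.d n n').hom v ∈ Cycle A n' :=
  congr(($(A.d_comp_d n n' (n' - 1))).hom v)

theorem hom_bdy (f : A ⟶ B) (n n' : ℤ) (a : A.X n) :
    (B.d n n').hom ((f.f n).hom a) = (f.f n').hom ((A.d n n').hom a) :=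
  congr(($(f.comm n n')).hom a)

end QuasiIsos

/-! ### Massey products in dg operads -/

section Massey
variable {k : Type u} [Field k] {S : Type} {I J K : Type} [Finite I] [Finite J] [Finite K]

theorem DGOperad.comp_bdy_left (P : DGOperad k S) (x : I → S) (y : S) (i : I) (z : J → S)
    {p q n p' n' : ℤ} (hp : p' + 1 = p) (hn : n' + 1 = n) (h : p + q = n) (h' : p' + q = n')
    (a : (P.obj I x y).X p) {b : (P.obj J z (x i)).X q} (hb : b ∈ Cycle _ q) :
    P.comp x y i z h' (((P.obj I x y).d p p').hom a) b =
      ((P.obj (Graft i J) (graftColor x i z) y).d n n').hom (P.comp x y i z h a b) := by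
  rw [P.d_comp x y i z h hp (q' := q - 1) (by omega) hn h' (by omega), LinearMap.mem_ker.1 hb]
  simp

theorem DGOperad.comp_bdy_right (P : DGOperad k S) (x : I → S) (y : S) (i : I) (z : J → S)
    {p q n q' n' : ℤ} (hq : q' + 1 = q) (hn : n' + 1 = n) (h : p + q = n) (h' : p + q' = n')
    {a : (P.obj I x y).X p} (ha : a ∈ Cycle _ p) (b : (P.obj J z (x i)).X q) :
    P.comp x y i z h' a (((P.obj J z (x i)).d q q').hom b) =
      ((P.obj (Graft i J) (graftColor x i z) y).d n n').hom
        ((p.negOnePow : ℤ) • P.comp x y i z h a b) := by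
  rw [map_zsmul, P.d_comp x y i z h (p' := p - 1) (by omega) hq hn (by omega) h',
    LinearMap.mem_ker.1 ha, map_zero, LinearMap.zero_apply, zero_add, smul_smul, ← Units.val_mul,
    ← Int.negOnePow_add, Int.negOnePow_even _ ⟨p, rfl⟩, Units.val_one, one_smul]

theorem DGOperad.comp_mem_cycle (P : DGOperad k S) (x : I → S) (y : S) (i : I) (z : J → S)
    {p q n : ℤ} (h : p + q = n) {a : (P.obj I x y).X p} (ha : a ∈ Cycle _ p)
    {b : (P.obj J z (x i)).X q} (hb : b ∈ Cycle _ q) : P.comp x y i z h a b ∈ Cycle _ n :=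
  (P.isLeibniz x y i z).mem_cycle h ha hb

/-- Replacing cycles by homologous ones changes their composite by a boundary. -/
theorem DGOperad.comp_homologous (P : DGOperad k S) (x : I → S) (y : S) (i : I) (z : J → S)
    {p q n : ℤ} (h : p + q = n) {a : (P.obj I x y).X p} (ha : a ∈ Cycle _ p)
    {b : (P.obj J z (x i)).X q} (hb : b ∈ Cycle _ q) (a' : (P.obj I x y).X (p + 1))
    (b' : (P.obj J z (x i)).X (q + 1)) :
    P.comp x y i z h (a + ((P.obj I x y).d (p + 1) p).hom a')
        (b + ((P.obj J z (x i)).d (q + 1) q).hom b') = P.comp x y i z h a b +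
      ((P.obj (Graft i J) (graftColor x i z) y).d (n + 1) n).hom
        (P.comp x y i z (by omega) a' (b + ((P.obj J z (x i)).d (q + 1) q).hom b') +
          (p.negOnePow : ℤ) • P.comp x y i z (by omega) a b') := by
  rw [map_add (P.comp x y i z h), LinearMap.add_apply, map_add (P.comp x y i z h a),
    P.comp_bdy_right x y i z rfl rfl (by omega) h ha,
    P.comp_bdy_left x y i z rfl rfl (by omega) h a' (Submodule.add_mem _ hb (bdy_mem_cycle b'))]
  refine Eq.trans ?_ (congrArg _ (map_add _ _ _).symm)
  abel

/-- Let `a` be a cycle with two distinct inputs `i` and `i'`, let `b` and `c` be cycles of degree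
zero, and suppose that `a ∘ᵢ b` and `a ∘ᵢ' c` are boundaries. If the operad is formal, one can
choose cycles homologous to `a`, `b` and `c`, and chains `h₁` and `h₂` bounded by their composites,
such that the Massey product `h₁ ∘ c - h₂ ∘ b` is a boundary: the bounding chains can be taken in
the kernel of the morphism to the homology operad. -/
theorem DGOperad.exists_massey_eq_bdy {P Q : DGOperad k S} (γ : P.Hom Q) (ψ : P.Hom Q.homology)
    (hγ : γ.IsQuasiIso) (hψ : ψ.IsQuasiIso) (x : I → S) (y : S) {i i' : I} (hi : i ≠ i')
    (z : J → S) (w : K → S) {n : ℤ} {a : (Q.obj I x y).X n} (ha : a ∈ Cycle _ n)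
    {b : (Q.obj J z (x i)).X 0} (hb : b ∈ Cycle _ 0) {c : (Q.obj K w (x i')).X 0}
    (hc : c ∈ Cycle _ 0) {h₁ : (Q.obj (Graft i J) (graftColor x i z) y).X (n + 1)}
    (hh₁ : ((Q.obj (Graft i J) (graftColor x i z) y).d (n + 1) n).hom h₁ =
      Q.comp x y i z (add_zero n) a b)
    {h₂ : (Q.obj (Graft i' K) (graftColor x i' w) y).X (n + 1)}
    (hh₂ : ((Q.obj (Graft i' K) (graftColor x i' w) y).d (n + 1) n).hom h₂ =
      Q.comp x y i' w (add_zero n) a c) :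
    ∃ (a' : (Q.obj I x y).X (n + 1)) (b' : (Q.obj J z (x i)).X (0 + 1))
      (c' : (Q.obj K w (x i')).X (0 + 1))
      (g₁ : (Q.obj (Graft i J) (graftColor x i z) y).X (n + 1))
      (g₂ : (Q.obj (Graft i' K) (graftColor x i' w) y).X (n + 1))
      (e : (Q.obj (Graft (Sum.inl ⟨i', hi.symm⟩ : Graft i J) K)
        (graftColor (graftColor x i z) (Sum.inl ⟨i', hi.symm⟩) w) y).X (n + 1 + 1)),
      ((Q.obj (Graft i J) (graftColor x i z) y).d (n + 1) n).hom g₁ =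
        Q.comp x y i z (add_zero n) (a + ((Q.obj I x y).d (n + 1) n).hom a')
          (b + ((Q.obj J z (x i)).d (0 + 1) 0).hom b') ∧
      Q.comp (graftColor x i z) y (Sum.inl ⟨i', hi.symm⟩) w (add_zero (n + 1)) g₁
          (c + ((Q.obj K w (x i')).d (0 + 1) 0).hom c') -
        ((Q.act (graftSwap hi J K) (graftSwap_color x z w hi) y).f (n + 1)).hom
          (Q.comp (graftColor x i' w) y (Sum.inl ⟨i, hi⟩) z (add_zero (n + 1)) g₂
            (b + ((Q.obj J z (x i)).d (0 + 1) 0).hom b')) =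
        ((Q.obj (Graft (Sum.inl ⟨i', hi.symm⟩ : Graft i J) K)
          (graftColor (graftColor x i z) (Sum.inl ⟨i', hi.symm⟩) w) y).d (n + 1 + 1) (n + 1)).hom
          e := by
  have := hγ I x y
  have := hγ J z (x i)
  have := hγ K w (x i')
  have := hγ (Graft i J) (graftColor x i z) y
  have := hγ (Graft i' K) (graftColor x i' w) y
  obtain ⟨α, hα, a', ha'⟩ := exists_cycle_lift (γ.app I x y) ha
  obtain ⟨β, hβ, b', hb'⟩ := exists_cycle_lift (γ.app J z (x i)) hb
  obtain ⟨ε, hε, c', hc'⟩ := exists_cycle_lift (γ.app K w (x i')) hc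
  have e1 := γ.map_comp x y i z (add_zero n) α β
  rw [ha', hb', Q.comp_homologous x y i z (add_zero n) ha hb, ← hh₁, ← map_add] at e1
  obtain ⟨v₁, hv₁⟩ := exists_bdy_of_map_bdy _ (P.comp_mem_cycle x y i z (add_zero n) hα hβ) e1.symm
  have e2 := γ.map_comp x y i' w (add_zero n) α ε
  rw [ha', hc', Q.comp_homologous x y i' w (add_zero n) ha hc, ← hh₂, ← map_add] at e2
  obtain ⟨v₂, hv₂⟩ := exists_bdy_of_map_bdy _ (P.comp_mem_cycle x y i' w (add_zero n) hα hε)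
    e2.symm
  obtain ⟨u₁, hu₁, hψ₁⟩ := exists_bdy_map_eq_zero _ (hψ (Graft i J) (graftColor x i z) y) v₁
  obtain ⟨u₂, hu₂, hψ₂⟩ := exists_bdy_map_eq_zero _ (hψ (Graft i' K) (graftColor x i' w) y) v₂
  rw [hv₁] at hu₁
  rw [hv₂] at hu₂
  -- The Massey product formed in `P` with `u₁` and `u₂`. It is a cycle, and `ψ` kills it because it
  -- kills `u₁` and `u₂`; hence it is a boundary.
  set m := P.comp (graftColor x i z) y (Sum.inl ⟨i', hi.symm⟩) w (add_zero (n + 1)) u₁ ε -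
    ((P.act (graftSwap hi J K) (graftSwap_color x z w hi) y).f (n + 1)).hom
      (P.comp (graftColor x i' w) y (Sum.inl ⟨i, hi⟩) z (add_zero (n + 1)) u₂ β) with hm
  have hcyc : m ∈ Cycle _ (n + 1) := by
    rw [mem_cycle_iff (n' := n) rfl, hm, map_sub, hom_bdy]
    have hs := P.comp_swap x y hi z w (add_zero n) (add_zero n) (add_zero n) (add_zero n) α β ε
    have l1 := P.comp_bdy_left (graftColor x i z) y (Sum.inl ⟨i', hi.symm⟩) w rfl rfl
      (add_zero (n + 1)) (add_zero n) u₁ hε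
    have l2 := P.comp_bdy_left (graftColor x i' w) y (Sum.inl ⟨i, hi⟩) z rfl rfl
      (add_zero (n + 1)) (add_zero n) u₂ hβ
    rw [hu₁] at l1
    rw [hu₂] at l2
    rw [← l1, ← l2, hs]
    simp
  have hψm : ((ψ.app (Graft (Sum.inl ⟨i', hi.symm⟩ : Graft i J) K)
      (graftColor (graftColor x i z) (Sum.inl ⟨i', hi.symm⟩) w) y).f (n + 1)).hom m = 0 := by
    have hact := congr(($(ψ.map_act (graftSwap hi J K) (graftSwap_color x z w hi) y)).f (n + 1))
    have hact' := congr(($hact).hom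
      (P.comp (graftColor x i' w) y (Sum.inl ⟨i, hi⟩) z (add_zero (n + 1)) u₂ β))
    refine (map_sub _ _ _).trans ((congrArg₂ (· - ·) (x' := 0) (y' := 0) ?_ ?_).trans (sub_zero _))
    · exact (ψ.map_comp _ _ _ _ _ _ _).trans
        ((congrArg (fun v => Q.homology.comp _ _ _ _ _ v _) hψ₁).trans (LinearMap.map_zero₂ _ _))
    · refine hact'.trans ((congrArg ((Q.homology.act (graftSwap hi J K)
        (graftSwap_color x z w hi) y).f (n + 1)).hom ?_).trans (map_zero _))
      exact (ψ.map_comp (graftColor x i' w) y (Sum.inl ⟨i, hi⟩) z (add_zero (n + 1)) u₂ β).trans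
        ((congrArg (fun v => Q.homology.comp (graftColor x i' w) y (Sum.inl ⟨i, hi⟩) z
          (add_zero (n + 1)) v _) hψ₂).trans (LinearMap.map_zero₂ _ _))
  obtain ⟨t, ht⟩ := exists_bdy_of_map_zero _ (hψ _ _ _) hcyc hψm
  refine ⟨a', b', c', ((γ.app _ _ _).f _).hom u₁, ((γ.app _ _ _).f _).hom u₂,
    ((γ.app _ _ _).f _).hom t, ?_, ?_⟩
  · rw [hom_bdy, hu₁, γ.map_comp, ha', hb']
  · rw [hom_bdy, ht]
    refine Eq.trans ?_ (map_sub _ _ _).symm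
    have hact := congr(($(γ.map_act (graftSwap hi J K) (graftSwap_color x z w hi) y)).f (n + 1))
    have hact' := congr(($hact).hom
      (P.comp (graftColor x i' w) y (Sum.inl ⟨i, hi⟩) z (add_zero (n + 1)) u₂ β))
    refine congrArg₂ (· - ·) ?_ (Eq.trans ?_ hact'.symm)
    · rw [← hc']
      exact (γ.map_comp _ _ _ _ _ _ _).symm
    refine congrArg _ ?_
    rw [← hb']
    exact (γ.map_comp _ _ _ _ _ _ _).symm

/-- Replacing three cycles by homologous ones changes their iterated composite by the boundary of
a sum of iterated composites. -/
theorem DGOperad.comp_comp_homologous (P : DGOperad k S) (x : I → S) (y : S) (i : I) (z : J → S)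
    (j : Graft i J) (w : K → S) {n : ℤ} {a : (P.obj I x y).X n} (ha : a ∈ Cycle _ n)
    {b : (P.obj J z (x i)).X 0} (hb : b ∈ Cycle _ 0)
    {c : (P.obj K w (graftColor x i z j)).X 0} (hc : c ∈ Cycle _ 0)
    (a' : (P.obj I x y).X (n + 1)) (b' : (P.obj J z (x i)).X (0 + 1))
    (c' : (P.obj K w (graftColor x i z j)).X (0 + 1))
    (T : Submodule k ((P.obj (Graft j K) (graftColor (graftColor x i z) j w) y).X (n + 1)))
    (hT : ∀ (p q r s : ℤ) (h1 : p + q = s) (h2 : s + r = n + 1) (a b c),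
      P.comp (graftColor x i z) y j w h2 (P.comp x y i z h1 a b) c ∈ T) :
    ∃ e ∈ T, P.comp (graftColor x i z) y j w (add_zero n) (P.comp x y i z (add_zero n)
        (a + ((P.obj I x y).d (n + 1) n).hom a') (b + ((P.obj J z (x i)).d (0 + 1) 0).hom b'))
        (c + ((P.obj K w (graftColor x i z j)).d (0 + 1) 0).hom c') =
      P.comp (graftColor x i z) y j w (add_zero n) (P.comp x y i z (add_zero n) a b) c +
        ((P.obj (Graft j K) (graftColor (graftColor x i z) j w) y).d (n + 1) n).hom e := by
  rw [P.comp_homologous x y i z (add_zero n) ha hb, P.comp_homologous (graftColor x i z) y j w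
    (add_zero n) (P.comp_mem_cycle x y i z (add_zero n) ha hb) hc]
  refine ⟨_, ?_, rfl⟩
  refine T.add_mem ?_ (zsmul_mem (hT _ _ _ _ _ _ _ _ _) _)
  rw [map_add (P.comp (graftColor x i z) y j w _), LinearMap.add_apply,
    map_zsmul (P.comp (graftColor x i z) y j w _), LinearMap.smul_apply]
  exact T.add_mem (hT _ _ _ _ _ _ _ _ _) (zsmul_mem (hT _ _ _ _ _ _ _ _ _) _)

end Massey

/-! ### Configurations of two balls or half-balls -/

section Geometry
variable {l : ℕ}

theorem mem_upperHalf {v : EuclideanSpace ℝ (Fin (l + 1))} :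
    v ∈ upperHalf (l + 1) ↔ 0 < v (Fin.last l) := by
  refine ⟨fun h => h _ (by simp), fun h i hi => ?_⟩
  obtain rfl : i = Fin.last l := Fin.ext (by simpa using hi)
  exact h

theorem mem_boundary {v : EuclideanSpace ℝ (Fin (l + 1))} :
    v ∈ boundary (l + 1) ↔ v (Fin.last l) = 0 := by
  refine ⟨fun h => h _ (by simp), fun h i hi => ?_⟩
  obtain rfl : i = Fin.last l := Fin.ext (by simpa using hi)
  exact h

theorem norm_le_of_abs_le {n : ℕ} {v w : EuclideanSpace ℝ (Fin n)} (h : ∀ i, |v i| ≤ |w i|) :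
    ‖v‖ ≤ ‖w‖ := by
  rw [EuclideanSpace.norm_eq, EuclideanSpace.norm_eq]
  refine Real.sqrt_le_sqrt (Finset.sum_le_sum fun i _ => ?_)
  exact pow_le_pow_left₀ (norm_nonneg _) (h i) 2

theorem region_subset_region {s : Colour} {c : EuclideanSpace ℝ (Fin (l + 1))} {r : ℝ}
    (h : ‖c‖ + r ≤ 1) : region s (c, r) ⊆ region s (0, 1) := by
  have hb : Metric.ball c r ⊆ Metric.ball 0 1 :=
    Metric.ball_subset_ball' (by rw [dist_zero_right]; linarith)
  cases s with
  | closed => exact hb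
  | opened => exact Set.inter_subset_inter_left _ hb

theorem region_closed_subset {c : EuclideanSpace ℝ (Fin (l + 1))} {r : ℝ}
    (h : ‖c‖ + r ≤ 1) (h' : r ≤ c (Fin.last l)) :
    region .closed (c, r) ⊆ region .opened (0, 1) := by
  intro v hv
  refine ⟨region_subset_region h hv, mem_upperHalf.2 ?_⟩
  have h1 : ‖v - c‖ < r := by rw [← dist_eq_norm]; exact hv
  have h2 := (PiLp.norm_apply_le (v - c) (Fin.last l)).trans_lt h1
  rw [Real.norm_eq_abs, PiLp.sub_apply, abs_lt] at h2
  linarith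

theorem region_disjoint {s s' : Colour} {c c' : EuclideanSpace ℝ (Fin (l + 1))} {r r' : ℝ}
    (h : r + r' ≤ dist c c') : Disjoint (region s (c, r)) (region s' (c', r')) := by
  refine (Metric.ball_disjoint_ball h).mono ?_ ?_
  · cases s
    · exact subset_rfl
    · exact Set.inter_subset_left
  · cases s'
    · exact subset_rfl
    · exact Set.inter_subset_left

/-- Two balls or half-balls with opposite centres, at distance `‖v‖` from each other. -/
def pairRegions (v : EuclideanSpace ℝ (Fin (l + 1))) : Fin 2 → EuclideanSpace ℝ (Fin (l + 1)) × ℝ :=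
  ![((1 / 2 : ℝ) • v, ‖v‖ / 4), (-((1 / 2 : ℝ) • v), ‖v‖ / 4)]

theorem isConfig_pairRegions {s : Colour} {v : EuclideanSpace ℝ (Fin (l + 1))} (hv : v ≠ 0)
    (hv1 : ‖v‖ ≤ 1) (hs : s = .opened → v (Fin.last l) = 0) :
    IsConfig (fun _ : Fin 2 => s) s (pairRegions v) := by
  have hpos : 0 < ‖v‖ := norm_pos_iff.2 hv
  have hn : ‖(1 / 2 : ℝ) • v‖ = ‖v‖ / 2 := by
    rw [norm_smul, Real.norm_of_nonneg (by norm_num)]; ring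
  have hd : ‖v‖ / 4 + ‖v‖ / 4 ≤ dist ((1 / 2 : ℝ) • v) (-((1 / 2 : ℝ) • v)) := by
    rw [dist_eq_norm, sub_neg_eq_add, ← add_smul]
    norm_num
    linarith
  refine ⟨⟨0⟩, fun h _ => h, ?_, ?_, ?_, ?_⟩
  · intro i
    fin_cases i <;> simp [pairRegions, hpos]
  · intro i hi
    rw [mem_boundary]
    fin_cases i <;> simp [pairRegions, hs hi]
  · intro i
    fin_cases i
    · exact region_subset_region (by rw [hn]; linarith)
    · exact region_subset_region (by rw [norm_neg, hn]; linarith)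
  · intro i j hij
    fin_cases i <;> fin_cases j
    · exact absurd rfl hij
    · exact region_disjoint hd
    · exact (region_disjoint hd).symm
    · exact absurd rfl hij

/-- The vector obtained by replacing the last coordinate by zero. -/
def horizontal (v : EuclideanSpace ℝ (Fin (l + 1))) : EuclideanSpace ℝ (Fin (l + 1)) :=
  WithLp.toLp 2 fun i => if i = Fin.last l then 0 else v i

theorem horizontal_apply (v : EuclideanSpace ℝ (Fin (l + 1))) (i : Fin (l + 1)) :
    horizontal v i = if i = Fin.last l then 0 else v i := rfl

theorem continuous_horizontal : Continuous (horizontal (l := l)) := by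
  refine (PiLp.continuous_toLp 2 _).comp (continuous_pi fun i => ?_)
  split_ifs
  · exact continuous_const
  · fun_prop

theorem horizontal_of_eq_zero {v : EuclideanSpace ℝ (Fin (l + 1))} (h : v (Fin.last l) = 0) :
    horizontal v = v := by
  ext i
  rw [horizontal_apply]
  split_ifs with hi
  · rw [hi, h]
  · rfl

/-- The last vector of the standard basis. -/
def lastVec (l : ℕ) : EuclideanSpace ℝ (Fin (l + 1)) := EuclideanSpace.single (Fin.last l) 1

theorem norm_lastVec : ‖lastVec l‖ = 1 := by simp [lastVec]

theorem lastVec_last : lastVec l (Fin.last l) = 1 := by simp [lastVec]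

theorem lastVec_of_ne {i : Fin (l + 1)} (h : i ≠ Fin.last l) : lastVec l i = 0 := by
  simp [lastVec, h]

variable {i : Fin 2}

/-- A half-ball, and a ball disjoint from it; when the last coordinate of `v` vanishes, this is the
result of replacing a half-ball of `pairRegions v` by a ball contained in it. -/
def capRegions (i : Fin 2) (v : EuclideanSpace ℝ (Fin (l + 1))) :
    Graft i Unit → EuclideanSpace ℝ (Fin (l + 1)) × ℝ :=
  Sum.elim (fun _ => (-((1 / 2 : ℝ) • horizontal v), ‖v‖ / 4))
    fun _ => ((1 / 2 : ℝ) • v + (‖v‖ / 8) • lastVec l, ‖v‖ / 8)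

theorem isConfig_capRegions {v : EuclideanSpace ℝ (Fin (l + 1))} (hv : v ≠ 0)
    (hv1 : ‖v‖ ≤ 1) (hl : 0 ≤ v (Fin.last l)) :
    IsConfig (graftColor (fun _ : Fin 2 => Colour.opened) i fun _ : Unit => .closed) .opened
      (capRegions i v) := by
  have hpos : 0 < ‖v‖ := norm_pos_iff.2 hv
  have hn : ‖(1 / 2 : ℝ) • v‖ = ‖v‖ / 2 := by
    rw [norm_smul, Real.norm_of_nonneg (by norm_num)]; ring
  have hn' : ‖(1 / 2 : ℝ) • horizontal v‖ ≤ ‖v‖ / 2 := by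
    rw [← hn]
    refine norm_le_of_abs_le fun i => ?_
    rw [PiLp.smul_apply, PiLp.smul_apply, horizontal_apply]
    split_ifs
    · simp
    · rfl
  have hd : ‖v‖ / 4 + ‖v‖ / 8 ≤ dist (-((1 / 2 : ℝ) • horizontal v))
      ((1 / 2 : ℝ) • v + (‖v‖ / 8) • lastVec l) := by
    refine le_trans (b := ‖(1 / 2 : ℝ) • v‖) (by rw [hn]; linarith) ?_
    rw [dist_comm, dist_eq_norm, sub_neg_eq_add]
    refine norm_le_of_abs_le fun i => ?_
    simp only [PiLp.add_apply, PiLp.smul_apply, smul_eq_mul, horizontal_apply]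
    split_ifs with hi
    · subst hi
      rw [lastVec_last, abs_of_nonneg (by positivity), abs_of_nonneg (by positivity)]
      linarith
    · rw [lastVec_of_ne hi, mul_zero, add_zero, abs_mul,
        show (1 / 2 : ℝ) * v i + 1 / 2 * v i = v i by ring, abs_of_pos (by norm_num)]
      linarith [abs_nonneg (v i)]
  refine ⟨⟨Sum.inr ()⟩, fun h => by simp at h, ?_, ?_, ?_, ?_⟩
  · rintro (a | a)
    · exact div_pos hpos (by norm_num)
    · exact div_pos hpos (by norm_num)
  · rintro (a | a) h
    · rw [mem_boundary]
      simp [capRegions, horizontal_apply]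
    · exact absurd h (by simp)
  · rintro (a | a)
    · exact region_subset_region (by rw [norm_neg]; linarith)
    · refine region_closed_subset ?_ ?_
      · refine (add_le_add_left (norm_add_le _ _) _).trans ?_
        rw [hn, norm_smul, norm_lastVec, Real.norm_of_nonneg (by positivity)]
        linarith
      · simp only [PiLp.add_apply, PiLp.smul_apply, smul_eq_mul, lastVec_last]
        linarith
  · rintro (a | a) (b | b) hab
    · refine absurd (congrArg Sum.inl (Subtype.ext ?_)) hab
      have ha := a.2
      have hb := b.2
      omega
    · exact region_disjoint hd
    · exact (region_disjoint hd).symm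
    · exact absurd rfl hab

/-- The vector obtained by changing the signs of all the coordinates but the last. -/
def reflect (v : EuclideanSpace ℝ (Fin (l + 1))) : EuclideanSpace ℝ (Fin (l + 1)) :=
  v - (2 : ℝ) • horizontal v

theorem continuous_reflect : Continuous (reflect (l := l)) :=
  continuous_id.sub (continuous_horizontal.const_smul (2 : ℝ))

theorem reflect_last (v : EuclideanSpace ℝ (Fin (l + 1))) :
    reflect v (Fin.last l) = v (Fin.last l) := by
  simp [reflect, horizontal_apply]

theorem norm_reflect (v : EuclideanSpace ℝ (Fin (l + 1))) : ‖reflect v‖ = ‖v‖ := by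
  have h : ∀ i, |reflect v i| = |v i| := by
    intro i
    simp only [reflect, PiLp.sub_apply, PiLp.smul_apply, smul_eq_mul, horizontal_apply]
    split_ifs
    · simp
    · rw [← abs_neg]; congr 1; ring
  exact le_antisymm (norm_le_of_abs_le fun i => (h i).le) (norm_le_of_abs_le fun i => (h i).ge)

theorem reflect_of_eq_zero {v : EuclideanSpace ℝ (Fin (l + 1))} (h : v (Fin.last l) = 0) :
    reflect v = -v := by
  rw [reflect, horizontal_of_eq_zero h, two_smul]
  abel

/-- The punctured unit ball. -/
def puncturedBall (l : ℕ) : Set (EuclideanSpace ℝ (Fin (l + 1))) := {v | v ≠ 0 ∧ ‖v‖ ≤ 1}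

/-- The vectors of the punctured unit ball with nonnegative last coordinate. -/
def upperBall (l : ℕ) : Set (EuclideanSpace ℝ (Fin (l + 1))) :=
  {v | v ≠ 0 ∧ ‖v‖ ≤ 1 ∧ 0 ≤ v (Fin.last l)}

/-- The vectors of the punctured unit ball with zero last coordinate. -/
def equatorBall (l : ℕ) : Set (EuclideanSpace ℝ (Fin (l + 1))) :=
  {v | v ≠ 0 ∧ ‖v‖ ≤ 1 ∧ v (Fin.last l) = 0}

theorem equatorBall_subset : equatorBall l ⊆ upperBall l := fun _ h => ⟨h.1, h.2.1, h.2.2.ge⟩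

theorem continuous_pairRegions : Continuous (pairRegions (l := l)) := by
  refine continuous_pi fun i => ?_
  fin_cases i
  · exact (by fun_prop : Continuous fun v : EuclideanSpace ℝ (Fin (l + 1)) =>
      ((1 / 2 : ℝ) • v, ‖v‖ / 4))
  · exact (by fun_prop : Continuous fun v : EuclideanSpace ℝ (Fin (l + 1)) =>
      (-((1 / 2 : ℝ) • v), ‖v‖ / 4))

theorem continuous_capRegions (i : Fin 2) : Continuous (capRegions (l := l) i) := by
  have h := continuous_horizontal (l := l)
  refine continuous_pi fun i => ?_
  rcases i with a | a
  · exact (by fun_prop : Continuous fun v : EuclideanSpace ℝ (Fin (l + 1)) =>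
      (-((1 / 2 : ℝ) • horizontal v), ‖v‖ / 4))
  · exact (by fun_prop : Continuous fun v : EuclideanSpace ℝ (Fin (l + 1)) =>
      ((1 / 2 : ℝ) • v + (‖v‖ / 8) • lastVec l, ‖v‖ / 8))

/-- The family of pairs of opposite balls. -/
def closedPair (l : ℕ) : TopCat.of (puncturedBall l) ⟶
    (swissCheese (l + 1)).obj (Fin 2) (fun _ => .closed) .closed :=
  TopCat.ofHom ⟨fun v => ⟨pairRegions v.1, isConfig_pairRegions v.2.1 v.2.2 (by simp)⟩,
    Continuous.subtype_mk (continuous_pairRegions.comp continuous_subtype_val) _⟩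

/-- The family of pairs of opposite half-balls. -/
def openPair (l : ℕ) : TopCat.of (equatorBall l) ⟶
    (swissCheese (l + 1)).obj (Fin 2) (fun _ => .opened) .opened :=
  TopCat.ofHom ⟨fun v => ⟨pairRegions v.1, isConfig_pairRegions v.2.1 v.2.2.1 fun _ => v.2.2.2⟩,
    Continuous.subtype_mk (continuous_pairRegions.comp continuous_subtype_val) _⟩

/-- The colours of the inputs of the composite of an operation with two open inputs and an
operation with one closed input. -/
abbrev mixedColor (i : Fin 2) : Graft i Unit → Colour :=
  graftColor (fun _ : Fin 2 => Colour.opened) i fun _ : Unit => .closed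

/-- A family of configurations with one half-ball and one ball that extends the composites of the
pairs of half-balls and of a ball inserted in the half-ball number `0`. -/
def cap (l : ℕ) : TopCat.of (upperBall l) ⟶
    (swissCheese (l + 1)).obj (Graft (0 : Fin 2) Unit) (mixedColor 0) .opened :=
  TopCat.ofHom ⟨fun v => ⟨capRegions 0 v.1, isConfig_capRegions v.2.1 v.2.2.1 v.2.2.2⟩,
    Continuous.subtype_mk ((continuous_capRegions 0).comp continuous_subtype_val) _⟩

/-- A family of configurations with one half-ball and one ball that extends the composites of the
pairs of half-balls and of a ball inserted in the half-ball number `1`. -/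
def cap' (l : ℕ) : TopCat.of (upperBall l) ⟶
    (swissCheese (l + 1)).obj (Graft (1 : Fin 2) Unit) (mixedColor 1) .opened :=
  TopCat.ofHom ⟨fun v => ⟨capRegions 1 (reflect v.1), isConfig_capRegions
      (norm_pos_iff.1 (by rw [norm_reflect]; exact norm_pos_iff.2 v.2.1))
      (by rw [norm_reflect]; exact v.2.2.1) (by rw [reflect_last]; exact v.2.2.2)⟩,
    Continuous.subtype_mk ((continuous_capRegions 1).comp
      (continuous_reflect.comp continuous_subtype_val)) _⟩

/-- A ball in the half-ball. -/
def whistle (l : ℕ) : (swissCheese (l + 1)).obj Unit (fun _ => .closed) .opened :=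
  ⟨fun _ => ((1 / 2 : ℝ) • lastVec l, 1 / 2),
    { nonempty := ⟨()⟩
      closed_of_closed := fun h => by simp at h
      radius_pos := fun _ => by norm_num
      centre_mem := fun _ h => by simp at h
      subset := fun _ => region_closed_subset (by
        rw [norm_smul, norm_lastVec, Real.norm_of_nonneg (by norm_num)]; norm_num) (by
        rw [PiLp.smul_apply, lastVec_last, smul_eq_mul, mul_one])
      disjoint := fun _ _ h => absurd rfl h }⟩

/-- The insertion of `whistle` in an input of an operation. -/
def insertWhistle (l : ℕ) {I : Type} [Finite I] (x : I → Colour) (y : Colour) (i : I)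
    (hi : x i = .opened) : (swissCheese (l + 1)).obj I x y ⟶
      (swissCheese (l + 1)).obj (Graft i Unit) (graftColor x i fun _ : Unit => .closed) y :=
  TopCat.ofHom (((swissCheese (l + 1)).comp x y i fun _ : Unit => .closed).comp
    ((ContinuousMap.id _).prodMk (ContinuousMap.const _ (hi ▸ whistle l))))

theorem openPair_insertWhistle_zero :
    openPair l ≫ insertWhistle l (fun _ => .opened) .opened (0 : Fin 2) rfl =
      TopCat.ofHom ⟨Set.inclusion equatorBall_subset, continuous_inclusion _⟩ ≫ cap l := by
  ext v
  refine Subtype.ext (funext fun a => ?_)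
  rcases a with ⟨a, ha⟩ | a
  · obtain rfl : a = 1 := by omega
    change (-((1 / 2 : ℝ) • v.1), ‖v.1‖ / 4) = (-((1 / 2 : ℝ) • horizontal v.1), ‖v.1‖ / 4)
    rw [horizontal_of_eq_zero v.2.2.2]
  · change ((1 / 2 : ℝ) • v.1 + (‖v.1‖ / 4) • (1 / 2 : ℝ) • lastVec l, ‖v.1‖ / 4 * (1 / 2)) =
      ((1 / 2 : ℝ) • v.1 + (‖v.1‖ / 8) • lastVec l, ‖v.1‖ / 8)
    rw [smul_smul, show ‖v.1‖ / 4 * (1 / 2) = ‖v.1‖ / 8 by ring]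

theorem openPair_insertWhistle_one :
    openPair l ≫ insertWhistle l (fun _ => .opened) .opened (1 : Fin 2) rfl =
      TopCat.ofHom ⟨Set.inclusion equatorBall_subset, continuous_inclusion _⟩ ≫ cap' l := by
  ext v
  have hr := reflect_of_eq_zero v.2.2.2
  refine Subtype.ext (funext fun a => ?_)
  rcases a with ⟨a, ha⟩ | a
  · obtain rfl : a = 0 := by omega
    change ((1 / 2 : ℝ) • v.1, ‖v.1‖ / 4) =
      (-((1 / 2 : ℝ) • horizontal (reflect v.1)), ‖reflect v.1‖ / 4)
    rw [horizontal_of_eq_zero (by rw [reflect_last]; exact v.2.2.2), hr, norm_neg, smul_neg,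
      neg_neg]
  · change (-((1 / 2 : ℝ) • v.1) + (‖v.1‖ / 4) • (1 / 2 : ℝ) • lastVec l, ‖v.1‖ / 4 * (1 / 2)) =
      ((1 / 2 : ℝ) • reflect v.1 + (‖reflect v.1‖ / 8) • lastVec l, ‖reflect v.1‖ / 8)
    rw [smul_smul, show ‖v.1‖ / 4 * (1 / 2) = ‖v.1‖ / 8 by ring, hr, norm_neg, smul_neg]

/-- The difference of the centres of the regions labelled `a` and `b`. -/
def centreDiff {I : Type} [Finite I] (x : I → Colour) (y : Colour) (a b : I) :
    (swissCheese (l + 1)).obj I x y ⟶ TopCat.of (EuclideanSpace ℝ (Fin (l + 1))) :=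
  TopCat.ofHom ⟨fun f => (f.1 a).1 - (f.1 b).1,
    (((continuous_apply a).comp continuous_subtype_val).fst).sub
      (((continuous_apply b).comp continuous_subtype_val).fst)⟩

theorem someNonzero_of_ne_zero {v : EuclideanSpace ℝ (Fin (l + 1))} (h : v ≠ 0) :
    v ∈ someNonzero (l + 1) (l + 1) := by
  by_contra h'
  refine h ?_
  ext i
  by_contra hi
  exact h' ⟨i, i.2, hi⟩

theorem centre_mem_region {v : EuclideanSpace ℝ (Fin (l + 1)) × ℝ} (h : 0 < v.2) :
    v.1 ∈ region .closed v := Metric.mem_ball_self h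

theorem IsConfig.centre_ne {I : Type} {x : I → Colour} {y : Colour}
    {f : I → EuclideanSpace ℝ (Fin (l + 1)) × ℝ} (hf : IsConfig x y f) {a b : I}
    (ha : x a = .closed) (hb : x b = .closed) (hab : a ≠ b) : (f a).1 - (f b).1 ≠ 0 := by
  intro h
  have h1 := centre_mem_region (hf.radius_pos a)
  have h2 := centre_mem_region (hf.radius_pos b)
  rw [← ha] at h1
  rw [← hb] at h2
  rw [sub_eq_zero.1 h] at h1
  exact Set.disjoint_left.1 (hf.disjoint a b hab) h1 h2

/-- A ball disjoint from a half-ball is not vertically below a ball contained in this half-ball: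
otherwise its centre, which is in the upper half-space, is at least as close to the centre of the half-ball as the
centre of the other ball. -/
theorem IsConfig.diff_mem_posOrNonzero {I J : Type} {x : I → Colour} {z : J → Colour}
    {f : I → EuclideanSpace ℝ (Fin (l + 1)) × ℝ} (hf : IsConfig x .opened f)
    {g : J → EuclideanSpace ℝ (Fin (l + 1)) × ℝ} (hg : IsConfig z .opened g) {a b : I} {j : J}
    (ha : x a = .closed) (hb : x b = .opened) (hj : z j = .closed) :
    (f a).1 - (insertRegion (f b) (g j)).1 ∈ posOrNonzero (l + 1) l := by
  by_contra hcon
  simp only [posOrNonzero, someNonzero, Set.mem_ofPred_eq, not_or, not_exists, not_and, not_not,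
    not_lt] at hcon
  have hab : a ≠ b := by rintro rfl; rw [ha] at hb; cases hb
  have h1 : (f a).1 ∈ upperHalf (l + 1) := by
    have := centre_mem_region (hf.radius_pos a)
    rw [← ha] at this
    exact (hf.subset a this).2
  have h2 : ‖(g j).1‖ < 1 := by
    have := centre_mem_region (hg.radius_pos j)
    rw [← hj] at this
    simpa using (hg.subset j this).1
  have h3 := mem_boundary.1 (hf.centre_mem b hb)
  have hR := hf.radius_pos b
  have h4 : (f a).1 ∈ region (x b) (f b) := by
    rw [hb]
    refine ⟨?_, h1⟩
    rw [Metric.mem_ball, dist_eq_norm]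
    refine lt_of_le_of_lt (b := ‖(f b).2 • (g j).1‖) (norm_le_of_abs_le fun i => ?_) ?_
    · rw [mem_upperHalf] at h1
      have e : ∀ i, (insertRegion (f b) (g j)).1 i = (f b).1 i + ((f b).2 • (g j).1) i :=
        fun i => rfl
      rw [PiLp.sub_apply]
      by_cases hi : i = Fin.last l
      · subst hi
        have h5 := hcon.1 (Fin.last l) (by simp)
        rw [PiLp.sub_apply, e, h3, zero_add] at h5
        rw [h3, sub_zero, abs_of_pos h1]
        exact (by linarith : _ ≤ ((f b).2 • (g j).1) (Fin.last l)).trans (le_abs_self _)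
      · have h5 := hcon.2 i (by
          have := i.2
          have : (i : ℕ) ≠ l := fun h => hi (Fin.ext h)
          omega)
        rw [PiLp.sub_apply, e, sub_eq_zero] at h5
        rw [h5, add_sub_cancel_left]
    · rw [norm_smul, Real.norm_of_nonneg hR.le]
      nlinarith
  have h5 := centre_mem_region (hf.radius_pos a)
  rw [← ha] at h5
  exact Set.disjoint_left.1 (hf.disjoint a b hab) h5 h4

end Geometry

/-! ### Non-formality of the Swiss-cheese operad -/

section NonFormality
variable (l : ℕ)

/-- The difference of the centres of the two balls in the composites of an operation with two open
inputs and of an operation in each of them with one closed input. -/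
def ballDiff : (swissCheese (l + 1)).obj
    (Graft (Sum.inl ⟨1, one_ne_zero⟩ : Graft (0 : Fin 2) Unit) Unit)
    (graftColor (mixedColor 0) (Sum.inl ⟨1, one_ne_zero⟩) fun _ : Unit => .closed) .opened ⟶
      TopCat.of (EuclideanSpace ℝ (Fin (l + 1))) :=
  centreDiff _ _ (Sum.inl ⟨Sum.inr (), Sum.inr_ne_inl⟩) (Sum.inr ())

variable {l} {k : Type u} [Field k]

/-- The ball inserted in the half-ball number `0` is not vertically below the one inserted in the
half-ball number `1` when the second insertion is made in a configuration of a ball and a half-ball. -/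
theorem ballDiff_comp_mem_supp {p q n : ℤ} (h : p + q = n)
    (g : (chains k ((swissCheese (l + 1)).obj (Graft (0 : Fin 2) Unit) (mixedColor 0) .opened)).X p)
    (c : (chains k ((swissCheese (l + 1)).obj Unit (fun _ => .closed) .opened)).X q) :
    push (ballDiff l) n (((swissCheese (l + 1)).chains k).comp (mixedColor 0) .opened
      (Sum.inl ⟨1, one_ne_zero⟩ : Graft (0 : Fin 2) Unit) (fun _ : Unit => .closed) h g c) ∈
      supp k n (posOrNonzero (l + 1) l) :=
  (congrArg (· ∈ _) (map_cross (ballDiff l) ((swissCheese (l + 1)).comp (mixedColor 0) .opened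
    (Sum.inl ⟨1, one_ne_zero⟩ : Graft (0 : Fin 2) Unit) (fun _ : Unit => .closed)) h g c)).mpr
    (cross_mem_supp _ (fun z => by
      exact z.1.2.diff_mem_posOrNonzero z.2.2 (a := Sum.inr ()) (b := Sum.inl ⟨1, one_ne_zero⟩)
        (j := ()) rfl rfl rfl) h g c)

/-- The ball inserted in the half-ball number `0` is not vertically above the one inserted in the
half-ball number `1` when the first insertion is made in a configuration of a ball and a half-ball. -/
theorem ballDiff_swap_comp_mem_supp {p q n : ℤ} (h : p + q = n)
    (g : (chains k ((swissCheese (l + 1)).obj (Graft (1 : Fin 2) Unit) (mixedColor 1) .opened)).X p)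
    (b : (chains k ((swissCheese (l + 1)).obj Unit (fun _ => .closed) .opened)).X q) :
    push (ballDiff l) n (((((swissCheese (l + 1)).chains k).act (graftSwap zero_ne_one Unit Unit)
      (graftSwap_color (fun _ : Fin 2 => Colour.opened) (fun _ : Unit => .closed)
        (fun _ : Unit => .closed) zero_ne_one) .opened).f n).hom
      (((swissCheese (l + 1)).chains k).comp (mixedColor 1) .opened
      (Sum.inl ⟨0, zero_ne_one⟩ : Graft (1 : Fin 2) Unit) (fun _ : Unit => .closed) h g b)) ∈
      supp k n (negOrNonzero (l + 1) l) := by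
  refine (congrArg (· ∈ _) ((push_push _ _ n _).trans (map_cross _ ((swissCheese (l + 1)).comp
    (mixedColor 1) .opened (Sum.inl ⟨0, zero_ne_one⟩ : Graft (1 : Fin 2) Unit)
    (fun _ : Unit => .closed)) h g b))).mpr (cross_mem_supp _ (fun z => ?_) h g b)
  have := IsConfig.diff_mem_posOrNonzero z.1.2 z.2.2 (a := Sum.inr ())
      (b := Sum.inl ⟨0, zero_ne_one⟩) (j := ()) rfl rfl rfl
  rw [← neg_sub] at this
  exact this

/-- The composition with the class of a point of the operad is the insertion of this point. -/
theorem TopOperad.comp_gen_const {S : Type} (O : TopOperad S) {I J : Type} [Finite I] [Finite J]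
    (x : I → S) (y : S) (i : I) (z : J → S) (v : O.obj J z (x i)) {n : ℤ}
    (a : (SwissCheese.chains k (O.obj I x y)).X n) :
    (O.chains k).comp x y i z (add_zero n) a (gen 0 rfl (ContinuousMap.const _ v)) =
      push (TopCat.ofHom ((O.comp x y i z).comp
        ((ContinuousMap.id _).prodMk (ContinuousMap.const _ v)))) n a :=
  cross_gen_zero_right _ (add_zero n) _ v _ (fun _ => rfl) a

/-- The difference of the centres of the balls inserted in the half-balls of `openPair`. -/
theorem openPair_ballDiff : openPair l ≫ insertWhistle l (fun _ => .opened) .opened (0 : Fin 2) rfl ≫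
    insertWhistle l (mixedColor 0) .opened (Sum.inl ⟨1, one_ne_zero⟩) rfl ≫ ballDiff l =
      subIncl (X := TopCat.of (EuclideanSpace ℝ (Fin (l + 1)))) (equatorBall l) := by
  ext v : 1
  change ((1 / 2 : ℝ) • v.1 + (‖v.1‖ / 4) • (1 / 2 : ℝ) • lastVec l) -
    (-((1 / 2 : ℝ) • v.1) + (‖v.1‖ / 4) • (1 / 2 : ℝ) • lastVec l) = v.1
  rw [add_sub_add_right_eq_sub, sub_neg_eq_add, ← add_smul]
  norm_num

end NonFormality

section OpenSphere
variable (k : Type u) [Field k] (l : ℕ)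

theorem sphereChain_mem_equatorBall (n : ℤ) :
    sphereChain k (l + 1) n l ∈ supp k n (equatorBall l) := by
  refine supp_mono ?_ (sphereChain_mem k (l + 1) n l.le_succ)
  rintro v ⟨⟨i, hi, h⟩, hv, hv'⟩
  refine ⟨?_, hv, hv' _ le_rfl⟩
  rintro rfl
  exact h rfl

theorem hemisphere_mem_upperBall (n : ℤ) :
    hemisphere k (l + 1) n l true ∈ supp k n (upperBall l) := by
  refine supp_mono ?_ (hemisphere_mem k (l + 1) n l.lt_succ_self true)
  rintro v ⟨⟨i, hi, h⟩, hv, hv', hv''⟩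
  refine ⟨?_, hv, hv'' _ rfl⟩
  rintro rfl
  exact h rfl

/-- The sphere of the pairs of half-balls with centres `v / 2` and `-v / 2`, as a chain. It has
dimension `l - 1`, and it is meaningful for `n = l - 1`. -/
def openSphere (n : ℤ) :
    (chains k ((swissCheese (l + 1)).obj (Fin 2) (fun _ => .opened) .opened)).X n :=
  push (openPair l) n (restr (X := TopCat.of (EuclideanSpace ℝ (Fin (l + 1)))) n (equatorBall l)
    (sphereChain k (l + 1) n l))

theorem openSphere_mem_cycle (n : ℤ) : openSphere k l n ∈ Cycle _ n := by
  rw [LinearMap.mem_ker]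
  refine (bdy_push (openPair l) n (n - 1) _).trans ?_
  rw [bdy_restr (sphereChain_mem_equatorBall k l n), bdy_sphereChain k _ (by omega), map_zero,
    map_zero]

/-- The chain of dimension `0` given by the operation `whistle`. -/
def whistleChain : (chains k ((swissCheese (l + 1)).obj Unit (fun _ => .closed) .opened)).X 0 :=
  gen 0 rfl (ContinuousMap.const _ (whistle l))

theorem whistleChain_mem_cycle : whistleChain k l ∈ Cycle _ 0 :=
  chains_d_gen_zero _ _

theorem comp_whistleChain (i : Fin 2) {n : ℤ}
    (a : (chains k ((swissCheese (l + 1)).obj (Fin 2) (fun _ => .opened) .opened)).X n) :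
    ((swissCheese (l + 1)).chains k).comp (fun _ : Fin 2 => .opened) .opened i
      (fun _ : Unit => .closed) (add_zero n) a (whistleChain k l) =
      push (insertWhistle l (fun _ => .opened) .opened i rfl) n a :=
  (swissCheese (l + 1)).comp_gen_const (fun _ : Fin 2 => .opened) .opened i
    (fun _ : Unit => .closed) (whistle l) a

theorem bdy_cap (n : ℤ) : bdy k _ (n + 1) n
    (push (cap l) (n + 1) (restr (X := TopCat.of (EuclideanSpace ℝ (Fin (l + 1))))
      (n + 1) (upperBall l) (hemisphere k (l + 1) (n + 1) l true))) =
      ((swissCheese (l + 1)).chains k).comp (fun _ : Fin 2 => .opened) .opened 0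
        (fun _ : Unit => .closed) (add_zero n) (openSphere k l n) (whistleChain k l) := by
  have h : push (insertWhistle l (fun _ => .opened) .opened (0 : Fin 2) rfl) n (openSphere k l n) =
      bdy k _ (n + 1) n (push (cap l) (n + 1) (restr (X := TopCat.of (EuclideanSpace ℝ (Fin (l + 1))))
        (n + 1) (upperBall l) (hemisphere k (l + 1) (n + 1) l true))) := by
    rw [openSphere, push_push, openPair_insertWhistle_zero, ← push_push,
      push_restr_of_subset _ (sphereChain_mem_equatorBall k l n), bdy_push,
      bdy_restr (hemisphere_mem_upperBall k l (n + 1)), bdy_hemisphere k (l + 1) rfl]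
  exact h.symm.trans (comp_whistleChain k l 0 (openSphere k l n)).symm

theorem bdy_cap' (n : ℤ) : bdy k _ (n + 1) n
    (push (cap' l) (n + 1) (restr (X := TopCat.of (EuclideanSpace ℝ (Fin (l + 1))))
      (n + 1) (upperBall l) (hemisphere k (l + 1) (n + 1) l true))) =
      ((swissCheese (l + 1)).chains k).comp (fun _ : Fin 2 => .opened) .opened 1
        (fun _ : Unit => .closed) (add_zero n) (openSphere k l n) (whistleChain k l) := by
  have h : push (insertWhistle l (fun _ => .opened) .opened (1 : Fin 2) rfl) n (openSphere k l n) =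
      bdy k _ (n + 1) n (push (cap' l) (n + 1) (restr (X := TopCat.of (EuclideanSpace ℝ (Fin (l + 1))))
        (n + 1) (upperBall l) (hemisphere k (l + 1) (n + 1) l true))) := by
    rw [openSphere, push_push, openPair_insertWhistle_one, ← push_push,
      push_restr_of_subset _ (sphereChain_mem_equatorBall k l n), bdy_push,
      bdy_restr (hemisphere_mem_upperBall k l (n + 1)), bdy_hemisphere k (l + 1) rfl]
  exact h.symm.trans (comp_whistleChain k l 1 (openSphere k l n)).symm

/-- The difference of the centres maps the double composite of `openSphere` with balls to the sphere
`sphereChain`. -/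
theorem ballDiff_openSphere (n : ℤ) : push (ballDiff l) n
    (((swissCheese (l + 1)).chains k).comp (mixedColor 0) .opened
      (Sum.inl ⟨1, one_ne_zero⟩ : Graft (0 : Fin 2) Unit) (fun _ : Unit => .closed) (add_zero n)
      (((swissCheese (l + 1)).chains k).comp (fun _ : Fin 2 => .opened) .opened 0
        (fun _ : Unit => .closed) (add_zero n) (openSphere k l n) (whistleChain k l))
      (whistleChain k l)) = sphereChain k (l + 1) n l := by
  have h2 := (swissCheese (l + 1)).comp_gen_const (mixedColor 0) .opened
    (Sum.inl ⟨1, one_ne_zero⟩ : Graft (0 : Fin 2) Unit)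
    (fun _ : Unit => .closed) (whistle l) (push (insertWhistle l (fun _ => .opened) .opened
      (0 : Fin 2) rfl) n (openSphere k l n))
  have h3 : push (ballDiff l) n (push (insertWhistle l (mixedColor 0) .opened
      (Sum.inl ⟨1, one_ne_zero⟩) rfl) n (push (insertWhistle l (fun _ => .opened) .opened
      (0 : Fin 2) rfl) n (openSphere k l n))) = sphereChain k (l + 1) n l := by
    rw [openSphere, push_push, push_push, push_push, openPair_ballDiff,
      push_restr (sphereChain_mem_equatorBall k l n)]
  refine Eq.trans (congrArg (push (ballDiff l) n) ?_) h3
  refine Eq.trans (congrArg (fun v => ((swissCheese (l + 1)).chains k).comp (mixedColor 0) .opened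
    (Sum.inl ⟨1, one_ne_zero⟩ : Graft (0 : Fin 2) Unit) (fun _ : Unit => .closed) (add_zero n) v
    (whistleChain k l)) (comp_whistleChain k l 0 (openSphere k l n))) h2

end OpenSphere

section Hemispheres
variable {k : Type u} [Field k] {l : ℕ}

/-- If two chains, one in the set of the vectors above the horizontal hyperplane or off the vertical
axis and one in the opposite set, have for boundary the equator up to the boundary of a chain `e₂`
off the vertical axis, then their difference does not bound away from the origin. -/
theorem not_homologous_hemispheres {n : ℤ} (hn : (l : ℤ) = n)
    {a b e₂ : (chains k (TopCat.of (EuclideanSpace ℝ (Fin (l + 1 + 1))))).X (n + 1)}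
    {e : (chains k (TopCat.of (EuclideanSpace ℝ (Fin (l + 1 + 1))))).X (n + 1 + 1)}
    (ha : a ∈ supp k (n + 1) (posOrNonzero (l + 1 + 1) (l + 1)))
    (hb : b ∈ supp k (n + 1) (negOrNonzero (l + 1 + 1) (l + 1)))
    (he : e ∈ supp k (n + 1 + 1) (someNonzero (l + 1 + 1) (l + 1 + 1)))
    (h : a - b = bdy k _ (n + 1 + 1) (n + 1) e)
    (he₂ : e₂ ∈ supp k (n + 1) (someNonzero (l + 1 + 1) (l + 1)))
    (h₂ : bdy k _ (n + 1) n a = sphereChain k (l + 1 + 1) n (l + 1) + bdy k _ (n + 1) n e₂) :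
    False := by
  rw [← pos_union_neg] at he
  obtain ⟨N, c, e', hc, h'⟩ := mayerVietoris (isOpen_posOrNonzero _) (isOpen_negOrNonzero _)
    ha hb he h
  rw [pos_inter_neg] at hc
  refine sphereChain_ne_bdy l (by omega) hn rfl N
    (c - (subdiv k _ (n + 1) ^ N) e₂) (Submodule.sub_mem _ hc (subdiv_pow_mem_supp N he₂)) ?_
  have h3 := congrArg (bdy k _ (n + 1) n) h'
  rw [bdy_bdy, map_sub, sub_eq_zero, bdy_subdiv_pow, h₂, map_add] at h3
  rw [map_sub, bdy_subdiv_pow, ← h3, add_sub_cancel_right]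

end Hemispheres

/-- The Massey product of the class of `openSphere` with two balls is not zero: the difference of
the centres of the balls maps it to a sphere around the origin, cut in the hemispheres where the
last coordinate is positive or negative. -/
theorem not_isFormal_swissCheese (k : Type u) [Field k] (l : ℕ) :
    ¬ (swissCheese (l + 1 + 1)).IsFormal k := by
  rintro ⟨P, γ, ψ, hγ, hψ⟩
  obtain ⟨n, hn⟩ : ∃ n : ℤ, (l : ℤ) = n := ⟨_, rfl⟩
  have ha := openSphere_mem_cycle k (l + 1) n
  have hb := whistleChain_mem_cycle k (l + 1)
  obtain ⟨a', b', c', g₁, g₂, e, hg₁, he⟩ := DGOperad.exists_massey_eq_bdy γ ψ hγ hψ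
    (fun _ : Fin 2 => .opened) .opened zero_ne_one (fun _ : Unit => .closed)
    (fun _ : Unit => .closed) ha hb hb (bdy_cap k (l + 1) n) (bdy_cap' k (l + 1) n)
  -- The boundary of `g₁ ∘ c` is a double composite of cycles homologous to those of
  -- `ballDiff_openSphere`. It can be computed in both orders, so the chain `e₂` realizing the
  -- homology satisfies the conditions of both hemispheres: its image is off the vertical axis.
  obtain ⟨e₂, he₂, hc⟩ := ((swissCheese (l + 1 + 1)).chains k).comp_comp_homologous
    (fun _ : Fin 2 => .opened) .opened 0 (fun _ : Unit => .closed) (Sum.inl ⟨1, one_ne_zero⟩)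
    (fun _ : Unit => .closed) ha hb hb a' b' c'
    ((supp k (n + 1) (someNonzero (l + 1 + 1) (l + 1))).comap (push (ballDiff (l + 1)) (n + 1)))
    (fun p q r s h1 h2 a b c => by
      refine (congrArg (fun V => push (ballDiff (l + 1)) (n + 1) _ ∈ supp k (n + 1) V)
        (pos_inter_neg (d := l + 1 + 1) (l + 1))).mp
        (mem_supp_inter (ballDiff_comp_mem_supp h2 _ c) ?_)
      have h := ((swissCheese (l + 1 + 1)).chains k).comp_swap (fun _ : Fin 2 => .opened) .opened
        zero_ne_one (fun _ : Unit => .closed) (fun _ : Unit => .closed) h1 h2 (t := p + r) rfl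
        (by omega) a b c
      refine (congrArg (fun v => push (ballDiff (l + 1)) (n + 1) v ∈ _) h).mpr ?_
      exact (congrArg (· ∈ _) (map_zsmul (push (ballDiff (l + 1)) (n + 1)) _ _)).mpr
        (zsmul_mem (ballDiff_swap_comp_mem_supp (by omega) _ b) _))
  refine not_homologous_hemispheres hn (ballDiff_comp_mem_supp (add_zero _) g₁ _)
    (ballDiff_swap_comp_mem_supp (add_zero _) g₂ _) (push_mem_supp (ballDiff (l + 1))
      (V := Set.univ) ?_ (mem_supp_univ e)) (((map_sub (push (ballDiff (l + 1)) (n + 1)) _ _).symm.trans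
        (congrArg (push (ballDiff (l + 1)) (n + 1)) he)).trans (bdy_push _ _ _ _).symm) he₂ ?_
  · intro v _
    exact someNonzero_of_ne_zero (v.2.centre_ne rfl rfl Sum.inl_ne_inr)
  · have h := ((swissCheese (l + 1 + 1)).chains k).comp_bdy_left (mixedColor 0) .opened
      (Sum.inl ⟨1, one_ne_zero⟩ : Graft (0 : Fin 2) Unit) (fun _ : Unit => .closed) rfl rfl
      (add_zero (n + 1)) (add_zero n) g₁ (Submodule.add_mem _ hb (bdy_mem_cycle c'))
    refine (bdy_push (ballDiff (l + 1)) (n + 1) n _).trans ?_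
    refine (congrArg (push (ballDiff (l + 1)) n) (h.symm.trans ((congrArg (fun v =>
      ((swissCheese (l + 1 + 1)).chains k).comp (mixedColor 0) .opened
        (Sum.inl ⟨1, one_ne_zero⟩ : Graft (0 : Fin 2) Unit) (fun _ : Unit => .closed) (add_zero n)
        v _) hg₁).trans hc))).trans ?_
    exact (map_add (push (ballDiff (l + 1)) n) _ _).trans (congrArg₂ (· + ·)
      (ballDiff_openSphere k (l + 1) n) (bdy_push (ballDiff (l + 1)) (n + 1) n e₂).symm)

/-! ### Free involutions -/

section Involutions
variable {k : Type u} [Field k] {X : TopCat.{0}}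

/-- A path gives a chain of dimension `1` whose boundary is the difference of its endpoints. -/
theorem exists_bdy_eq_of_joined {x y : X} (h : Joined x y) : ∃ e : (chains k X).X 1,
    bdy k X 1 0 e = gen 0 rfl (ContinuousMap.const _ y) - gen 0 rfl (ContinuousMap.const _ x) := by
  obtain ⟨γ⟩ := h
  let σ : Simp 1 X := γ.toContinuousMap.comp
    (stdSimplexHomeomorphUnitInterval : C(stdSimplex ℝ (Fin 2), unitInterval))
  have h1 : ∀ i : Fin 2, σ.comp ⟨_, stdSimplex.continuous_map (S := ℝ) i.succAbove⟩ =
      ContinuousMap.const _ (σ (stdSimplex.vertex (i.succAbove 0))) := by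
    intro i
    ext t
    have ht : t = stdSimplex.vertex 0 := by
      have h : ∀ u : stdSimplex ℝ (Fin 1), u.1 0 = 1 := fun u => by simpa using u.2.2
      refine Subtype.ext (funext fun i => ?_)
      obtain rfl : i = 0 := Subsingleton.elim (α := Fin 1) _ _
      exact (h t).trans (h _).symm
    subst ht
    exact congrArg σ (stdSimplex.map_vertex _ _)
  refine ⟨gen 1 rfl σ, ?_⟩
  refine (chains_d_gen 0 rfl rfl σ).trans ?_
  rw [Fin.sum_univ_two, h1, h1]
  have h2 : σ (stdSimplex.vertex 0) = x :=
    (congrArg γ stdSimplexHomeomorphUnitInterval_zero).trans γ.source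
  have h3 : σ (stdSimplex.vertex 1) = y :=
    (congrArg γ stdSimplexHomeomorphUnitInterval_one).trans γ.target
  rw [show (0 : Fin 2).succAbove 0 = 1 from rfl, show (1 : Fin 2).succAbove 0 = 0 from rfl, h2, h3]
  simp [sub_eq_add_neg]

theorem cupWord_eq_zero {α : Type} (s : ℕ → α → k) {n j : ℕ} (hj : j < n) {c : k} {w : List α}
    (h : ∀ a ∈ w, s j a = c) : cupWord s n w = 0 := by
  induction n generalizing w with
  | zero => omega
  | succ n ih =>
    match w, h with
    | [], _ => rfl
    | [_], _ => rfl
    | a :: b :: u, h =>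
      rw [cupWord]
      rcases Nat.lt_succ_iff_lt_or_eq.1 hj with h' | rfl
      · rw [ih h' (fun a ha => h a (List.mem_cons_of_mem _ ha)), mul_zero]
      · rw [h a (by simp), h b (by simp), sub_self, zero_mul]

/-- A cup product of coboundaries vanishes on the simplices where one of the functions is
constant. -/
theorem cup_verts_eq_zero (s : ℕ → X → k) {n j : ℕ} (hj : j < n) {c : k} {U : Set X}
    (h : ∀ a ∈ U, s j a = c) {m : ℤ} {x : (chains k X).X m} (hx : x ∈ supp k m U) :
    cup s n (verts m x) = 0 := by
  refine map_eq_of_mem_supp (cup s n ∘ₗ verts m) 0 (fun m' hm σ hσ => ?_) hx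
  rw [LinearMap.comp_apply, verts_gen, cup, Finsupp.linearCombination_single, cupWord_eq_zero s hj,
    smul_zero, LinearMap.zero_apply]
  rintro a ha
  obtain ⟨i, rfl⟩ := (List.mem_ofFn' _ _).1 ha
  exact h _ (hσ _)

theorem cupWord_map_add_one {α : Type} {τ : α → α} {s : ℕ → α → k}
    (hs : ∀ j a, s j (τ a) = s j a + 1) (n : ℕ) (w : List α) :
    cupWord s n (w.map τ) = cupWord s n w := by
  induction n generalizing w with
  | zero => cases w <;> rfl
  | succ n ih =>
    match w with
    | [] => rfl
    | [_] => rfl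
    | a :: b :: u =>
      have := ih (b :: u)
      rw [List.map_cons] at this
      rw [List.map_cons, List.map_cons, cupWord, this, cupWord, hs, hs, add_sub_add_right_eq_sub]

theorem headCup_add_wmap [CharP k 2] {α : Type} {τ : α → α} {s : ℕ → α → k}
    (hs : ∀ j a, s j (τ a) = s j a + 1) (n : ℕ) (x : Words k α) :
    headCup s n (x + wmap τ x) = cup s n x := by
  refine words_ext (f := headCup s n ∘ₗ (LinearMap.id + wmap τ)) (g := cup s n) (fun w => ?_) x
  cases w with
  | nil => simp [headCup, cup, cupWord]
  | cons a u =>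
    have := cupWord_map_add_one hs n (a :: u)
    rw [List.map_cons] at this
    simp only [LinearMap.comp_apply, LinearMap.add_apply, LinearMap.id_apply, wmap_single,
      List.map_cons, map_add, headCup, cup, Finsupp.linearCombination_single, one_smul, this, hs]
    rw [add_mul, one_mul, ← add_assoc, CharTwo.add_self_eq_zero, zero_add]

/-- If the boundary of `x` is `(1 + τ) y`, then the cup product of `n + 1` coboundaries takes on `x`
the value of the cup product of the first `n` of them on `y`. -/
theorem cup_succ_verts [CharP k 2] {τ : X ⟶ X} {s : ℕ → X → k}
    (hs : ∀ j a, s j (τ a) = s j a + 1) (n : ℕ) {m : ℤ} (hm : (n : ℤ) = m)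
    {x : (chains k X).X (m + 1)} {y : (chains k X).X m} (h : bdy k X (m + 1) m x = y + push τ m y) :
    cup s (n + 1) (verts (m + 1) x) = cup s n (verts m y) := by
  have h1 : headCup s n (bdry (verts (m + 1) x)) = cup s (n + 1) (verts (m + 1) x) := by
    refine map_eq_of_mem_wspan (headCup s n ∘ₗ bdry) (cup s (n + 1)) (fun w hw => ?_) (verts_mem x)
    rw [LinearMap.comp_apply, bdry_single, (cup_bdry s n w (by omega)).2]
  rw [← h1, ← verts_bdy rfl (by omega), h, map_add, verts_push]
  exact headCup_add_wmap hs n _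

section Formal
variable [CharP k 2] {M : ChainComplex (ModuleCat.{u} k) ℤ} {t : M ⟶ M} (ht : t ≫ t = 𝟙 M)
  {τ : X ⟶ X} (γ : M ⟶ chains k X) (hγ : QuasiIso γ) (htγ : t ≫ γ = γ ≫ (chainsFunctor k).map τ)
  (ψ : M ⟶ (gradedHomology k).obj (chains k X)) (hψ : QuasiIso ψ)
  {θ : (gradedHomology k).obj (chains k X) ⟶ (gradedHomology k).obj (chains k X)}
  (htψ : t ≫ ψ = ψ ≫ θ)
include ht hγ htγ hψ htψ

/-- The chains `y` of successive degrees, each bounding the image of the previous one under `1 + t`.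
The cup product of the coboundaries of the `s j` takes the value `1` on the image of each of them in
the singular chains, and on its subdivisions. -/
theorem exists_tower {s : ℕ → X → k} (hs : ∀ j a, s j (τ a) = s j a + 1) {x : X}
    (hx : Joined x (τ x)) (n : ℕ) : ∀ m : ℤ, (n : ℤ) = m → ∃ (y : M.X m) (v : M.X (m + 1)),
      (M.d (m + 1) m).hom v = y + (t.f m).hom y ∧
        ∀ N, cup s n (verts m ((subdiv k X m ^ N) ((γ.f m).hom y))) = 1 := by
  have hcomm : ∀ m y, (γ.f m).hom ((t.f m).hom y) = push τ m ((γ.f m).hom y) := fun m y =>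
    congr(($(htγ).f m).hom y)
  have htt : ∀ m y, (t.f m).hom ((t.f m).hom y) = y := fun m y => congr(($(ht).f m).hom y)
  have h2 : ∀ (m : ℤ) (y : M.X m), y + y = 0 := fun m y => by
    rw [← two_smul k, CharTwo.two_eq_zero, zero_smul]
  have h2' : ∀ {m : ℤ} (a : (chains k X).X m), a + a = 0 := fun a => by
    rw [← two_smul k, CharTwo.two_eq_zero, zero_smul]
  induction n with
  | zero =>
    intro m hm
    obtain rfl : m = 0 := by simpa using hm.symm
    obtain ⟨e, he⟩ : ∃ e : (chains k X).X (0 + 1), bdy k X (0 + 1) 0 e =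
        gen 0 rfl (ContinuousMap.const _ (τ x)) - gen 0 rfl (ContinuousMap.const _ x) :=
      exists_bdy_eq_of_joined hx
    obtain ⟨y, hy, w, hw⟩ := exists_cycle_lift γ (n := 0) (LinearMap.mem_ker.2
      (chains_d_gen_zero (k := k) (n' := 0 - 1) rfl (ContinuousMap.const _ x)))
    have hy' : y + (t.f 0).hom y ∈ Cycle M 0 := by
      rw [LinearMap.mem_ker] at hy ⊢
      rw [map_add, hom_bdy, hy, map_zero, add_zero]
    have hτ : push τ 0 (gen (k := k) 0 rfl (ContinuousMap.const _ x)) =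
        gen 0 rfl (ContinuousMap.const _ (τ x)) := chains_map_gen _ _ _ _
    obtain ⟨v, hv⟩ := exists_bdy_of_map_bdy γ hy' (w := e + w + push τ (0 + 1) w) (by
      rw [map_add (γ.f 0).hom, hcomm, hw, map_add (push τ 0), hτ, map_add, map_add]
      refine (congrArg₂ (fun a b => a + (bdy k X (0 + 1) 0 w) + b) he (bdy_push τ (0 + 1) 0 w)).trans
        ?_
      rw [sub_eq_add_neg, neg_eq_of_add_eq_zero_left (h2' (gen 0 rfl (ContinuousMap.const _ x)))]
      abel)
    refine ⟨y, v, hv, fun N => ?_⟩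
    rw [subdiv_pow_zero, hw, map_add, map_add, verts_gen]
    refine (congrArg₂ (· + ·) ?_ (cup_zero_bdy s w)).trans (add_zero 1)
    simp [cup, cupWord]
  | succ n ih =>
    intro m hm
    obtain rfl : m = (n : ℤ) + 1 := by push_cast at hm; exact hm.symm
    obtain ⟨y, v, hv, hy⟩ := ih n rfl
    -- The choice of `y'` in the kernel of `ψ` makes `y' + t y'` a cycle in this kernel, hence a
    -- boundary.
    obtain ⟨y', hy', hψ'⟩ := exists_bdy_map_eq_zero ψ hψ v
    rw [hv] at hy'
    have hcyc : y' + (t.f (n + 1)).hom y' ∈ Cycle M (n + 1) := by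
      rw [mem_cycle_iff (n' := (n : ℤ)) rfl, map_add, hom_bdy, hy', map_add, htt]
      rw [add_comm ((t.f n).hom y), h2]
    obtain ⟨v', hv'⟩ := exists_bdy_of_map_zero ψ hψ hcyc (by
      have := congr(($(htψ).f (n + 1)).hom y')
      refine (map_add _ _ _).trans ?_
      rw [hψ', zero_add]
      refine this.trans ?_
      refine (congrArg ((θ.f (n + 1)).hom) hψ').trans (map_zero _))
    refine ⟨y', v', hv', fun N => ?_⟩
    rw [← hy N]
    refine cup_succ_verts hs n rfl ?_
    rw [bdy_subdiv_pow, bdy, hom_bdy, hy', map_add, map_add, hcomm, push_subdiv_pow]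

/-- If a free involution of `X` moves a point along a path, and if odd functions `g₀, …, g_{d-1}`
on `X` have no common zero, then in characteristic `2` the singular chains of `X` are not formal as
a complex with involution. -/
theorem false_of_formal_of_odd (hττ : ∀ x, τ (τ x) = x) (hfree : ∀ x, τ x ≠ x) {d : ℕ}
    {g : ℕ → X → ℝ} (hg : ∀ j, Continuous (g j)) (hodd : ∀ j x, g j (τ x) = - g j x)
    (hzero : ∀ x, ∃ j < d, g j x ≠ 0) {x : X} (hx : Joined x (τ x)) : False := by
  classical
  -- The indicator functions of halves of `X` exchanged by `τ`: `g j` is positive on one half and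
  -- negative on the other half, and the zeros of `g j` are shared out by means of a well-ordering.
  let s : ℕ → X → k := fun j a =>
    if 0 < g j a ∨ g j a = 0 ∧ WellOrderingRel a (τ a) then 1 else 0
  have hs : ∀ j a, s j (τ a) = s j a + 1 := by
    intro j a
    have h2 : (1 : k) + 1 = 0 := CharTwo.add_self_eq_zero 1
    simp only [s, hodd, hττ]
    rcases lt_trichotomy (g j a) 0 with h | h | h
    · simp [h, h.not_gt, h.ne]
    · rcases trichotomous_of WellOrderingRel a (τ a) with h' | h' | h'
      · simp [h, h', asymm_of WellOrderingRel h', h2]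
      · exact absurd h'.symm (hfree a)
      · simp [h, h', asymm_of WellOrderingRel h']
    · simp [h, h.not_gt, h.ne', h2]
  obtain ⟨y, v, -, hy⟩ := exists_tower ht γ hγ htγ ψ hψ htψ hs hx d d rfl
  let U : Fin d × Bool → Set X := fun a =>
    {x | cond a.2 (0 < g a.1 x) (g a.1 x < 0)}
  have hU : ∀ a, IsOpen (U a) := by
    rintro ⟨j, b⟩
    cases b
    · exact isOpen_lt (hg j) continuous_const
    · exact isOpen_lt continuous_const (hg j)
  have hcover : (Set.univ : Set X) ⊆ ⋃ a, U a := by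
    intro x _
    obtain ⟨j, hj, h⟩ := hzero x
    rcases h.lt_or_gt with h | h
    · exact Set.mem_iUnion.2 ⟨(⟨j, hj⟩, false), h⟩
    · exact Set.mem_iUnion.2 ⟨(⟨j, hj⟩, true), h⟩
  obtain ⟨N, hN⟩ := (eventually_subdiv_mem hU hcover (mem_supp_univ ((γ.f d).hom y))).exists
  refine one_ne_zero ((hy N).symm.trans ?_)
  have hle : ⨆ a, supp k d (U a) ≤ LinearMap.ker (cup s d ∘ₗ verts (k := k) (X := X) d) := by
    refine iSup_le fun a z hz => ?_
    obtain ⟨j, b⟩ := a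
    refine cup_verts_eq_zero s j.2 (c := cond b 1 0) (fun a ha => ?_) hz
    cases b
    · have h : g j a < 0 := ha
      simp [s, h.not_gt, h.ne]
    · have h : 0 < g j a := ha
      simp [s, h]
  exact hle hN

end Formal

end Involutions

/-! ### The exchange of two balls -/

section ClosedPairs
variable (l : ℕ)

/-- The exchange of the labels of two balls. -/
def swapBalls : (swissCheese (l + 1)).obj (Fin 2) (fun _ => .closed) .closed ⟶
    (swissCheese (l + 1)).obj (Fin 2) (fun _ => .closed) .closed :=
  (swissCheese (l + 1)).act (Equiv.swap 0 1) (fun _ => rfl) .closed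

variable {l}

theorem closedPair_neg {v : EuclideanSpace ℝ (Fin (l + 1))} (hv : v ∈ puncturedBall l)
    (hv' : -v ∈ puncturedBall l) :
    swapBalls l (closedPair l ⟨v, hv⟩) = closedPair l ⟨-v, hv'⟩ := by
  refine Subtype.ext (funext fun i => ?_)
  change pairRegions v (Equiv.swap 0 1 i) = pairRegions (-v) i
  fin_cases i <;> simp [pairRegions]

/-- Two balls can be exchanged along a path, in dimension at least `2`. -/
theorem joined_swapBalls (hl : 1 ≤ l) : ∃ x, Joined x (swapBalls l x) := by
  have hr : 1 < Module.rank ℝ (EuclideanSpace ℝ (Fin (l + 1))) := by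
    rw [rank_eq_card_basis (EuclideanSpace.basisFun (Fin (l + 1)) ℝ).toBasis, Fintype.card_fin]
    exact_mod_cast Nat.lt_succ_of_le hl
  have hmem : ∀ v ∈ Metric.sphere (0 : EuclideanSpace ℝ (Fin (l + 1))) 1, v ∈ puncturedBall l := by
    intro v hv
    rw [mem_sphere_zero_iff_norm] at hv
    exact ⟨norm_ne_zero_iff.1 (by rw [hv]; exact one_ne_zero), hv.le⟩
  have h1 : lastVec l ∈ Metric.sphere (0 : EuclideanSpace ℝ (Fin (l + 1))) 1 := by
    rw [mem_sphere_zero_iff_norm, norm_lastVec]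
  have h2 : -lastVec l ∈ Metric.sphere (0 : EuclideanSpace ℝ (Fin (l + 1))) 1 := by
    rw [mem_sphere_zero_iff_norm, norm_neg, norm_lastVec]
  have h := ((isPathConnected_sphere hr 0 zero_le_one).joinedIn _ h1 _ h2).mono hmem
  refine ⟨closedPair l ⟨lastVec l, hmem _ h1⟩, ?_⟩
  rw [closedPair_neg _ (hmem _ h2)]
  exact h.joined_subtype.map (closedPair l).hom.continuous

theorem not_isFormalModule_swissCheese (k : Type u) [Field k] [CharP k 2] (hl : 1 ≤ l) :
    ¬ IsFormalModule (((swissCheese (l + 1)).chains k).symModule 2 .closed .closed) := by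
  rintro ⟨M, γ, ψ, hγ, hψ⟩
  obtain ⟨x, hx⟩ := joined_swapBalls hl
  have hM : M.ρ (Equiv.swap 0 1) ≫ M.ρ (Equiv.swap 0 1) = 𝟙 M.V := by
    have := (map_mul M.ρ (Equiv.swap 0 1) (Equiv.swap 0 1)).symm
    rwa [Equiv.swap_mul_self, map_one] at this
  let g : ℕ → (swissCheese (l + 1)).obj (Fin 2) (fun _ => .closed) .closed → ℝ := fun j f =>
    if h : j < l + 1 then centreDiff (fun _ => .closed) .closed (0 : Fin 2) 1 f ⟨j, h⟩ else 0
  refine false_of_formal_of_odd (X := (swissCheese (l + 1)).obj (Fin 2) (fun _ => .closed) .closed)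
    (τ := swapBalls l) hM γ.hom hγ (γ.comm (Equiv.swap 0 1)) ψ.hom hψ (ψ.comm (Equiv.swap 0 1))
    (d := l + 1) (g := g) (fun f => ?_) (fun f hf => ?_) (fun j => ?_) (fun j f => ?_)
    (fun f => ?_) hx
  · refine Subtype.ext (funext fun i => ?_)
    exact congrArg f.1 (Equiv.swap_apply_self 0 1 i)
  · have h := congrArg (fun f => (f.1 0).1) hf
    exact f.2.centre_ne (a := 1) (b := 0) rfl rfl one_ne_zero (sub_eq_zero.2 h)
  · by_cases h : j < l + 1
    · simp only [g, dif_pos h]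
      fun_prop
    · simp only [g, dif_neg h]
      exact continuous_const
  · by_cases h : j < l + 1
    · simp only [g, dif_pos h]
      exact (neg_sub (((f.1 0).1 : EuclideanSpace ℝ (Fin (l + 1))) ⟨j, h⟩) ((f.1 1).1 ⟨j, h⟩)).symm
    · simp only [g, dif_neg h, neg_zero]
  · have h := f.2.centre_ne (a := 0) (b := 1) rfl rfl zero_ne_one
    obtain ⟨i, hi, h⟩ := someNonzero_of_ne_zero h
    refine ⟨i, hi, ?_⟩
    simp only [g, dif_pos hi]
    exact h

end ClosedPairs

end SwissCheese
end

theorem mainTheorem2 (d : ℕ) (hd : 3 ≤ d) (k : Type u) [Field k] :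
    ¬ (SwissCheese.swissCheese d).IsFormal k ∧
      (CharP k 2 → ¬ SwissCheese.IsFormalModule
        (((SwissCheese.swissCheese d).chains k).symModule 2 .closed .closed)) := by
  obtain ⟨l, rfl⟩ : ∃ l, d = l + 1 + 1 := ⟨d - 2, by omega⟩
  exact ⟨SwissCheese.not_isFormal_swissCheese k l,
    fun _ => SwissCheese.not_isFormalModule_swissCheese k (by omega)⟩
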